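/- Let $\mathbb{D}$ be the unit disk of $\mathbb{C}$ with its Poincaré distance $d_P$, normalized by $d_P(0,\xi)=\ln\frac{1+|\xi|}{1-|\xi|}$. A \emph{Fuchsian group} is a subgroup $\Gamma$ of the group $\mathrm{Aut}(\mathbb{D})$ of biholomorphisms of $\mathbb{D}$ such that, for every compact $K\subset\mathbb{D}$, the set $\{\alpha\in\Gamma : \alpha(K)\cap K\neq\emptyset\}$ is finite. Let $g\in\mathbb{N}$ with $g\geq 2$ and let $\varepsilon>0$. Then there exist a Fuchsian group $\Gamma_\varepsilon$ such that $\mathbb{D}/\Gamma_\varepsilon$ is a compact smooth Riemann surface (that is, without orbifold points: no element of $\Gamma_\varepsilon$ other than $\mathrm{id}$ has a fixed point in $\mathbb{D}$) of genus $g$, a finite set of generators $\mathcal{G}_\varepsilon$ of $\Gamma_\varepsilon$ with $\mathcal{G}_\varepsilon=\mathcal{G}_\varepsilon^{-1}$ and $\mathrm{id}\notin\mathcal{G}_\varepsilon$, and an element $\alpha_\varepsilon\in\mathcal{G}_\varepsilon$ such that $d_P(0,\alpha_\varepsilon(0))\leq\varepsilon$. -/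

import Mathlib

open Complex
open scoped Complex.UnitDisc Manifold ContDiff

noncomputable section

/-- The complex structure of the open unit disc `𝔻`: its only chart is the inclusion in `ℂ`. -/
instance instChartedSpaceUnitDisc : ChartedSpace ℂ 𝔻 :=
  Topology.IsOpenEmbedding.singletonChartedSpace (f := (UnitDisc.coe : 𝔻 → ℂ))
    (Metric.isOpen_ball.isOpenEmbedding_subtypeVal)

/-- `Aut(𝔻)`: the group of biholomorphic bijections of the unit disc. -/
def DiscAut : Subgroup (Equiv.Perm 𝔻) where
  carrier := {f | MDifferentiable 𝓘(ℂ) 𝓘(ℂ) (f : 𝔻 → 𝔻) ∧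
    MDifferentiable 𝓘(ℂ) 𝓘(ℂ) (f.symm : 𝔻 → 𝔻)}
  one_mem' := ⟨mdifferentiable_id, mdifferentiable_id⟩
  mul_mem' := fun ha hb => ⟨ha.1.comp hb.1, hb.2.comp ha.2⟩
  inv_mem' := fun ha => ⟨ha.2, ha.1⟩

/-- The Poincaré distance of the unit disc (curvature `-1`),
`d(z, w) = log ((1 + δ) / (1 - δ))` with `δ = |z - w| / |1 - z̄ w|`;
in particular `d(0, w) = log ((1 + |w|) / (1 - |w|))`. -/
def poincareDist (z w : 𝔻) : ℝ :=
  Real.log ((1 + ‖((z : ℂ) - w) / (1 - (starRingEnd ℂ) (z : ℂ) * w)‖) /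
    (1 - ‖((z : ℂ) - w) / (1 - (starRingEnd ℂ) (z : ℂ) * w)‖))

/-- A subgroup `Γ` of `Aut(𝔻)` is Fuchsian if it acts properly discontinuously on `𝔻`: for every
compact `K`, only finitely many `γ ∈ Γ` satisfy `γ(K) ∩ K ≠ ∅`. -/
def IsFuchsian (Γ : Subgroup DiscAut) : Prop :=
  ∀ K : Set 𝔻, IsCompact K →
    {γ : DiscAut | γ ∈ Γ ∧ (((fun z : 𝔻 => γ • z) '' K) ∩ K).Nonempty}.Finite

/-- The quotient space `𝔻 / Γ` of orbits, with the quotient topology. -/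
abbrev DiscQuotient (Γ : Subgroup DiscAut) : Type := MulAction.orbitRel.Quotient Γ 𝔻

/-- The projection `𝔻 → 𝔻 / Γ`. -/
def discProj (Γ : Subgroup DiscAut) (z : 𝔻) : DiscQuotient Γ :=
  Quotient.mk (MulAction.orbitRel Γ 𝔻) z

/-- `𝔻 / Γ` is a smooth Riemann surface (without orbifold points): no element of `Γ` other than the
identity has a fixed point, the quotient is Hausdorff, and it carries a complex structure of
dimension one for which the projection `𝔻 → 𝔻 / Γ` is a local biholomorphism.  (The quotient is
connected, as the image of `𝔻`.) -/
def IsSmoothQuotient (Γ : Subgroup DiscAut) : Prop :=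
  (∀ γ ∈ Γ, γ ≠ 1 → ∀ z : 𝔻, γ • z ≠ z) ∧
  T2Space (DiscQuotient Γ) ∧
  ∃ _ : ChartedSpace ℂ (DiscQuotient Γ),
    IsManifold 𝓘(ℂ) ω (DiscQuotient Γ) ∧
    IsLocalDiffeomorph 𝓘(ℂ) 𝓘(ℂ) ω (discProj Γ)

/-- The point of the unit circle at parameter `t`, where the circle is divided into `4 g` arcs of
equal length, the `j`-th of which is the image of `[j, j + 1]`. -/
def circlePoint (g : ℕ) (t : ℝ) : ℂ :=
  Complex.exp (((2 * Real.pi * t / (4 * g) : ℝ) : ℂ) * Complex.I)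

/-- The side pairing on the boundary of the closed disc, seen as a `4 g`-gon whose boundary reads
`a₁ b₁ a₁⁻¹ b₁⁻¹ ⋯ a_g b_g a_g⁻¹ b_g⁻¹`. -/
inductive SidePairing (g : ℕ) : Metric.closedBall (0 : ℂ) 1 → Metric.closedBall (0 : ℂ) 1 → Prop
  | a (k : ℕ) (hk : k < g) (s : ℝ) (hs : s ∈ Set.Icc (0 : ℝ) 1)
      (z w : Metric.closedBall (0 : ℂ) 1)
      (hz : (z : ℂ) = circlePoint g (4 * k + s))
      (hw : (w : ℂ) = circlePoint g (4 * k + 3 - s)) : SidePairing g z w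
  | b (k : ℕ) (hk : k < g) (s : ℝ) (hs : s ∈ Set.Icc (0 : ℝ) 1)
      (z w : Metric.closedBall (0 : ℂ) 1)
      (hz : (z : ℂ) = circlePoint g (4 * k + 1 + s))
      (hw : (w : ℂ) = circlePoint g (4 * k + 4 - s)) : SidePairing g z w

/-- The standard closed orientable surface of genus `g ≥ 1`: the quotient of the `4 g`-gon by its
side pairing (that is, by the equivalence relation generated by it), with the quotient topology. -/
abbrev StandardSurface (g : ℕ) : Type := Quot (SidePairing g)

/-- A topological space is a closed orientable surface of genus `g` (for `g ≥ 1`) if it is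
homeomorphic to the standard one. -/
def HasGenus (X : Type) [TopologicalSpace X] (g : ℕ) : Prop :=
  Nonempty (X ≃ₜ StandardSurface g)

end

noncomputable section

open Set Topology Filter

/-! ### The complex manifold structure of the disc -/

/-! Take a hyperbolic quadrilateral with angles π/2, π/(2g), π/2, π/(2g), two of whose opposite
sides (numbered 1 and 3) are at distance d = ε/2. Its shape is free enough that d can be any
positive number. The reflections in its sides generate a discrete group, a quotient of the Coxeter
group W of `quadMatrix`. The product of the reflections in sides 1 and 3 is a translation of length
2d = ε along their common perpendicular, which passes through 0.

The surface is tiled by 4g copies of the quadrilateral. Placed around the vertex where sides 0 and 3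
meet, they form a 4g-gon in which each tile contains one corner, and sides 1 and 2 of the tiles are
the halves of the edges of this polygon. Gluing the edges by a₁ b₁ a₁⁻¹ b₁⁻¹ ⋯ prescribes the
neighbour of each tile across each side, that is, an action of W on the 4g tiles (`tilePerm`,
`tileAction`). The Fuchsian group is the image of the stabiliser of one tile.

Three facts about this stabiliser carry the proof. (1) Discreteness and the fundamental domain come
from Tits' theorem (`HyperbolicMirrors.eq_and_mem_closure_of_action_eq`): two points of the chamber
in the same orbit coincide, and stabilisers are generated by the reflections in the sides through
the point. (2) Such point stabilisers are trivial or generated by one side or two adjacent sides,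
and they act freely on the tiles (`eq_one_of_mem_closure_pair`), so the surface group acts freely on
the disc. Every reflection changes the parity of the tile, so elements fixing a tile are
holomorphic. (3) The disc quotient and the standard surface are both quotients of (tiles) × [0,1]²,
with the same fibres, hence are homeomorphic.

As generators one takes the nontrivial elements moving a large compact set K to meet itself. They
generate as soon as K contains all the tiles, and K may be enlarged so that the short translation is
among them. -/

theorem UnitDisc.isOpenEmbedding_coe : IsOpenEmbedding (UnitDisc.coe : 𝔻 → ℂ) :=
  Metric.isOpen_ball.isOpenEmbedding_subtypeVal

theorem UnitDisc.range_coe : range (UnitDisc.coe : 𝔻 → ℂ) = Metric.ball 0 1 :=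
  Subtype.range_coe

instance : T2Space 𝔻 := UnitDisc.isEmbedding_coe.t2Space

instance : LocallyCompactSpace 𝔻 := UnitDisc.isOpenEmbedding_coe.locallyCompactSpace

theorem UnitDisc.contMDiff_coe : ContMDiff 𝓘(ℂ) 𝓘(ℂ) ω (UnitDisc.coe : 𝔻 → ℂ) :=
  contMDiff_isOpenEmbedding UnitDisc.isOpenEmbedding_coe

/-- The inverse of the inclusion of the disc, as an open partial homeomorphism. -/
def UnitDisc.chart : OpenPartialHomeomorph 𝔻 ℂ :=
  UnitDisc.isOpenEmbedding_coe.toOpenPartialHomeomorph UnitDisc.coe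

@[simp] theorem UnitDisc.chart_symm_coe (z : 𝔻) : UnitDisc.chart.symm (z : ℂ) = z :=
  UnitDisc.chart.left_inv (mem_univ z)

theorem UnitDisc.chart_target : UnitDisc.chart.target = Metric.ball 0 1 := by
  rw [UnitDisc.chart, Topology.IsOpenEmbedding.toOpenPartialHomeomorph_target,
    UnitDisc.range_coe]

theorem UnitDisc.contMDiffOn_chart_symm :
    ContMDiffOn 𝓘(ℂ) 𝓘(ℂ) ω UnitDisc.chart.symm (Metric.ball 0 1) := by
  rw [← UnitDisc.range_coe]
  exact contMDiffOn_isOpenEmbedding_symm UnitDisc.isOpenEmbedding_coe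

/-- A map into the disc is analytic as soon as its composition with the inclusion is. -/
theorem UnitDisc.contMDiffAt_of_coe {M : Type*} [TopologicalSpace M] [ChartedSpace ℂ M]
    {f : M → 𝔻} {x : M} (hf : ContMDiffAt 𝓘(ℂ) 𝓘(ℂ) ω (fun y => (f y : ℂ)) x) :
    ContMDiffAt 𝓘(ℂ) 𝓘(ℂ) ω f x := by
  have h : f = UnitDisc.chart.symm ∘ fun y => (f y : ℂ) := by ext; simp
  rw [h]
  refine ContMDiffAt.comp x (UnitDisc.contMDiffOn_chart_symm.contMDiffAt ?_) hf
  exact Metric.isOpen_ball.mem_nhds (by simpa using (f x).norm_lt_one)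

theorem UnitDisc.contMDiff_of_differentiableOn {f : 𝔻 → 𝔻} {F : ℂ → ℂ}
    (hF : DifferentiableOn ℂ F (Metric.ball 0 1)) (hf : ∀ z, (f z : ℂ) = F z) :
    ContMDiff 𝓘(ℂ) 𝓘(ℂ) ω f := by
  intro z
  apply UnitDisc.contMDiffAt_of_coe
  simp_rw [hf]
  have h1 : ContDiffAt ℂ ω F z := (hF.contDiffOn Metric.isOpen_ball).contDiffAt
    (Metric.isOpen_ball.mem_nhds (by simpa using z.norm_lt_one))
  exact h1.contMDiffAt.comp z (UnitDisc.contMDiff_coe z)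

/-- Holomorphic self-maps of the disc are analytic. -/
theorem UnitDisc.contMDiff_of_mdifferentiable {f : 𝔻 → 𝔻}
    (hf : MDifferentiable 𝓘(ℂ) 𝓘(ℂ) f) : ContMDiff 𝓘(ℂ) 𝓘(ℂ) ω f := by
  refine UnitDisc.contMDiff_of_differentiableOn (F := fun w => f (UnitDisc.chart.symm w)) ?_
    (by simp)
  intro w hw
  have h1 := (UnitDisc.contMDiff_coe.mdifferentiable (by simp)).comp hf
  have h2 := UnitDisc.contMDiffOn_chart_symm.contMDiffAt (Metric.isOpen_ball.mem_nhds hw)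
  have h3 := (h1 _).comp w (h2.mdifferentiableAt (by simp))
  exact (mdifferentiableAt_iff_differentiableAt.1 h3).differentiableWithinAt

/-! ### The quotient of the disc by a Fuchsian group acting freely -/

theorem DiscAut.contMDiff_smul (γ : DiscAut) : ContMDiff 𝓘(ℂ) 𝓘(ℂ) ω (fun z : 𝔻 => γ • z) :=
  UnitDisc.contMDiff_of_mdifferentiable γ.2.1

instance (Γ : Subgroup DiscAut) : ContinuousConstSMul Γ 𝔻 :=
  ⟨fun γ => (DiscAut.contMDiff_smul γ.1).continuous⟩

theorem IsFuchsian.properlyDiscontinuousSMul {Γ : Subgroup DiscAut} (hΓ : IsFuchsian Γ) :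
    ProperlyDiscontinuousSMul Γ 𝔻 where
  finite_disjoint_inter_image {K L} hK hL := by
    refine Finite.of_finite_image (f := Subtype.val) ?_ Subtype.val_injective.injOn
    refine (hΓ (K ∪ L) (hK.union hL)).subset ?_
    rintro _ ⟨γ, ⟨z, ⟨x, hx, rfl⟩, hz⟩, rfl⟩
    exact ⟨γ.2, _, ⟨x, Or.inl hx, rfl⟩, Or.inr hz⟩

theorem isCancelSMul_of_free {Γ : Subgroup DiscAut}
    (h : ∀ γ ∈ Γ, γ ≠ 1 → ∀ z : 𝔻, γ • z ≠ z) : IsCancelSMul Γ 𝔻 where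
  left_cancel' a b c := fun hbc => MulAction.injective a hbc
  right_cancel' a b c hab := by
    by_contra hne
    refine h (b⁻¹ * a : Γ) (b⁻¹ * a : Γ).2 ?_ c ?_
    · intro h1
      exact hne (inv_mul_eq_one.1 (Subtype.ext h1)).symm
    · have : (b⁻¹ * a) • c = c := by rw [mul_smul, hab, inv_smul_smul]
      exact this

section Quotient

variable {Γ : Subgroup DiscAut}

theorem exists_smul_of_discProj_eq {z w : 𝔻} (h : discProj Γ z = discProj Γ w) :
    ∃ γ ∈ Γ, γ • z = w := by
  obtain ⟨γ, hγ⟩ := Quotient.exact h.symm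
  exact ⟨γ, γ.2, hγ⟩

theorem discProj_smul {γ : DiscAut} (hγ : γ ∈ Γ) (z : 𝔻) : discProj Γ (γ • z) = discProj Γ z :=
  Quotient.sound (MulAction.orbitRel_apply.2 ⟨⟨γ, hγ⟩, rfl⟩)

/-- Two local sections of the projection differ by an element of the group. -/
theorem exists_localInverse_eventuallyEq (hl : IsLocalHomeomorph (discProj Γ)) {p p' : 𝔻}
    {y : DiscQuotient Γ} (hy : y ∈ (hl.localInverseAt p).source)
    (hy' : y ∈ (hl.localInverseAt p').source) :
    ∃ γ ∈ Γ, hl.localInverseAt p' =ᶠ[𝓝 y] fun x => γ • hl.localInverseAt p x := by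
  have h1 := hl.apply_localInverseAt_of_mem hy
  have h2 := hl.apply_localInverseAt_of_mem hy'
  obtain ⟨γ, hγ, h3⟩ := exists_smul_of_discProj_eq (h1.trans h2.symm)
  refine ⟨γ, hγ, ?_⟩
  have hc : ContinuousAt (fun x => γ • hl.localInverseAt p x) y :=
    (DiscAut.contMDiff_smul γ).continuous.continuousAt.comp
      ((hl.localInverseAt p).continuousAt hy)
  have h4 : (hl.localInverseAt p').target ∈ 𝓝 (γ • hl.localInverseAt p y) :=
    (hl.localInverseAt p').open_target.mem_nhds (h3 ▸ (hl.localInverseAt p').map_source hy')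
  filter_upwards [hc h4, (hl.localInverseAt p).open_source.mem_nhds hy,
    (hl.localInverseAt p').open_source.mem_nhds hy'] with x hx hx1 hx2
  refine hl.injOn_localInverseAt_target ((hl.localInverseAt p').map_source hx2) hx ?_
  rw [hl.apply_localInverseAt_of_mem hx2, discProj_smul hγ, hl.apply_localInverseAt_of_mem hx1]

/-- The quotient of the disc by a Fuchsian group acting freely is a Riemann surface. -/
theorem IsFuchsian.isSmoothQuotient (hΓ : IsFuchsian Γ)
    (hfree : ∀ γ ∈ Γ, γ ≠ 1 → ∀ z : 𝔻, γ • z ≠ z) : IsSmoothQuotient Γ := by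
  have := hΓ.properlyDiscontinuousSMul
  have := isCancelSMul_of_free hfree
  refine ⟨hfree, t2Space_of_properlyDiscontinuousSMul_of_t2Space, ?_⟩
  have hl : IsLocalHomeomorph (discProj Γ) :=
    (isQuotientCoveringMap_quotientMk_of_properlyDiscontinuousSMul
      (E := 𝔻) (G := Γ)).isCoveringMap.isLocalHomeomorph
  have hsurj : Function.Surjective (discProj Γ) := Quotient.mk_surjective
  obtain ⟨g, hg⟩ := hsurj.hasRightInverse
  -- The charts are the local sections of the projection, followed by the inclusion of the disc in
  -- ℂ.
  let cs : ChartedSpace ℂ (DiscQuotient Γ) := hl.chartedSpaceOfRightInverse hg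
  have hchart : ∀ q, chartAt ℂ q = (hl.localInverseAt (g q)).trans UnitDisc.chart := fun q => rfl
  have hman : IsManifold 𝓘(ℂ) ω (DiscQuotient Γ) := by
    apply isManifold_of_contDiffOn
    rintro _ _ ⟨q, rfl⟩ ⟨q', rfl⟩
    intro w hw
    set L := hl.localInverseAt (g q)
    set L' := hl.localInverseAt (g q')
    have hw1 : w ∈ ((L.trans UnitDisc.chart).symm.trans (L'.trans UnitDisc.chart)).source := by
      exact hw.1
    rw [OpenPartialHomeomorph.trans_source, OpenPartialHomeomorph.symm_source] at hw1
    have hwb : w ∈ Metric.ball (0 : ℂ) 1 := by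
      rw [← UnitDisc.chart_target]
      exact (OpenPartialHomeomorph.trans_target L UnitDisc.chart ▸ hw1.1).1
    set y := (L.trans UnitDisc.chart).symm w with hydef
    have hy : y ∈ L.source := by
      have := (L.trans UnitDisc.chart).map_target hw1.1
      exact (OpenPartialHomeomorph.trans_source L UnitDisc.chart ▸ this).1
    have hy' : y ∈ L'.source := by
      have := hw1.2
      exact (OpenPartialHomeomorph.trans_source L' UnitDisc.chart ▸ this).1
    -- Near `w` the change of charts is the action of a single element of the group, which is
    -- analytic.
    obtain ⟨γ, -, hγ⟩ := exists_localInverse_eventuallyEq hl hy hy'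
    have hcont : ContinuousAt (L.trans UnitDisc.chart).symm w :=
      (L.trans UnitDisc.chart).continuousAt_symm hw1.1
    have hev : (fun x => ((γ • UnitDisc.chart.symm x : 𝔻) : ℂ)) =ᶠ[𝓝 w]
        ((L.trans UnitDisc.chart).symm.trans (L'.trans UnitDisc.chart)) := by
      filter_upwards [hcont hγ, (L.trans UnitDisc.chart).open_target.mem_nhds hw1.1]
        with x hx hxt
      have hxt2 := OpenPartialHomeomorph.trans_target L UnitDisc.chart ▸ hxt
      have hx' : L' ((L.trans UnitDisc.chart).symm x) = γ • L ((L.trans UnitDisc.chart).symm x) :=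
        hx
      have h5 : L ((L.trans UnitDisc.chart).symm x) = UnitDisc.chart.symm x :=
        L.right_inv hxt2.2
      change _ = ((L' ((L.trans UnitDisc.chart).symm x) : 𝔻) : ℂ)
      rw [hx', h5]
    have hsm : ContMDiffAt 𝓘(ℂ) 𝓘(ℂ) ω (fun x => ((γ • UnitDisc.chart.symm x : 𝔻) : ℂ)) w :=
      (UnitDisc.contMDiff_coe _).comp w ((DiscAut.contMDiff_smul γ _).comp w
        (UnitDisc.contMDiffOn_chart_symm.contMDiffAt (Metric.isOpen_ball.mem_nhds hwb)))
    have hcd : ContDiffAt ℂ ω (fun x => ((γ • UnitDisc.chart.symm x : 𝔻) : ℂ)) w :=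
      contMDiffAt_iff_contDiffAt.1 hsm
    exact (hcd.congr_of_eventuallyEq hev.symm).contDiffWithinAt
  refine ⟨cs, hman, ?_⟩
  have hsec : ∀ (p : 𝔻), ∀ y ∈ (hl.localInverseAt p).source,
      ContMDiffAt 𝓘(ℂ) 𝓘(ℂ) ω (hl.localInverseAt p) y := by
    intro p y hy
    have hy0 : y ∈ (hl.localInverseAt (g y)).source := by
      simpa [hg y] using hl.apply_self_mem_localInverseAt_source (x := g y)
    obtain ⟨γ, -, hγ⟩ := exists_localInverse_eventuallyEq hl hy0 hy
    refine ContMDiffAt.congr_of_eventuallyEq ?_ hγ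
    refine (DiscAut.contMDiff_smul γ _).comp y (UnitDisc.contMDiffAt_of_coe ?_)
    exact (contMDiffOn_chart (n := ω) (I := 𝓘(ℂ)) (x := y)).contMDiffAt
      ((chartAt ℂ y).open_source.mem_nhds (mem_chart_source ℂ y))
  have hproj : ContMDiff 𝓘(ℂ) 𝓘(ℂ) ω (discProj Γ) := by
    intro z
    set q := discProj Γ z
    obtain ⟨γ, hγΓ, hγ⟩ := exists_smul_of_discProj_eq (hg q).symm
    have hev : discProj Γ =ᶠ[𝓝 z] fun x => (chartAt ℂ q).symm ((γ • x : 𝔻) : ℂ) := by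
      refine Eventually.of_forall fun x => ?_
      have h1 : (chartAt ℂ q).symm ((γ • x : 𝔻) : ℂ)
          = (hl.localInverseAt (g q)).symm (UnitDisc.chart.symm ((γ • x : 𝔻) : ℂ)) := rfl
      change discProj Γ x = (chartAt ℂ q).symm ((γ • x : 𝔻) : ℂ)
      rw [h1, UnitDisc.chart_symm_coe, hl.localInverseAt_symm, discProj_smul hγΓ]
    refine ContMDiffAt.congr_of_eventuallyEq ?_ hev
    have ht : ((γ • z : 𝔻) : ℂ) ∈ (chartAt ℂ q).target := by
      rw [hγ, hchart, OpenPartialHomeomorph.trans_target, UnitDisc.chart_target]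
      exact ⟨by simpa using (g q).norm_lt_one, by simp⟩
    exact ((contMDiffOn_chart_symm (n := ω) (I := 𝓘(ℂ)) (x := q)).contMDiffAt
      ((chartAt ℂ q).open_target.mem_nhds ht)).comp z
      ((UnitDisc.contMDiff_coe _).comp z (DiscAut.contMDiff_smul γ z))
  intro z
  refine ⟨{ (hl.localInverseAt z).symm.toPartialEquiv with
    open_source := (hl.localInverseAt z).open_target
    open_target := (hl.localInverseAt z).open_source
    contMDiffOn_toFun := ?_
    contMDiffOn_invFun := fun y hy => (hsec z y hy).contMDiffWithinAt }, ?_, ?_⟩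
  · change ContMDiffOn _ _ _ (hl.localInverseAt z).symm _
    rw [hl.localInverseAt_symm]
    exact hproj.contMDiffOn
  · exact hl.self_mem_localInverseAt_target
  · intro x _
    exact congrFun (hl.localInverseAt_symm z).symm x

end Quotient

/-! ### The hyperboloid model and reflections -/

/-- The Lorentz form on `ℝ × ℂ`. -/
def lorentz (v w : ℝ × ℂ) : ℝ := -(v.1 * w.1) + v.2.re * w.2.re + v.2.im * w.2.im

theorem lorentz_comm (v w : ℝ × ℂ) : lorentz v w = lorentz w v := by
  simp only [lorentz]; ring

theorem lorentz_add_left (u v w : ℝ × ℂ) : lorentz (u + v) w = lorentz u w + lorentz v w := by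
  simp only [lorentz, Prod.fst_add, Prod.snd_add, add_re, add_im]; ring

theorem lorentz_smul_left (a : ℝ) (v w : ℝ × ℂ) : lorentz (a • v) w = a * lorentz v w := by
  simp only [lorentz, Prod.smul_fst, Prod.smul_snd, real_smul, smul_eq_mul, re_ofReal_mul,
    im_ofReal_mul]
  ring

theorem lorentz_sub_left (u v w : ℝ × ℂ) : lorentz (u - v) w = lorentz u w - lorentz v w := by
  simp only [lorentz, Prod.fst_sub, Prod.snd_sub, sub_re, sub_im]; ring

theorem lorentz_add_right (u v w : ℝ × ℂ) : lorentz u (v + w) = lorentz u v + lorentz u w := by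
  simp only [lorentz, Prod.fst_add, Prod.snd_add, add_re, add_im]; ring

theorem lorentz_smul_right (a : ℝ) (v w : ℝ × ℂ) : lorentz v (a • w) = a * lorentz v w := by
  rw [lorentz_comm, lorentz_smul_left, lorentz_comm]

theorem lorentz_sub_right (u v w : ℝ × ℂ) : lorentz u (v - w) = lorentz u v - lorentz u w := by
  simp only [lorentz, Prod.fst_sub, Prod.snd_sub, sub_re, sub_im]; ring

/-- The reflection of `ℝ × ℂ` with respect to the vector `e`, of Lorentz square `1`. -/
def lorentzReflection (e v : ℝ × ℂ) : ℝ × ℂ := v - (2 * lorentz v e) • e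

theorem lorentz_lorentzReflection_left (e v w : ℝ × ℂ) :
    lorentz (lorentzReflection e v) w = lorentz v (lorentzReflection e w) := by
  rw [lorentzReflection, lorentzReflection, lorentz_sub_left, lorentz_sub_right,
    lorentz_smul_left, lorentz_smul_right, lorentz_comm e w]
  ring

theorem lorentzReflection_involutive {e : ℝ × ℂ} (he : lorentz e e = 1) (v : ℝ × ℂ) :
    lorentzReflection e (lorentzReflection e v) = v := by
  have h : lorentz (lorentzReflection e v) e = -lorentz v e := by
    rw [lorentzReflection, lorentz_sub_left, lorentz_smul_left, he]; ring
  rw [lorentzReflection, h, lorentzReflection]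
  module

theorem UnitDisc.one_sub_normSq_pos (z : 𝔻) : 0 < 1 - normSq (z : ℂ) := by
  linarith [z.normSq_lt_one]

/-- The point of the hyperboloid corresponding to a point of the disc. -/
def hyperboloid (z : 𝔻) : ℝ × ℂ :=
  ((1 + normSq z) / (1 - normSq z), ((2 / (1 - normSq z) : ℝ) : ℂ) * z)

theorem hyperboloid_fst_add_one (z : 𝔻) : (hyperboloid z).1 + 1 = 2 / (1 - normSq z) := by
  have := (UnitDisc.one_sub_normSq_pos z).ne'
  rw [hyperboloid]; field_simp; ring

theorem hyperboloid_injective : Function.Injective hyperboloid := by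
  intro z w h
  have h1 := hyperboloid_fst_add_one z
  have h2 := hyperboloid_fst_add_one w
  have h3 : (2 / (1 - normSq z) : ℝ) = 2 / (1 - normSq w) := by rw [← h1, ← h2, h]
  have h4 := congrArg Prod.snd h
  simp only [hyperboloid] at h4
  rw [h3] at h4
  have h5 : ((2 / (1 - normSq w) : ℝ) : ℂ) ≠ 0 := by
    have := UnitDisc.one_sub_normSq_pos w
    exact ofReal_ne_zero.2 (by positivity)
  exact UnitDisc.coe_injective (mul_left_cancel₀ h5 h4)

theorem continuous_hyperboloid : Continuous hyperboloid := by
  have h : Continuous fun z : 𝔻 => normSq (z : ℂ) :=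
    continuous_normSq.comp UnitDisc.continuous_coe
  have h0 : ∀ z : 𝔻, 1 - normSq (z : ℂ) ≠ 0 := fun z => (UnitDisc.one_sub_normSq_pos z).ne'
  refine Continuous.prodMk ((continuous_const.add h).div (continuous_const.sub h) h0) ?_
  exact (continuous_ofReal.comp (continuous_const.div (continuous_const.sub h) h0)).mul
    UnitDisc.continuous_coe

theorem continuous_lorentz : Continuous fun p : (ℝ × ℂ) × (ℝ × ℂ) => lorentz p.1 p.2 := by
  unfold lorentz; fun_prop

section Reflection

variable {e : ℝ × ℂ} (he : lorentz e e = 1)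
include he

theorem normSq_snd_of_unit : normSq e.2 = 1 + e.1 ^ 2 := by
  rw [lorentz] at he; rw [normSq_apply]; linarith

/-- A zero would give |e.2|² = e.1² |z|², whereas |e.2|² = 1 + e.1². -/
theorem reflection_denom_ne_zero (z : ℂ) (hz : normSq z < 1) : (e.1 : ℂ) * z - (starRingEnd ℂ) e.2 ≠ 0 := by
  intro h
  have h1 : (e.1 : ℂ) * z = (starRingEnd ℂ) e.2 := sub_eq_zero.1 h
  have h2 := congrArg normSq h1
  rw [normSq_mul, normSq_conj, normSq_ofReal, normSq_snd_of_unit he] at h2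
  nlinarith [mul_self_nonneg e.1]

/-- This identity shows that the Möbius map preserves the disc, and it gives 1 - |image|², the
denominator in the hyperboloid coordinates of the image. -/
theorem reflection_normSq_sub (z : ℂ) :
    normSq ((e.1 : ℂ) * z - (starRingEnd ℂ) e.2) - normSq (e.2 * z - e.1) = 1 - normSq z := by
  have := normSq_snd_of_unit he
  simp only [normSq_apply, sub_re, sub_im, mul_re, mul_im, ofReal_re, ofReal_im, conj_re,
    conj_im] at this ⊢
  linear_combination (1 - (z.re * z.re + z.im * z.im)) * this

theorem reflection_norm_lt_one (z : ℂ) (hz : ‖z‖ < 1) :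
    ‖(e.2 * z - e.1) / ((e.1 : ℂ) * z - (starRingEnd ℂ) e.2)‖ < 1 := by
  have hz' : normSq z < 1 := by rw [normSq_eq_norm_sq]; nlinarith [norm_nonneg z]
  have h0 := reflection_denom_ne_zero he z hz'
  rw [norm_div, div_lt_one (norm_pos_iff.2 h0)]
  have h1 := reflection_normSq_sub he z
  rw [normSq_eq_norm_sq, normSq_eq_norm_sq, normSq_eq_norm_sq] at h1
  rw [normSq_eq_norm_sq] at hz'
  exact lt_of_pow_lt_pow_left₀ 2 (norm_nonneg _) (by linarith)

/-- The holomorphic map of the disc whose composition with the conjugation is the reflection with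
respect to `e`. -/
def reflectionMobius (z : 𝔻) : 𝔻 :=
  UnitDisc.mk ((e.2 * z - e.1) / ((e.1 : ℂ) * z - (starRingEnd ℂ) e.2))
    (reflection_norm_lt_one he z z.norm_lt_one)

theorem contMDiff_reflectionMobius : ContMDiff 𝓘(ℂ) 𝓘(ℂ) ω (reflectionMobius he) := by
  refine UnitDisc.contMDiff_of_differentiableOn
    (F := fun z => (e.2 * z - e.1) / ((e.1 : ℂ) * z - (starRingEnd ℂ) e.2)) ?_ fun z => rfl
  refine DifferentiableOn.div (by fun_prop) (by fun_prop) fun z hz => ?_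
  refine reflection_denom_ne_zero he z ?_
  rw [mem_ball_zero_iff] at hz
  rw [normSq_eq_norm_sq]; nlinarith [norm_nonneg z]

/-- The reflection of the disc with respect to the geodesic orthogonal to `e`. -/
def discReflection (z : 𝔻) : 𝔻 := reflectionMobius he (star z)

/-- In the hyperboloid the reflection becomes linear, so that all questions about mirrors and
distances reduce to the algebra of the form `lorentz`. -/
theorem hyperboloid_discReflection (z : 𝔻) :
    hyperboloid (discReflection he z) = lorentzReflection e (hyperboloid z) := by
  obtain ⟨e0, n⟩ := e
  have h0 := reflection_denom_ne_zero he (star z : 𝔻) (star z).normSq_lt_one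
  have h1 := reflection_normSq_sub he (star z : 𝔻)
  have hn := normSq_snd_of_unit he
  have hz := UnitDisc.one_sub_normSq_pos z
  rw [UnitDisc.coe_star, normSq_conj] at h1
  rw [UnitDisc.coe_star] at h0
  set D := (e0 : ℂ) * (starRingEnd ℂ) (z : ℂ) - (starRingEnd ℂ) n with hD
  set E := n * (starRingEnd ℂ) (z : ℂ) - e0 with hE
  have hDpos : 0 < normSq D := normSq_pos.2 h0
  have hw : ((discReflection he z : 𝔻) : ℂ) = E / D := rfl
  have hws : 1 - normSq (E / D) = (1 - normSq (z : ℂ)) / normSq D := by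
    rw [normSq_div]; field_simp; linarith
  have hED : E / D = ((1 / normSq D : ℝ) : ℂ) * (E * (starRingEnd ℂ) D) := by
    rw [div_eq_mul_inv, inv_def]; push_cast; ring
  have key : (2 / (1 - normSq (E / D)) : ℝ) = 2 * normSq D / (1 - normSq (z : ℂ)) := by
    rw [hws]; field_simp
  have hfst : (hyperboloid (discReflection he z)).1
      = 2 * normSq D / (1 - normSq (z : ℂ)) - 1 := by
    rw [← key, ← hw, ← hyperboloid_fst_add_one]; ring
  have hsnd : (hyperboloid (discReflection he z)).2
      = ((2 / (1 - normSq (z : ℂ)) : ℝ) : ℂ) * (E * (starRingEnd ℂ) D) := by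
    change ((2 / (1 - normSq ((discReflection he z : 𝔻) : ℂ)) : ℝ) : ℂ)
      * ((discReflection he z : 𝔻) : ℂ) = _
    rw [hw, key, hED, ← mul_assoc, ← ofReal_mul]
    congr 2
    field_simp
  have hlor : lorentz (hyperboloid z) (e0, n) = (-(e0 * (1 + normSq (z : ℂ)))
      + 2 * (n.re * (z : ℂ).re + n.im * (z : ℂ).im)) / (1 - normSq (z : ℂ)) := by
    simp only [lorentz, hyperboloid, re_ofReal_mul, im_ofReal_mul]
    field_simp; ring
  refine Prod.ext ?_ ?_
  · rw [hfst, lorentzReflection, hlor]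
    simp only [Prod.fst_sub, Prod.smul_fst, smul_eq_mul, hyperboloid]
    rw [eq_comm]
    field_simp
    simp only [hD, normSq_apply, sub_re, sub_im, mul_re, mul_im, ofReal_re, ofReal_im, conj_re,
      conj_im] at hn ⊢
    linear_combination (-2) * hn
  · rw [hsnd, lorentzReflection, hlor]
    simp only [Prod.snd_sub, Prod.smul_snd, hyperboloid]
    apply Complex.ext
    · simp only [hD, hE, sub_re, real_smul, mul_re, mul_im, sub_im, ofReal_re,
        ofReal_im, conj_re, conj_im]
      field_simp
      simp only [normSq_apply] at hn ⊢
      linear_combination 2 * (z : ℂ).re * hn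
    · simp only [hD, hE, sub_re, real_smul, mul_re, mul_im, sub_im, ofReal_re,
        ofReal_im, conj_re, conj_im]
      field_simp
      simp only [normSq_apply] at hn ⊢
      linear_combination 2 * (z : ℂ).im * hn

theorem discReflection_involutive : Function.Involutive (discReflection he) := fun z =>
  hyperboloid_injective (by
    rw [hyperboloid_discReflection, hyperboloid_discReflection, lorentzReflection_involutive he])

/-- The reflection of the disc, as a permutation. -/
def discReflectionPerm : Equiv.Perm 𝔻 := (discReflection_involutive he).toPerm

theorem discReflectionPerm_apply (z : 𝔻) : discReflectionPerm he z = discReflection he z := rfl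

end Reflection

theorem lorentz_conj_self {e : ℝ × ℂ} (he : lorentz e e = 1) :
    lorentz (e.1, (starRingEnd ℂ) e.2) (e.1, (starRingEnd ℂ) e.2) = 1 := by
  simp only [lorentz, conj_re, conj_im] at he ⊢; linarith

theorem star_discReflection {e : ℝ × ℂ} (he : lorentz e e = 1) (z : 𝔻) :
    star (discReflection he z) = reflectionMobius (lorentz_conj_self he) z := by
  apply UnitDisc.coe_injective
  simp [discReflection, reflectionMobius]

/-! ### The hyperbolic distance -/

/-- The hyperbolic cosine of the distance of two points of the disc. -/
def coshDist (z w : 𝔻) : ℝ := -lorentz (hyperboloid z) (hyperboloid w)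

theorem coshDist_comm (z w : 𝔻) : coshDist z w = coshDist w z := by
  rw [coshDist, lorentz_comm, coshDist]

theorem coshDist_eq (z w : 𝔻) : coshDist z w
    = 1 + 2 * normSq ((z : ℂ) - w) / ((1 - normSq (z : ℂ)) * (1 - normSq (w : ℂ))) := by
  have hz := (UnitDisc.one_sub_normSq_pos z).ne'
  have hw := (UnitDisc.one_sub_normSq_pos w).ne'
  simp only [coshDist, lorentz, hyperboloid, re_ofReal_mul, im_ofReal_mul]
  field_simp
  simp only [normSq_apply, sub_re, sub_im]
  ring

@[simp] theorem coshDist_self (z : 𝔻) : coshDist z z = 1 := by simp [coshDist_eq]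

theorem continuous_coshDist : Continuous fun p : 𝔻 × 𝔻 => coshDist p.1 p.2 := by
  refine (continuous_lorentz.comp ((continuous_hyperboloid.comp continuous_fst).prodMk
    (continuous_hyperboloid.comp continuous_snd))).neg

/-- From (cosh d(z, w) + 1)(1 - |z|²)(1 - |w|²) = 2 |1 - z̄ w|² and |1 - z̄ w| ≥ 1 - |w|. The
absolute value of R only serves to keep the denominator positive. -/
theorem norm_sq_le_of_coshDist_le {z w : 𝔻} {R : ℝ} (h : coshDist z w ≤ R) :
    ‖(z : ℂ)‖ ^ 2 ≤ 1 - 2 * (1 - ‖(w : ℂ)‖) ^ 2 / (|R| + 1) := by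
  have hz := UnitDisc.one_sub_normSq_pos z
  have hw := UnitDisc.one_sub_normSq_pos w
  have h1 : (coshDist z w + 1) * ((1 - normSq (z : ℂ)) * (1 - normSq (w : ℂ)))
      = 2 * normSq (1 - (starRingEnd ℂ) (z : ℂ) * w) := by
    rw [coshDist_eq]
    field_simp
    simp only [normSq_apply, sub_re, sub_im, mul_re, mul_im, conj_re, conj_im, one_re, one_im]
    ring
  have h2 : (1 - ‖(w : ℂ)‖) ^ 2 ≤ normSq (1 - (starRingEnd ℂ) (z : ℂ) * w) := by
    rw [normSq_eq_norm_sq]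
    have h3 : 1 - ‖(w : ℂ)‖ ≤ ‖1 - (starRingEnd ℂ) (z : ℂ) * w‖ := by
      have h4 := norm_sub_norm_le (1 : ℂ) ((starRingEnd ℂ) (z : ℂ) * w)
      rw [norm_one, norm_mul, RCLike.norm_conj] at h4
      nlinarith [norm_nonneg (w : ℂ), z.norm_lt_one]
    exact pow_le_pow_left₀ (by linarith [w.norm_lt_one]) h3 2
  have hR : coshDist z w + 1 ≤ |R| + 1 := by linarith [le_abs_self R]
  have h5 : (1 - normSq (z : ℂ)) * (1 - normSq (w : ℂ)) ≤ 1 - normSq (z : ℂ) :=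
    mul_le_of_le_one_right hz.le (by linarith [normSq_nonneg (w : ℂ)])
  have hp : 0 < |R| + 1 := by positivity
  rw [← normSq_eq_norm_sq, le_sub_comm, div_le_iff₀ hp]
  calc 2 * (1 - ‖(w : ℂ)‖) ^ 2
      ≤ (coshDist z w + 1) * ((1 - normSq (z : ℂ)) * (1 - normSq (w : ℂ))) := by rw [h1]; linarith
    _ ≤ (|R| + 1) * ((1 - normSq (z : ℂ)) * (1 - normSq (w : ℂ))) :=
        mul_le_mul_of_nonneg_right hR (by positivity)
    _ ≤ (1 - normSq (z : ℂ)) * (|R| + 1) := by nlinarith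

theorem UnitDisc.isCompact_norm_le {ρ : ℝ} (hρ : ρ < 1) : IsCompact {z : 𝔻 | ‖(z : ℂ)‖ ≤ ρ} := by
  rw [UnitDisc.isEmbedding_coe.isCompact_iff]
  have : UnitDisc.coe '' {z : 𝔻 | ‖(z : ℂ)‖ ≤ ρ} = Metric.closedBall 0 ρ := by
    ext x
    simp only [mem_image, mem_ofPred_eq, mem_closedBall_zero_iff]
    exact ⟨fun ⟨z, hz, h⟩ => h ▸ hz, fun h => ⟨UnitDisc.mk x (h.trans_lt hρ), h, rfl⟩⟩
  rw [this]
  exact isCompact_closedBall _ _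

/-- The points at bounded hyperbolic distance from a compact set form a relatively compact set. -/
theorem exists_isCompact_of_coshDist_le {K : Set 𝔻} (hK : IsCompact K) (R : ℝ) :
    ∃ K' : Set 𝔻, IsCompact K' ∧ ∀ z, ∀ w ∈ K, coshDist z w ≤ R → z ∈ K' := by
  obtain ⟨r, hr, hKr⟩ : ∃ r < 1, ∀ w ∈ K, ‖(w : ℂ)‖ ≤ r := by
    rcases K.eq_empty_or_nonempty with rfl | hne
    · exact ⟨0, one_pos, by simp⟩
    · obtain ⟨w, -, hw⟩ := hK.exists_isMaxOn hne
        (UnitDisc.continuous_coe.norm.continuousOn : ContinuousOn (fun w : 𝔻 => ‖(w : ℂ)‖) K)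
      exact ⟨_, w.norm_lt_one, hw⟩
  have hp : 0 < |R| + 1 := by positivity
  have h1 : 0 < 2 * (1 - r) ^ 2 / (|R| + 1) := div_pos (by nlinarith) hp
  refine ⟨_, UnitDisc.isCompact_norm_le (ρ := √(1 - 2 * (1 - r) ^ 2 / (|R| + 1))) ?_,
    fun z w hw h => ?_⟩
  · rw [Real.sqrt_lt' one_pos]; linarith
  · refine Real.le_sqrt_of_sq_le ((norm_sq_le_of_coshDist_le h).trans ?_)
    gcongr
    exact hKr w hw

/-! ### Groups generated by reflections -/

/-- The vector x e + y f is the projection of v on the plane of e and f. The product of the two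
reflections fixes the orthogonal complement and rotates this plane by 2φ, whence the sines. -/
theorem lorentzReflection_comp_iterate {e f v : ℝ × ℂ} (he : lorentz e e = 1)
    (hf : lorentz f f = 1) {φ x y : ℝ} (hs : Real.sin φ ≠ 0)
    (hef : lorentz e f = -Real.cos φ) (hx : lorentz v e = x - Real.cos φ * y)
    (hy : lorentz v f = y - Real.cos φ * x) (k : ℕ) :
    (fun v => lorentzReflection e (lorentzReflection f v))^[k] v = v
      + ((Real.sin ((2 * k + 1) * φ) * x - Real.sin (2 * k * φ) * y) / Real.sin φ - x) • e
      + ((Real.sin (2 * k * φ) * x - Real.sin ((2 * k - 1) * φ) * y) / Real.sin φ - y) • f := by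
  induction k with
  | zero =>
    simp only [Function.iterate_zero, id, Nat.cast_zero, mul_zero, zero_add, one_mul, zero_mul,
      Real.sin_zero, zero_sub, neg_mul, Real.sin_neg, sub_zero, neg_neg]
    rw [mul_div_cancel_left₀ _ hs, mul_div_cancel_left₀ _ hs]
    simp
  | succ k ih =>
    rw [Function.iterate_succ_apply', ih]
    have h1 : Real.sin ((2 * k + 2) * φ)
        = 2 * Real.cos φ * Real.sin ((2 * k + 1) * φ) - Real.sin (2 * k * φ) := by
      have a1 : (2 * k + 2) * φ = (2 * k + 1) * φ + φ := by ring
      have a2 : 2 * k * φ = (2 * k + 1) * φ - φ := by ring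
      rw [a1, a2, Real.sin_add, Real.sin_sub]; ring
    have h2 : Real.sin ((2 * k + 3) * φ)
        = 2 * Real.cos φ * Real.sin ((2 * k + 2) * φ) - Real.sin ((2 * k + 1) * φ) := by
      have a1 : (2 * k + 3) * φ = (2 * k + 2) * φ + φ := by ring
      have a2 : (2 * k + 1) * φ = (2 * k + 2) * φ - φ := by ring
      rw [a1, a2, Real.sin_add, Real.sin_sub]; ring
    have h3 : Real.sin ((2 * k + 1) * φ)
        = 2 * Real.cos φ * Real.sin (2 * k * φ) - Real.sin ((2 * k - 1) * φ) := by
      have a1 : (2 * k + 1) * φ = 2 * k * φ + φ := by ring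
      have a2 : (2 * k - 1) * φ = 2 * k * φ - φ := by ring
      rw [a1, a2, Real.sin_add, Real.sin_sub]; ring
    have e1 : (2 * ((k + 1 : ℕ) : ℝ) + 1) * φ = (2 * k + 3) * φ := by push_cast; ring
    have e2 : 2 * ((k + 1 : ℕ) : ℝ) * φ = (2 * k + 2) * φ := by push_cast; ring
    have e3 : (2 * ((k + 1 : ℕ) : ℝ) - 1) * φ = (2 * k + 1) * φ := by push_cast; ring
    rw [e1, e2, e3]
    set P := (Real.sin ((2 * k + 1) * φ) * x - Real.sin (2 * k * φ) * y) / Real.sin φ - x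
      with hP
    set Q := (Real.sin (2 * k * φ) * x - Real.sin ((2 * k - 1) * φ) * y) / Real.sin φ - y
      with hQ
    set Q' := (Real.sin ((2 * k + 2) * φ) * x - Real.sin ((2 * k + 1) * φ) * y) / Real.sin φ - y
      with hQ'
    set P' := (Real.sin ((2 * k + 3) * φ) * x - Real.sin ((2 * k + 2) * φ) * y) / Real.sin φ - x
      with hP'
    have hQQ : Q' + y = -(Q + y) + 2 * Real.cos φ * (P + x) := by
      rw [hQ', hQ, hP, sub_add_cancel, sub_add_cancel, sub_add_cancel]
      linear_combination (x * h1 - y * h3) / Real.sin φ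
    have hPP : P' + x = -(P + x) + 2 * Real.cos φ * (Q' + y) := by
      rw [hQ', hP', hP, sub_add_cancel, sub_add_cancel, sub_add_cancel]
      linear_combination (x * h2 - y * h1) / Real.sin φ
    have r1 : lorentzReflection f (v + P • e + Q • f) = v + P • e + Q' • f := by
      have : lorentz (v + P • e + Q • f) f = (Q - Q') / 2 := by
        rw [lorentz_add_left, lorentz_add_left, lorentz_smul_left, lorentz_smul_left, hf, hef, hy]
        linarith
      rw [lorentzReflection, this]; module
    have r2 : lorentzReflection e (v + P • e + Q' • f) = v + P' • e + Q' • f := by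
      have : lorentz (v + P • e + Q' • f) e = (P - P') / 2 := by
        rw [lorentz_add_left, lorentz_add_left, lorentz_smul_left, lorentz_smul_left, he,
          lorentz_comm f e, hef, hx]
        linarith
      rw [lorentzReflection, this]; module
    rw [r1, r2]

theorem discReflectionPerm_mul_pow {e f : ℝ × ℂ} (he : lorentz e e = 1)
    (hf : lorentz f f = 1) {m : ℕ} (hm : 2 ≤ m) (hef : lorentz e f = -Real.cos (Real.pi / m)) :
    (discReflectionPerm he * discReflectionPerm hf) ^ m = 1 := by
  have hm0 : (m : ℝ) ≠ 0 := by positivity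
  have hs : Real.sin (Real.pi / m) ≠ 0 := by
    refine (Real.sin_pos_of_pos_of_lt_pi (by positivity) ?_).ne'
    rw [div_lt_iff₀ (by positivity)]
    have : (2 : ℝ) ≤ m := by exact_mod_cast hm
    nlinarith [Real.pi_pos]
  ext1 z
  apply hyperboloid_injective
  have h : ∀ k : ℕ, hyperboloid (((discReflectionPerm he * discReflectionPerm hf) ^ k) z)
      = (fun v => lorentzReflection e (lorentzReflection f v))^[k] (hyperboloid z) := by
    intro k
    induction k with
    | zero => rfl
    | succ k ih =>
      rw [Function.iterate_succ_apply', ← ih, pow_succ', Equiv.Perm.mul_apply,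
        Equiv.Perm.mul_apply, discReflectionPerm_apply, discReflectionPerm_apply,
        hyperboloid_discReflection, hyperboloid_discReflection]
  set φ := Real.pi / m with hφ
  set v := hyperboloid z
  have hsc := Real.sin_sq_add_cos_sq φ
  -- The values of x and y solve the linear system for the projection, whose determinant is 1 - cos²
  -- φ = sin² φ.
  rw [h, lorentzReflection_comp_iterate (φ := φ)
    (x := (lorentz v e + Real.cos φ * lorentz v f) / Real.sin φ ^ 2)
    (y := (lorentz v f + Real.cos φ * lorentz v e) / Real.sin φ ^ 2) he hf hs hef
    (by field_simp; linear_combination (lorentz v e) * hsc)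
    (by field_simp; linear_combination (lorentz v f) * hsc)]
  have e1 : 2 * (m : ℝ) * φ = 2 * Real.pi := by rw [hφ]; field_simp
  have e2 : (2 * (m : ℝ) + 1) * φ = φ + 2 * Real.pi := by rw [add_mul, e1]; ring
  have e3 : (2 * (m : ℝ) - 1) * φ = -φ + 2 * Real.pi := by rw [sub_mul, e1]; ring
  rw [e1, e2, e3, Real.sin_add_two_pi, Real.sin_add_two_pi, Real.sin_two_pi, Real.sin_neg,
    zero_mul, zero_mul, sub_zero, neg_mul, zero_sub, neg_neg, mul_div_cancel_left₀ _ hs,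
    mul_div_cancel_left₀ _ hs, sub_self, sub_self, zero_smul, zero_smul, add_zero, add_zero]
  rfl

/-- Unit normals of a hyperbolic polygon whose angles are prescribed by a Coxeter matrix. -/
structure HyperbolicMirrors {B : Type*} (M : CoxeterMatrix B) where
  normal : B → ℝ × ℂ
  unit : ∀ i, lorentz (normal i) (normal i) = 1
  angle : ∀ i j, i ≠ j → M i j ≠ 0 → lorentz (normal i) (normal j) = -Real.cos (Real.pi / M i j)
  far : ∀ i j, M i j = 0 → lorentz (normal i) (normal j) ≤ -1

namespace HyperbolicMirrors

variable {B : Type*} {M : CoxeterMatrix B} (H : HyperbolicMirrors M)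

/-- The reflection with respect to a side. -/
def reflection (i : B) : Equiv.Perm 𝔻 := discReflectionPerm (H.unit i)

theorem isLiftable_reflection : M.IsLiftable H.reflection := by
  intro i j
  rcases eq_or_ne i j with rfl | hij
  · rw [M.diagonal, pow_one]
    ext1 z
    exact discReflection_involutive (H.unit i) z
  · rcases eq_or_ne (M i j) 0 with h0 | h0
    · rw [h0, pow_zero]
    · refine discReflectionPerm_mul_pow _ _ ?_ (H.angle i j hij h0)
      have := M.off_diagonal i j hij
      omega

variable {W : Type*} [Group W] (cs : CoxeterSystem M W)

/-- The action of the Coxeter group on the disc. -/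
def action : W →* Equiv.Perm 𝔻 := cs.lift ⟨H.reflection, H.isLiftable_reflection⟩

@[simp] theorem action_simple (i : B) : H.action cs (cs.simple i) = H.reflection i :=
  cs.lift_apply_simple H.isLiftable_reflection i

/-- The signed position of a point with respect to a side. -/
def side (i : B) (z : 𝔻) : ℝ := lorentz (hyperboloid z) (H.normal i)

/-- The closed polygon. -/
def chamber : Set 𝔻 := {z | ∀ i, 0 ≤ H.side i z}

theorem lorentz_reflection (i : B) (z : 𝔻) (v : ℝ × ℂ) :
    lorentz (hyperboloid (H.reflection i z)) v
      = lorentz (hyperboloid z) (lorentzReflection (H.normal i) v) := by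
  rw [reflection, discReflectionPerm_apply, hyperboloid_discReflection,
    lorentz_lorentzReflection_left]

theorem side_reflection_self (i : B) (z : 𝔻) : H.side i (H.reflection i z) = -H.side i z := by
  rw [side, lorentz_reflection, lorentzReflection, lorentz_sub_right, lorentz_smul_right, H.unit,
    side]
  ring

theorem coshDist_action (w : W) (z z' : 𝔻) :
    coshDist (H.action cs w z) (H.action cs w z') = coshDist z z' := by
  induction w using cs.simple_induction_left with
  | one => simp
  | mul_simple_left w i ih =>
    rw [map_mul, action_simple, Equiv.Perm.mul_apply, Equiv.Perm.mul_apply, ← ih, coshDist,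
      lorentz_reflection, reflection, discReflectionPerm_apply, hyperboloid_discReflection,
      lorentzReflection_involutive (H.unit i), coshDist]

end HyperbolicMirrors

/-! ### Alternating words and the braid relation. -/

namespace CoxeterSystem

variable {B : Type*} {M : CoxeterMatrix B} {W : Type*} [Group W] (cs : CoxeterSystem M W)

/-- The alternating product `s t s ⋯` with `n` factors. -/
def alternating (s t : B) : ℕ → W
  | 0 => 1
  | n + 1 => cs.simple s * alternating t s n

@[simp] theorem alternating_zero (s t : B) : cs.alternating s t 0 = 1 := rfl

theorem alternating_succ (s t : B) (n : ℕ) :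
    cs.alternating s t (n + 1) = cs.simple s * cs.alternating t s n := rfl

theorem simple_mul_alternating_succ (s t : B) (n : ℕ) :
    cs.simple s * cs.alternating s t (n + 1) = cs.alternating t s n := by
  rw [alternating_succ, simple_mul_simple_cancel_left]

theorem length_alternating_le (s t : B) (n : ℕ) : cs.length (cs.alternating s t n) ≤ n := by
  induction n generalizing s t with
  | zero => simp
  | succ n ih =>
    have := cs.length_mul_le (cs.simple s) (cs.alternating t s n)
    rw [cs.length_simple] at this
    rw [alternating_succ]
    linarith [ih t s]

/-- For n = M s t the power is trivial, which yields the braid relation. -/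
theorem alternating_eq_pow_mul (s t : B) (n : ℕ) :
    cs.alternating s t n = (cs.simple s * cs.simple t) ^ n * cs.alternating t s n := by
  induction n generalizing s t with
  | zero => simp
  | succ n ih =>
    have h : ∀ n : ℕ, (cs.simple s * cs.simple t) ^ n * cs.simple s
        = cs.simple s * (cs.simple t * cs.simple s) ^ n := by
      intro n
      induction n with
      | zero => simp
      | succ n ih => rw [pow_succ', pow_succ', mul_assoc, ih]; simp only [mul_assoc]
    have h2 : (cs.simple t * cs.simple s) ^ n = ((cs.simple s * cs.simple t) ^ n)⁻¹ := by
      rw [← inv_pow, mul_inv_rev, inv_simple, inv_simple]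
    rw [alternating_succ, alternating_succ, ih t s, h2, pow_succ, mul_assoc, mul_assoc,
      simple_mul_simple_cancel_left, ← mul_assoc ((cs.simple s * cs.simple t) ^ n), h, mul_assoc,
      h2]

theorem alternating_comm (s t : B) :
    cs.alternating s t (M s t) = cs.alternating t s (M s t) := by
  rw [alternating_eq_pow_mul, cs.simple_mul_simple_pow, one_mul]

end CoxeterSystem

/-! ### Tits' theorem on the chamber. -/

namespace HyperbolicMirrors

variable {B : Type*} {M : CoxeterMatrix B} (H : HyperbolicMirrors M)
variable {W : Type*} [Group W] (cs : CoxeterSystem M W)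

/-- Reflections are self-adjoint, so the word can be transferred to the normal vector one letter at
a time. Each letter advances the coefficients by one step of the recursion, and at the end a
nonnegative combination of the two normals is paired with y. -/
theorem lorentz_alternating_nonneg {s t : B} (a : ℕ → ℝ)
    (ha : ∀ k, a (k + 2) = -2 * lorentz (H.normal s) (H.normal t) * a (k + 1) - a k)
    {y : 𝔻} (hs : 0 ≤ H.side s y) (ht : 0 ≤ H.side t y) (j k : ℕ)
    (hN : ∀ i ≤ k + j + 1, 0 ≤ a i) :
    0 ≤ lorentz (hyperboloid (H.action cs (cs.alternating t s j) y))
      (a (k + 1) • H.normal s + a k • H.normal t) := by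
  induction j generalizing s t k with
  | zero =>
    simp only [CoxeterSystem.alternating_zero, map_one, Equiv.Perm.one_apply, lorentz_add_right,
      lorentz_smul_right]
    exact add_nonneg (mul_nonneg (hN _ (by omega)) hs) (mul_nonneg (hN _ (by omega)) ht)
  | succ j ih =>
    rw [CoxeterSystem.alternating_succ, map_mul, action_simple, Equiv.Perm.mul_apply,
      lorentz_reflection]
    have h1 : lorentzReflection (H.normal t) (a (k + 1) • H.normal s + a k • H.normal t)
        = a (k + 2) • H.normal t + a (k + 1) • H.normal s := by
      rw [lorentzReflection, lorentz_add_left, lorentz_smul_left, lorentz_smul_left, H.unit, ha]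
      module
    rw [h1]
    refine ih (s := t) (t := s) (fun k => ?_) ht hs (k + 1) fun i hi => hN i (by omega)
    rw [lorentz_comm, ha]

/-- The recursion satisfied by the coefficients of the images of a normal under the dihedral group
generated by two reflections has a nonnegative solution, up to half the order of the group. -/
theorem exists_nonneg_recursion {s t : B} (hst : s ≠ t) :
    ∃ a : ℕ → ℝ, a 0 = 0 ∧ a 1 = 1 ∧
      (∀ k, a (k + 2) = -2 * lorentz (H.normal s) (H.normal t) * a (k + 1) - a k) ∧
      ∀ i, (M s t ≠ 0 → i ≤ M s t) → 0 ≤ a i := by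
  rcases eq_or_ne (M s t) 0 with h0 | h0
  · have hc := H.far s t h0
    set c := -lorentz (H.normal s) (H.normal t) with hcdef
    -- Mirrors that do not meet: c ≥ 1, so the sequence is nonnegative and nondecreasing for ever.
    let f : ℕ → ℝ × ℝ := fun n => (fun p : ℝ × ℝ => (p.2, 2 * c * p.2 - p.1))^[n] (0, 1)
    have hf : ∀ n, f (n + 1) = ((f n).2, 2 * c * (f n).2 - (f n).1) := fun n =>
      Function.iterate_succ_apply' _ _ _
    have hp : ∀ n, 0 ≤ (f n).1 ∧ (f n).1 ≤ (f n).2 := by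
      intro n
      induction n with
      | zero => exact ⟨le_rfl, zero_le_one⟩
      | succ n ih =>
        rw [hf]
        exact ⟨ih.1.trans ih.2, by dsimp only; nlinarith [ih.1.trans ih.2]⟩
    refine ⟨fun n => (f n).1, rfl, rfl, fun k => ?_, fun i _ => (hp i).1⟩
    change (f (k + 2)).1 = -2 * _ * (f (k + 1)).1 - (f k).1
    rw [hf, hf]; dsimp only; rw [hcdef]; ring
  · have hc := H.angle s t hst h0
    have hm : 2 ≤ M s t := by have := M.off_diagonal s t hst; omega
    have hm' : (2 : ℝ) ≤ M s t := by exact_mod_cast hm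
    set φ := Real.pi / M s t with hφ
    have hs : 0 < Real.sin φ := by
      refine Real.sin_pos_of_pos_of_lt_pi (by positivity) ?_
      rw [hφ, div_lt_iff₀ (by positivity)]; nlinarith [Real.pi_pos]
    -- Mirrors meeting at angle φ = π / m: sin (nφ) / sin φ stays nonnegative exactly as long as nφ
    -- has not passed π.
    refine ⟨fun n => Real.sin (n * φ) / Real.sin φ, by simp, ?_, fun k => ?_, fun i hi => ?_⟩
    · simp [hs.ne']
    · have a1 : ((k + 2 : ℕ) : ℝ) * φ = ((k + 1 : ℕ) : ℝ) * φ + φ := by push_cast; ring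
      have a2 : (k : ℝ) * φ = ((k + 1 : ℕ) : ℝ) * φ - φ := by push_cast; ring
      dsimp only
      rw [a1, a2, Real.sin_add, Real.sin_sub, hc]; ring
    · refine div_nonneg (Real.sin_nonneg_of_nonneg_of_le_pi (by positivity) ?_) hs.le
      have h1 : (i : ℝ) ≤ M s t := by exact_mod_cast hi h0
      calc (i : ℝ) * φ ≤ M s t * φ := by gcongr
        _ = Real.pi := by rw [hφ]; field_simp

/-- A dihedral word beginning with t and shorter than the longest one keeps the sector on the
positive side of s. With k = 0 the combination of `lorentz_alternating_nonneg` is the normal of s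
itself. -/
theorem side_alternating_nonneg {s t : B} (hst : s ≠ t) {y : 𝔻} (hs : 0 ≤ H.side s y)
    (ht : 0 ≤ H.side t y) {j : ℕ} (hj : M s t ≠ 0 → j + 1 ≤ M s t) :
    0 ≤ H.side s (H.action cs (cs.alternating t s j) y) := by
  obtain ⟨a, h0, h1, ha, hN⟩ := H.exists_nonneg_recursion hst
  have := H.lorentz_alternating_nonneg cs a ha hs ht j 0 fun i hi =>
    hN i fun h => (by omega : i ≤ j + 1).trans (hj h)
  simpa [h0, h1, side] using this

/-- The image of the chamber lies on the positive side of the mirror `s`, or else on the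
negative side, and then `s` is a left descent. -/
def Separated (w : W) (s : B) : Prop :=
  (∀ z ∈ H.chamber, 0 ≤ H.side s (H.action cs w z)) ∨
    ((∀ z ∈ H.chamber, H.side s (H.action cs w z) ≤ 0) ∧
      cs.length (cs.simple s * w) < cs.length w)

/-- The image of the chamber lies in the image of a dihedral sector under an element of the
dihedral group which is a prefix of `w`. -/
def InSector (w : W) (s t : B) : Prop :=
  ∃ (j : ℕ) (u : W), (u = cs.alternating s t j ∨ u = cs.alternating t s j) ∧
    (M s t ≠ 0 → j ≤ M s t) ∧
    (∀ z ∈ H.chamber, 0 ≤ H.side s (H.action cs (u⁻¹ * w) z) ∧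
      0 ≤ H.side t (H.action cs (u⁻¹ * w) z)) ∧
    cs.length w = j + cs.length (u⁻¹ * w)

variable {H cs}

theorem InSector.symm {w : W} {s t : B} (h : H.InSector cs w s t) : H.InSector cs w t s := by
  obtain ⟨j, u, hu, hj, hz, hl⟩ := h
  exact ⟨j, u, hu.symm, by rwa [M.symmetric], fun z hzc => (hz z hzc).symm, hl⟩

/-- If `w` starts with `t` and the prefix of `w` in the dihedral group of `s, t` is given, then the
prefix of `t w` starts with `s`. -/
theorem InSector.exists_of_length_lt {w : W} {s t : B} (h : H.InSector cs w s t)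
    (hl : cs.length w < cs.length (cs.simple t * w)) :
    ∃ j, (M s t ≠ 0 → j + 1 ≤ M s t) ∧
      (∀ z ∈ H.chamber, 0 ≤ H.side s (H.action cs ((cs.alternating s t j)⁻¹ * w) z) ∧
        0 ≤ H.side t (H.action cs ((cs.alternating s t j)⁻¹ * w) z)) ∧
      cs.length w = j + cs.length ((cs.alternating s t j)⁻¹ * w) := by
  obtain ⟨j, u, hu, hj, hz, hlw⟩ := h
  -- If the prefix began with t, cancelling that letter would make t w shorter than w.
  have key : ∀ j', u = cs.alternating t s (j' + 1) → j = j' + 1 → False := by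
    rintro j' rfl rfl
    have h1 : cs.simple t * w
        = cs.alternating s t j' * ((cs.alternating t s (j' + 1))⁻¹ * w) := by
      rw [CoxeterSystem.alternating_succ, mul_inv_rev, CoxeterSystem.inv_simple]
      group
    have h2 := cs.length_mul_le (cs.alternating s t j')
      ((cs.alternating t s (j' + 1))⁻¹ * w)
    have h3 := cs.length_alternating_le s t j'
    rw [← h1] at h2
    omega
  rcases hu with rfl | rfl
  · refine ⟨j, fun h0 => ?_, hz, hlw⟩
    have := hj h0
    rcases this.lt_or_eq with h | h
    · exact h
    -- The longest dihedral element can also be written starting with t, so it is excluded too.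
    · exfalso
      obtain ⟨j', rfl⟩ : ∃ j', j = j' + 1 := ⟨j - 1, by omega⟩
      refine key j' ?_ rfl
      rw [h]; exact cs.alternating_comm s t
  · rcases j with _ | j
    · exact ⟨0, fun h0 => by omega, hz, hlw⟩
    · exact (key j rfl rfl).elim

/-- For s = t the reflection exchanges the two sides. Otherwise the dihedral prefix of t w is the
prefix of w with t added in front. If it is not the longest element, the image remains on the
positive side of s. If it is, it may be rewritten to start with s, and s is then a descent. -/
theorem separated_simple_mul {w : W} {s t : B} (hP : H.Separated cs w s)
    (hQ : s ≠ t → H.InSector cs w s t) (hl : cs.length w < cs.length (cs.simple t * w)) :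
    H.Separated cs (cs.simple t * w) s := by
  rcases eq_or_ne s t with rfl | hst
  · right
    rw [CoxeterSystem.simple_mul_simple_cancel_left]
    refine ⟨fun z hz => ?_, hl⟩
    rcases hP with hP | hP
    · rw [map_mul, action_simple, Equiv.Perm.mul_apply, side_reflection_self]
      linarith [hP z hz]
    · omega
  · obtain ⟨j, hj, hz, hlw⟩ := (hQ hst).exists_of_length_lt hl
    have hdec : cs.simple t * w = cs.alternating t s (j + 1)
        * ((cs.alternating s t j)⁻¹ * w) := by
      rw [CoxeterSystem.alternating_succ]; group
    by_cases hlast : M s t ≠ 0 ∧ j + 1 = M s t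
    · right
      have hdec' : cs.simple s * (cs.simple t * w) = cs.alternating t s j
          * ((cs.alternating s t j)⁻¹ * w) := by
        rw [hdec, hlast.2, ← cs.alternating_comm s t, ← hlast.2, ← mul_assoc,
          cs.simple_mul_alternating_succ]
      constructor
      · intro z hzc
        have h1 : H.action cs (cs.simple t * w) z
            = H.reflection s (H.action cs (cs.simple s * (cs.simple t * w)) z) := by
          rw [← H.action_simple cs, ← Equiv.Perm.mul_apply, ← map_mul,
            cs.simple_mul_simple_cancel_left]
        rw [h1, side_reflection_self, hdec', map_mul, Equiv.Perm.mul_apply]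
        have := H.side_alternating_nonneg cs hst (hz z hzc).1 (hz z hzc).2 hj
        linarith
      · rw [hdec']
        have h2 := cs.length_mul_le (cs.alternating t s j) ((cs.alternating s t j)⁻¹ * w)
        have h3 := cs.length_alternating_le t s j
        omega
    · left
      intro z hzc
      rw [hdec, map_mul, Equiv.Perm.mul_apply]
      refine H.side_alternating_nonneg cs hst (hz z hzc).1 (hz z hzc).2 fun h0 => ?_
      have := hj h0
      push Not at hlast
      have := hlast h0
      omega

/-- Here s is a left descent of w, so the dihedral prefix of s w may be taken to start with t, and
adding s in front gives a prefix of w. -/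
theorem inSector_of_not_nonneg {w : W} {s t : B} (hP : H.Separated cs w s)
    (hQ : H.InSector cs (cs.simple s * w) s t)
    (hw : ¬ ∀ z ∈ H.chamber, 0 ≤ H.side s (H.action cs w z)) : H.InSector cs w s t := by
  have hl := (hP.resolve_left hw).2
  have hl' : cs.length (cs.simple s * w) < cs.length (cs.simple s * (cs.simple s * w)) := by
    rwa [cs.simple_mul_simple_cancel_left]
  obtain ⟨j, hj, hz, hlw⟩ := hQ.symm.exists_of_length_lt hl'
  have h1 : (cs.alternating s t (j + 1))⁻¹ * w
      = (cs.alternating t s j)⁻¹ * (cs.simple s * w) := by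
    rw [CoxeterSystem.alternating_succ, mul_inv_rev, cs.inv_simple, mul_assoc]
  refine ⟨j + 1, _, Or.inl rfl, by rwa [M.symmetric], fun z hzc => ?_, ?_⟩
  · rw [h1]; exact (hz z hzc).symm
  · rw [h1]
    have := cs.length_simple_mul w s
    omega

variable (H cs)

/-- The two statements feed each other in an induction on length. For w ≠ 1 with left descent t,
separation for w follows from both statements for t w. The sector statement for w follows from
separation for w and the sector statement for shorter elements. -/
theorem separated_and_inSector (n : ℕ) :
    (∀ w : W, cs.length w = n → ∀ s, H.Separated cs w s) ∧
      ∀ w : W, cs.length w = n → ∀ s t, s ≠ t → H.InSector cs w s t := by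
  have hsec : ∀ w : W, (∀ s, H.Separated cs w s) → (∀ s, cs.length (cs.simple s * w)
      < cs.length w → ∀ t, s ≠ t → H.InSector cs (cs.simple s * w) s t) →
      ∀ s t, s ≠ t → H.InSector cs w s t := by
    intro w hP hQ s t hst
    by_cases h1 : ∀ z ∈ H.chamber, 0 ≤ H.side s (H.action cs w z)
    · by_cases h2 : ∀ z ∈ H.chamber, 0 ≤ H.side t (H.action cs w z)
      · refine ⟨0, 1, Or.inl rfl, fun _ => Nat.zero_le _, fun z hz => ?_, by simp⟩
        rw [inv_one, one_mul]
        exact ⟨h1 z hz, h2 z hz⟩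
      · exact (inSector_of_not_nonneg (hP t)
          (hQ t ((hP t).resolve_left h2).2 s hst.symm) h2).symm
    · exact inSector_of_not_nonneg (hP s) (hQ s ((hP s).resolve_left h1).2 t hst) h1
  induction n using Nat.strong_induction_on with
  | _ n ih =>
    have hP : ∀ w : W, cs.length w = n → ∀ s, H.Separated cs w s := by
      intro w hw s
      rcases eq_or_ne w 1 with rfl | hne
      · left; intro z hz; simpa using hz s
      · obtain ⟨t, ht⟩ := cs.exists_leftDescent_of_ne_one hne
        have ht' : cs.length (cs.simple t * w) < n := hw ▸ ht
        have h1 := ih _ ht'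
        have h2 := separated_simple_mul (s := s) (t := t) (h1.1 _ rfl s)
          (h1.2 _ rfl s t) (by rwa [cs.simple_mul_simple_cancel_left, hw])
        rwa [cs.simple_mul_simple_cancel_left] at h2
    exact ⟨hP, fun w hw => hsec w (hP w hw) fun s hs t hst => (ih _ (hw ▸ hs)).2 _ rfl s t hst⟩

/-- Since s is not a descent of s w, the image of the chamber under s w is on the positive side of
s. Reflecting it gives the image under w. -/
theorem side_action_nonpos {w : W} {s : B} (h : cs.IsLeftDescent w s) {z : 𝔻}
    (hz : z ∈ H.chamber) : H.side s (H.action cs w z) ≤ 0 := by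
  have h1 := (H.separated_and_inSector cs _).1 (cs.simple s * w) rfl s
  have h2 : cs.length (cs.simple s * w) < cs.length w := h
  rw [Separated, cs.simple_mul_simple_cancel_left] at h1
  have h3 := h1.resolve_right (fun h => by omega) z hz
  rw [map_mul, action_simple, Equiv.Perm.mul_apply, side_reflection_self] at h3
  linarith

/-- **Tits' theorem**: the chamber is a strict fundamental domain, and the stabiliser of a point of
the chamber is generated by the reflections in the sides through it. -/
theorem eq_and_mem_closure_of_action_eq {w : W} {x y : 𝔻} (hx : x ∈ H.chamber)
    (hy : y ∈ H.chamber) (h : H.action cs w x = y) :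
    x = y ∧ w ∈ Subgroup.closure (cs.simple '' {i | H.side i x = 0}) := by
  induction hn : cs.length w using Nat.strong_induction_on generalizing w with
  | _ n ih =>
    rcases eq_or_ne w 1 with rfl | hne
    · exact ⟨by simpa using h, one_mem _⟩
    · obtain ⟨s, hs⟩ := cs.exists_leftDescent_of_ne_one hne
      have h1 := H.side_action_nonpos cs hs hx
      rw [h] at h1
      -- The point y lies on both sides of the mirror of s, hence on it. So s fixes y, and the
      -- induction applies to the shorter element s w.
      have h2 : H.side s y = 0 := le_antisymm h1 (hy s)
      have h3 : H.reflection s y = y := by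
        apply hyperboloid_injective
        rw [reflection, discReflectionPerm_apply, hyperboloid_discReflection, lorentzReflection]
        rw [side] at h2
        rw [h2]; simp
      have h4 : H.action cs (cs.simple s * w) x = y := by
        rw [map_mul, action_simple, Equiv.Perm.mul_apply, h, h3]
      obtain ⟨h5, h6⟩ := ih _ (hn ▸ hs) h4 rfl
      refine ⟨h5, ?_⟩
      have h7 := mul_mem (Subgroup.subset_closure ⟨s, by rw [mem_ofPred_eq, h5, h2], rfl⟩ :
        cs.simple s ∈ Subgroup.closure (cs.simple '' {i | H.side i x = 0})) h6
      rwa [cs.simple_mul_simple_cancel_left] at h7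

end HyperbolicMirrors

/-! ### Discreteness of the reflection group and covering by the chambers. -/

theorem one_lt_coshDist {z w : 𝔻} (h : z ≠ w) : 1 < coshDist z w := by
  have hz := UnitDisc.one_sub_normSq_pos z
  have hw := UnitDisc.one_sub_normSq_pos w
  have : 0 < normSq ((z : ℂ) - w) :=
    normSq_pos.2 (sub_ne_zero.2 fun h' => h (UnitDisc.coe_injective h'))
  rw [coshDist_eq, lt_add_iff_pos_right]
  positivity

/-- Hyperbolic balls form a basis of neighbourhoods: the points with cosh of the distance at most 2
lie in a compact set, and on its part outside U the distance to x has a positive minimum. -/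
theorem exists_coshDist_lt_subset {x : 𝔻} {U : Set 𝔻} (hU : IsOpen U) (hx : x ∈ U) :
    ∃ η > 1, ∀ y, coshDist y x < η → y ∈ U := by
  obtain ⟨K, hK, hK'⟩ := exists_isCompact_of_coshDist_le (isCompact_singleton (x := x)) 2
  have hc : Continuous fun y => coshDist y x :=
    continuous_coshDist.comp (continuous_id.prodMk continuous_const)
  have hKU : IsCompact (K \ U) := hK.diff hU
  rcases (K \ U).eq_empty_or_nonempty with he | hne
  · refine ⟨2, by norm_num, fun y hy => ?_⟩
    by_contra hyU
    exact (he ▸ (⟨hK' y x rfl hy.le, hyU⟩ : y ∈ K \ U) : y ∈ (∅ : Set 𝔻))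
  · obtain ⟨y0, hy0, hmin⟩ := hKU.exists_isMinOn hne hc.continuousOn
    have h1 : 1 < coshDist y0 x := one_lt_coshDist fun h => hy0.2 (h ▸ hx)
    refine ⟨min 2 (coshDist y0 x), lt_min (by norm_num) h1, fun y hy => ?_⟩
    by_contra hyU
    have h2 : coshDist y0 x ≤ coshDist y x :=
      hmin ⟨hK' y x rfl (hy.le.trans (min_le_left _ _)), hyU⟩
    exact absurd (hy.trans_le (min_le_right _ _)) (not_lt.2 h2)

namespace HyperbolicMirrors

variable {B : Type*} {M : CoxeterMatrix B} (H : HyperbolicMirrors M)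
variable {W : Type*} [Group W] (cs : CoxeterSystem M W)

theorem continuous_side (i : B) : Continuous (H.side i) :=
  continuous_lorentz.comp (continuous_hyperboloid.prodMk continuous_const)

variable {x₀ : 𝔻} (hx₀ : ∀ i, 0 < H.side i x₀)
include hx₀

theorem eq_one_of_action_mem_chamber {w : W} (h : H.action cs w x₀ ∈ H.chamber) : w = 1 := by
  have h1 := (H.eq_and_mem_closure_of_action_eq cs (fun i => (hx₀ i).le) h rfl).2
  have h2 : {i | H.side i x₀ = 0} = ∅ := by ext i; simp [(hx₀ i).ne']
  simpa [h2] using h1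

variable [Finite B]

/-- A ball around x₀ lies in the chamber, so two translates of x₀ that are close to each other come
from the same element. Now cover K by finitely many sets of small diameter. -/
theorem finite_action_mem {K : Set 𝔻} (hK : IsCompact K) : {w : W | H.action cs w x₀ ∈ K}.Finite := by
  have hU : IsOpen {z : 𝔻 | ∀ i, 0 < H.side i z} := by
    have : {z : 𝔻 | ∀ i, 0 < H.side i z} = ⋂ i, {z | 0 < H.side i z} := by ext; simp
    rw [this]
    exact isOpen_iInter_of_finite fun i => isOpen_lt continuous_const (H.continuous_side i)
  obtain ⟨η, hη, hηU⟩ := exists_coshDist_lt_subset hU (show x₀ ∈ _ from hx₀)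
  have hV : ∀ k ∈ K, ∃ V ∈ 𝓝 k, ∀ y ∈ V, ∀ y' ∈ V, coshDist y y' < η := by
    intro k _
    have h1 : ∀ᶠ p : 𝔻 × 𝔻 in 𝓝 k ×ˢ 𝓝 k, coshDist p.1 p.2 < η := by
      rw [← nhds_prod_eq]
      exact continuous_coshDist.continuousAt.eventually_lt continuousAt_const (by simpa using hη)
    obtain ⟨V, hV, hV'⟩ := (eventually_prod_self_iff (r := fun y y' => coshDist y y' < η)).1 h1
    exact ⟨V, hV, hV'⟩
  choose! V hVn hV using hV
  obtain ⟨t, htK, ht⟩ := hK.elim_nhds_subcover V hVn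
  refine Set.Finite.subset (t.finite_toSet.biUnion
    (t := fun k => {w : W | k ∈ K ∧ H.action cs w x₀ ∈ V k}) fun k _ => ?_) ?_
  · refine Set.Subsingleton.finite fun w hw w' hw' => ?_
    have h1 := hV k hw.1 _ hw'.2 _ hw.2
    rw [← H.coshDist_action cs w⁻¹, ← Equiv.Perm.mul_apply, ← Equiv.Perm.mul_apply, ← map_mul,
      ← map_mul, inv_mul_cancel, map_one, Equiv.Perm.one_apply] at h1
    have h2 := H.eq_one_of_action_mem_chamber cs hx₀ fun i => (hηU _ h1 i).le
    exact inv_mul_eq_one.1 h2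
  · intro w hw
    obtain ⟨k, hk, hk'⟩ := mem_iUnion₂.1 (ht hw)
    exact mem_biUnion hk ⟨htK k hk, hk'⟩

/-- The translates of the chamber cover the disc. -/
theorem exists_action_mem_chamber (z : 𝔻) : ∃ w : W, H.action cs w z ∈ H.chamber := by
  obtain ⟨K, hK, hK'⟩ :=
    exists_isCompact_of_coshDist_le (isCompact_singleton (x := z)) (coshDist z x₀)
  have hfin : {w : W | coshDist (H.action cs w z) x₀ ≤ coshDist z x₀}.Finite := by
    refine ((H.finite_action_mem cs hx₀ hK).image (·⁻¹)).subset fun w hw => ?_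
    refine ⟨w⁻¹, hK' _ z rfl ?_, inv_inv w⟩
    rw [← H.coshDist_action cs w, ← Equiv.Perm.mul_apply, ← map_mul, mul_inv_cancel, map_one,
      Equiv.Perm.one_apply, coshDist_comm]
    exact hw
  -- Take a translate of z closest to x₀. If it were on the wrong side of a mirror, reflecting it
  -- would bring it closer.
  obtain ⟨w, hw, hmin⟩ := exists_min_image _ (fun w => coshDist (H.action cs w z) x₀) hfin
    ⟨1, by simp⟩
  refine ⟨w, fun s => ?_⟩
  by_contra! hs
  have h1 : coshDist (H.action cs (cs.simple s * w) z) x₀ < coshDist (H.action cs w z) x₀ := by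
    rw [map_mul, action_simple, Equiv.Perm.mul_apply, coshDist, lorentz_comm, coshDist,
      lorentz_comm _ (hyperboloid x₀), reflection, discReflectionPerm_apply,
      hyperboloid_discReflection, lorentzReflection, lorentz_sub_right, lorentz_smul_right]
    have h2 := hx₀ s
    rw [side] at hs h2
    nlinarith
  exact absurd (hmin _ (h1.le.trans hw)) (not_le.2 h1)

/-- If w k and k' are in K, with k in K and w k = k', then w x₀ is at bounded distance from K,
because w is an isometry. -/
theorem finite_image_inter_nonempty {K : Set 𝔻} (hK : IsCompact K) :
    {w : W | (H.action cs w '' K ∩ K).Nonempty}.Finite := by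
  rcases K.eq_empty_or_nonempty with rfl | hne
  · simp
  have hc : Continuous fun y => coshDist x₀ y :=
    continuous_coshDist.comp (continuous_const.prodMk continuous_id)
  obtain ⟨k0, -, hk0⟩ := hK.exists_isMaxOn hne hc.continuousOn
  obtain ⟨K', hK', hKK'⟩ := exists_isCompact_of_coshDist_le hK (coshDist x₀ k0)
  refine (H.finite_action_mem cs hx₀ hK').subset ?_
  rintro w ⟨_, ⟨k, hk, rfl⟩, hk'⟩
  refine hKK' _ _ hk' ?_
  rw [H.coshDist_action]
  exact hk0 hk

end HyperbolicMirrors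

section

/-! ### The quadrilateral -/

/-- The Coxeter matrix of a quadrilateral with angles `π/2, π/(2g), π/2, π/(2g)`. -/
def quadMatrix (g : ℕ) : CoxeterMatrix (Fin 4) where
  M := !![1, 2, 0, 2 * g; 2, 1, 2 * g, 0; 0, 2 * g, 1, 2; 2 * g, 0, 2, 1]
  isSymm := by ext i j; fin_cases i <;> fin_cases j <;> rfl
  diagonal i := by fin_cases i <;> rfl
  off_diagonal i j h := by
    fin_cases i <;> fin_cases j <;> first | exact absurd rfl h | (simp; try omega)

/-- The normals of a quadrilateral with angles `π/2, π/(2g), π/2, π/(2g)`, one side of which is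
at distance `d` from the opposite side. -/
def quadNormal (c d : ℝ) : Fin 4 → ℝ × ℂ :=
  ![(-(c * Real.cosh d / Real.sinh d), ⟨-c, √(1 + (c / Real.sinh d) ^ 2)⟩),
    (-Real.sinh d, ⟨-Real.cosh d, 0⟩),
    (-(c / Real.sinh d), ⟨0, -√(1 + (c / Real.sinh d) ^ 2)⟩),
    (0, ⟨1, 0⟩)]

section

variable {c d : ℝ}

theorem lorentz_quadNormal_zero_zero (hd : 0 < d) :
    lorentz (quadNormal c d 0) (quadNormal c d 0) = 1 := by
  have hs := Real.sinh_pos_iff.2 hd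
  have hc := Real.cosh_sq d
  have hY := Real.mul_self_sqrt (by positivity : 0 ≤ 1 + (c / Real.sinh d) ^ 2)
  simp only [lorentz, quadNormal, Matrix.cons_val]
  rw [hY]; field_simp; rw [hc]; ring

theorem lorentz_quadNormal_one_one : lorentz (quadNormal c d 1) (quadNormal c d 1) = 1 := by
  have hc := Real.cosh_sq d
  simp only [lorentz, quadNormal, Matrix.cons_val]
  linear_combination hc

theorem lorentz_quadNormal_two_two : lorentz (quadNormal c d 2) (quadNormal c d 2) = 1 := by
  have hY := Real.mul_self_sqrt (by positivity : 0 ≤ 1 + (c / Real.sinh d) ^ 2)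
  simp only [lorentz, quadNormal, Matrix.cons_val]
  rw [neg_mul_neg _ (√(1 + (c / Real.sinh d) ^ 2)), hY]; ring

theorem lorentz_quadNormal_three_three : lorentz (quadNormal c d 3) (quadNormal c d 3) = 1 := by
  simp [lorentz, quadNormal]

theorem lorentz_quadNormal_zero_one (hd : 0 < d) :
    lorentz (quadNormal c d 0) (quadNormal c d 1) = 0 := by
  have hs := Real.sinh_pos_iff.2 hd
  simp only [lorentz, quadNormal, Matrix.cons_val]
  field_simp; ring

theorem lorentz_quadNormal_zero_two_le (hc : 0 ≤ c) (hd : 0 < d) :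
    lorentz (quadNormal c d 0) (quadNormal c d 2) ≤ -1 := by
  have hs := Real.sinh_pos_iff.2 hd
  have hcc := Real.cosh_pos d
  have hY := Real.mul_self_sqrt (by positivity : 0 ≤ 1 + (c / Real.sinh d) ^ 2)
  simp only [lorentz, quadNormal, Matrix.cons_val]
  rw [mul_neg (√(1 + (c / Real.sinh d) ^ 2)), hY, neg_mul_neg, mul_zero]
  have : 0 ≤ c * Real.cosh d / Real.sinh d * (c / Real.sinh d) := by positivity
  nlinarith [sq_nonneg (c / Real.sinh d)]

theorem lorentz_quadNormal_zero_three : lorentz (quadNormal c d 0) (quadNormal c d 3) = -c := by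
  simp [lorentz, quadNormal]

theorem lorentz_quadNormal_one_two (hd : 0 < d) :
    lorentz (quadNormal c d 1) (quadNormal c d 2) = -c := by
  have hs := Real.sinh_pos_iff.2 hd
  simp only [lorentz, quadNormal, Matrix.cons_val]
  field_simp; ring

theorem lorentz_quadNormal_one_three_le : lorentz (quadNormal c d 1) (quadNormal c d 3) ≤ -1 := by
  simp [lorentz, quadNormal]

theorem lorentz_quadNormal_two_three : lorentz (quadNormal c d 2) (quadNormal c d 3) = 0 := by
  simp [lorentz, quadNormal]

end

theorem cos_pi_div_two_mul_nonneg {g : ℕ} (hg : 1 ≤ g) :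
    0 ≤ Real.cos (Real.pi / ((2 * g : ℕ) : ℝ)) := by
  have h1 : (1 : ℝ) ≤ g := by exact_mod_cast hg
  refine Real.cos_nonneg_of_mem_Icc ⟨?_, ?_⟩
  · have : 0 ≤ Real.pi / ((2 * g : ℕ) : ℝ) := by positivity
    linarith [Real.pi_pos]
  · push_cast
    rw [div_le_div_iff₀ (by positivity) (by positivity)]
    nlinarith [Real.pi_pos]

/-- The mirrors of the quadrilateral. -/
def quadMirrors {g : ℕ} (hg : 1 ≤ g) {d : ℝ} (hd : 0 < d) : HyperbolicMirrors (quadMatrix g) where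
  normal := quadNormal (Real.cos (Real.pi / ((2 * g : ℕ) : ℝ))) d
  unit i := by
    fin_cases i
    · exact lorentz_quadNormal_zero_zero hd
    · exact lorentz_quadNormal_one_one
    · exact lorentz_quadNormal_two_two
    · exact lorentz_quadNormal_three_three
  angle i j hij h := by
    have h2 : -Real.cos (Real.pi / ((2 : ℕ) : ℝ)) = 0 := by simp
    have h01 := (lorentz_quadNormal_zero_one (c := Real.cos (Real.pi / ((2 * g : ℕ) : ℝ))) hd).trans
      h2.symm
    have h23 := (lorentz_quadNormal_two_three
      (c := Real.cos (Real.pi / ((2 * g : ℕ) : ℝ))) (d := d)).trans h2.symm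
    fin_cases i <;> fin_cases j
    · exact absurd rfl hij
    · exact h01
    · exact absurd rfl h
    · exact lorentz_quadNormal_zero_three
    · exact (lorentz_comm _ _).trans h01
    · exact absurd rfl hij
    · exact lorentz_quadNormal_one_two hd
    · exact absurd rfl h
    · exact absurd rfl h
    · exact (lorentz_comm _ _).trans (lorentz_quadNormal_one_two hd)
    · exact absurd rfl hij
    · exact h23
    · exact (lorentz_comm _ _).trans lorentz_quadNormal_zero_three
    · exact absurd rfl h
    · exact (lorentz_comm _ _).trans h23
    · exact absurd rfl hij
  far i j h := by
    have hc := cos_pi_div_two_mul_nonneg hg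
    have h2g : 2 * g ≠ 0 := by omega
    fin_cases i <;> fin_cases j
    · exact absurd h one_ne_zero
    · exact absurd h two_ne_zero
    · exact lorentz_quadNormal_zero_two_le hc hd
    · exact absurd h h2g
    · exact absurd h two_ne_zero
    · exact absurd h one_ne_zero
    · exact absurd h h2g
    · exact lorentz_quadNormal_one_three_le
    · exact (lorentz_comm _ _).trans_le (lorentz_quadNormal_zero_two_le hc hd)
    · exact absurd h h2g
    · exact absurd h one_ne_zero
    · exact absurd h two_ne_zero
    · exact absurd h h2g
    · exact (lorentz_comm _ _).trans_le lorentz_quadNormal_one_three_le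
    · exact absurd h two_ne_zero
    · exact absurd h one_ne_zero

/-! ### The gluing of the tiles -/

/-- The tiles of the surface of genus `g`: `(k, c)` is the tile around the vertex `4 k + c` of the
polygon with `4 g` sides. -/
abbrev Tile (g : ℕ) : Type := ZMod g × Fin 4

/-- The position in its block of the neighbour of a tile across the side `i`. -/
def tileFlip (i c : Fin 4) : Fin 4 :=
  (![![1, 0, 3, 2], ![3, 2, 1, 0], ![1, 0, 3, 2], ![3, 2, 1, 0]] : Fin 4 → Fin 4 → Fin 4) i c

/-- The difference of the blocks of the neighbour of a tile across the side `i` and of the tile. -/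
def tileShift (i c : Fin 4) : ℤ :=
  (![![0, 0, 0, 0], ![0, 0, 0, 0], ![-1, 1, 0, 0], ![-1, 0, 0, 1]] : Fin 4 → Fin 4 → ℤ) i c

theorem tileFlip_tileFlip : ∀ i c, tileFlip i (tileFlip i c) = c := by decide

theorem tileShift_tileFlip : ∀ i c, tileShift i c + tileShift i (tileFlip i c) = 0 := by decide

variable {g : ℕ}

/-- The neighbour of a tile across the side `i`. -/
def tilePerm (g : ℕ) (i : Fin 4) : Equiv.Perm (Tile g) :=
  Function.Involutive.toPerm (fun p => (p.1 + (tileShift i p.2 : ZMod g), tileFlip i p.2)) fun p => by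
    refine Prod.ext ?_ (tileFlip_tileFlip i p.2)
    change p.1 + _ + _ = p.1
    rw [add_assoc, ← Int.cast_add, tileShift_tileFlip, Int.cast_zero, add_zero]

theorem tilePerm_apply (i : Fin 4) (p : Tile g) :
    tilePerm g i p = (p.1 + (tileShift i p.2 : ZMod g), tileFlip i p.2) := rfl

theorem tilePerm_tilePerm (i : Fin 4) (p : Tile g) : tilePerm g i (tilePerm g i p) = p :=
  (tilePerm g i).left_inv p

/-- The displacement of the square of the rotation around a vertex. -/
def tileRotation (i j c : Fin 4) : ℤ :=
  tileShift j c + tileShift i (tileFlip j c) + tileShift j (tileFlip i (tileFlip j c))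
    + tileShift i (tileFlip j (tileFlip i (tileFlip j c)))

theorem tileFlip_four : ∀ i j c, tileFlip i (tileFlip j (tileFlip i (tileFlip j c))) = c := by
  decide

theorem tilePerm_mul_sq (i j : Fin 4) (p : Tile g) :
    ((tilePerm g i * tilePerm g j) ^ 2) p = (p.1 + (tileRotation i j p.2 : ZMod g), p.2) := by
  simp only [pow_two, Equiv.Perm.mul_apply, tilePerm_apply]
  refine Prod.ext ?_ (tileFlip_four i j p.2)
  simp only [tileRotation, Int.cast_add]
  ring

theorem tilePerm_mul_sq_zpow (i j : Fin 4) (p : Tile g) (l : ℤ) :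
    (((tilePerm g i * tilePerm g j) ^ 2) ^ l) p
      = (p.1 + l * (tileRotation i j p.2 : ZMod g), p.2) := by
  have hinv : ∀ q : Tile g, ((tilePerm g i * tilePerm g j) ^ 2)⁻¹ q
      = (q.1 - (tileRotation i j q.2 : ZMod g), q.2) := by
    intro q
    rw [Equiv.Perm.inv_eq_iff_eq, tilePerm_mul_sq]
    simp
  induction l using Int.induction_on generalizing p with
  | zero => simp
  | succ n ih =>
    rw [zpow_add_one, Equiv.Perm.mul_apply, ih, tilePerm_mul_sq]
    refine Prod.ext ?_ rfl
    push_cast; ring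
  | pred n ih =>
    rw [zpow_sub_one, Equiv.Perm.mul_apply, ih, hinv]
    refine Prod.ext ?_ rfl
    push_cast; ring

/-- At the right angles the squared rotation fixes every tile. At the other vertices it moves the
block by a constant depending on the position, and g such moves are trivial in `ZMod g`. -/
theorem isLiftable_tilePerm : (quadMatrix g).IsLiftable (tilePerm g) := by
  have h2 : ∀ i j : Fin 4, (∀ c, tileRotation i j c = 0) →
      (tilePerm g i * tilePerm g j) ^ 2 = 1 := by
    intro i j h
    ext1 p
    rw [tilePerm_mul_sq, h]; simp
  have h2g : ∀ i j : Fin 4, (tilePerm g i * tilePerm g j) ^ (2 * g) = 1 := by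
    intro i j
    ext1 p
    rw [pow_mul, ← zpow_natCast, tilePerm_mul_sq_zpow]; simp
  have h1 : ∀ i : Fin 4, (tilePerm g i * tilePerm g i) ^ 1 = 1 := by
    intro i
    ext1 p
    rw [pow_one, Equiv.Perm.mul_apply, tilePerm_tilePerm, Equiv.Perm.one_apply]
  intro i j
  fin_cases i <;> fin_cases j <;>
    first
    | exact h1 _
    | exact pow_zero _
    | exact h2g _ _
    | exact h2 _ _ (by decide)

/-- The Coxeter group of the quadrilateral. -/
abbrev QuadGroup (g : ℕ) : Type := (quadMatrix g).Group

/-- The Coxeter system of the quadrilateral. -/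
abbrev quadSystem (g : ℕ) : CoxeterSystem (quadMatrix g) (QuadGroup g) :=
  (quadMatrix g).toCoxeterSystem

/-- The action of the Coxeter group on the tiles. -/
def tileAction (g : ℕ) : QuadGroup g →* Equiv.Perm (Tile g) :=
  (quadSystem g).lift ⟨tilePerm g, isLiftable_tilePerm⟩

@[simp] theorem tileAction_simple (i : Fin 4) :
    tileAction g ((quadSystem g).simple i) = tilePerm g i :=
  (quadSystem g).lift_apply_simple isLiftable_tilePerm i

end

/-! ### Coordinates on the quadrilateral -/

theorem kleinDisc_norm_lt_one {κ : ℂ} (h : normSq κ < 1) :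
    ‖κ / ((1 + √(1 - normSq κ) : ℝ) : ℂ)‖ < 1 := by
  have hr : 0 < √(1 - normSq κ) := Real.sqrt_pos.2 (by linarith)
  have hk : ‖κ‖ < 1 := by rw [normSq_eq_norm_sq] at h; nlinarith [norm_nonneg κ]
  rw [norm_div, norm_real, Real.norm_of_nonneg (by positivity), div_lt_one (by positivity)]
  linarith

/-- The point of the disc with given coordinate in the Klein model. -/
def kleinDisc (κ : ℂ) (h : normSq κ < 1) : 𝔻 :=
  UnitDisc.mk (κ / ((1 + √(1 - normSq κ) : ℝ) : ℂ)) (kleinDisc_norm_lt_one h)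

/-- Up to a positive factor the Klein coordinate is affine on the hyperboloid, so the sides of the
quadrilateral are cut out by affine inequalities in κ. -/
theorem hyperboloid_kleinDisc {κ : ℂ} (h : normSq κ < 1) :
    hyperboloid (kleinDisc κ h) = (√(1 - normSq κ))⁻¹ • ((1, κ) : ℝ × ℂ) := by
  have hr : 0 < √(1 - normSq κ) := Real.sqrt_pos.2 (by linarith)
  have hr2 := Real.sq_sqrt (by linarith : 0 ≤ 1 - normSq κ)
  set r := √(1 - normSq κ) with hrdef
  have hn : normSq (kleinDisc κ h : ℂ) = (1 - r) / (1 + r) := by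
    change normSq (κ / ((1 + r : ℝ) : ℂ)) = _
    rw [normSq_div, normSq_ofReal]
    field_simp
    nlinarith
  have h1 : 1 - (1 - r) / (1 + r) = 2 * r / (1 + r) := by field_simp; ring
  rw [hyperboloid, hn, h1]
  refine Prod.ext ?_ ?_
  · simp only [Prod.smul_fst, smul_eq_mul]
    field_simp; ring
  · change ((2 / (2 * r / (1 + r)) : ℝ) : ℂ) * (κ / ((1 + r : ℝ) : ℂ)) = r⁻¹ • κ
    have h2 : (2 / (2 * r / (1 + r)) : ℝ) = r⁻¹ * (1 + r) := by field_simp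
    have h3 : ((1 + r : ℝ) : ℂ) ≠ 0 := ofReal_ne_zero.2 (by positivity)
    rw [h2, real_smul, ofReal_mul]
    field_simp

theorem lorentz_hyperboloid_self (z : 𝔻) : lorentz (hyperboloid z) (hyperboloid z) = -1 := by
  have := coshDist_self z
  rw [coshDist] at this; linarith

theorem hyperboloid_fst_pos (z : 𝔻) : 0 < (hyperboloid z).1 := by
  have := UnitDisc.one_sub_normSq_pos z
  have h := normSq_nonneg (z : ℂ)
  rw [hyperboloid]; positivity

theorem exists_kleinDisc (z : 𝔻) : ∃ κ h, z = kleinDisc κ h ∧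
    hyperboloid z = (hyperboloid z).1 • ((1, κ) : ℝ × ℂ) := by
  have h0 := hyperboloid_fst_pos z
  have h1 := lorentz_hyperboloid_self z
  set X := hyperboloid z with hX
  have hκ : X.1 • ((1, (X.1⁻¹ : ℝ) • X.2) : ℝ × ℂ) = X := by
    refine Prod.ext (by simp) ?_
    simp only [Prod.smul_snd, smul_smul]
    rw [mul_inv_cancel₀ h0.ne', one_smul]
  have hn : 1 - normSq ((X.1⁻¹ : ℝ) • X.2) = (X.1⁻¹) ^ 2 := by
    rw [real_smul, normSq_mul, normSq_ofReal, normSq_apply]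
    rw [lorentz] at h1
    field_simp
    linarith
  have hlt : normSq ((X.1⁻¹ : ℝ) • X.2) < 1 := by
    have : 0 < (X.1⁻¹) ^ 2 := by positivity
    linarith
  refine ⟨_, hlt, ?_, hκ.symm⟩
  apply hyperboloid_injective
  rw [hyperboloid_kleinDisc, hn, Real.sqrt_sq (by positivity), inv_inv, hκ]

section QuadPoint

variable (c d : ℝ)

/-- The first Klein coordinate. -/
def quadFst (u : ℝ) : ℝ := u * Real.sinh d / (1 - u + u * Real.cosh d)

/-- The second Klein coordinate. -/
def quadSnd (u v : ℝ) : ℝ :=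
  (c / Real.sinh d * (v - (1 - v) * Real.cosh d) + c * (1 - v) * quadFst d u)
    / √(1 + (c / Real.sinh d) ^ 2)

variable {c d}

theorem quad_denom_pos {u : ℝ} (hu : u ∈ unitInterval) : 0 < 1 - u + u * Real.cosh d := by
  nlinarith [Real.one_le_cosh d, hu.1, hu.2]

/-- This is why `quadFst` has its form: the equations of sides 3 and 1 become u and 1 - u, up to a
common positive factor. -/
theorem sinh_sub_cosh_mul_quadFst {u : ℝ} (hu : u ∈ unitInterval) :
    Real.sinh d - Real.cosh d * quadFst d u
      = Real.sinh d / (1 - u + u * Real.cosh d) * (1 - u) := by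
  have h := (quad_denom_pos (d := d) hu).ne'
  obtain ⟨D, hD⟩ : ∃ D, D = 1 - u + u * Real.cosh d := ⟨_, rfl⟩
  rw [← hD] at h
  rw [quadFst, ← hD]
  field_simp
  rw [hD]; ring

theorem quadFst_nonneg (hd : 0 < d) {u : ℝ} (hu : u ∈ unitInterval) : 0 ≤ quadFst d u :=
  div_nonneg (mul_nonneg hu.1 (Real.sinh_pos_iff.2 hd).le) (quad_denom_pos hu).le

theorem cosh_mul_quadFst_le (hd : 0 < d) {u : ℝ} (hu : u ∈ unitInterval) :
    Real.cosh d * quadFst d u ≤ Real.sinh d := by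
  have h := sinh_sub_cosh_mul_quadFst (d := d) hu
  have h1 : 0 ≤ Real.sinh d / (1 - u + u * Real.cosh d) * (1 - u) :=
    mul_nonneg (div_nonneg (Real.sinh_pos_iff.2 hd).le (quad_denom_pos hu).le) (by linarith [hu.2])
  linarith

theorem quadFst_lt_one (hd : 0 < d) {u : ℝ} (hu : u ∈ unitInterval) : quadFst d u < 1 := by
  have h := cosh_mul_quadFst_le hd hu
  have h1 := Real.sinh_lt_cosh d
  have h2 := Real.cosh_pos d
  by_contra! h3
  nlinarith

theorem quad_factor_pos (hc : 0 < c) (hd : 0 < d) {u : ℝ} (hu : u ∈ unitInterval) :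
    0 < c / Real.sinh d * (1 + Real.cosh d) - c * quadFst d u := by
  have hs := Real.sinh_pos_iff.2 hd
  have h1 : c / Real.sinh d * (1 + Real.cosh d) - c * quadFst d u
      = c / Real.sinh d * (1 + Real.cosh d - Real.sinh d * quadFst d u) := by field_simp
  rw [h1]
  refine mul_pos (by positivity) ?_
  nlinarith [quadFst_lt_one hd hu, quadFst_nonneg hd hu, Real.sinh_lt_cosh d]

theorem quad_bound_one {S C ξ : ℝ} (hc1 : c ^ 2 < 1) (hs : 0 < S) (hsc : C ^ 2 = S ^ 2 + 1)
    (hC : 0 < C) (hξ0 : 0 ≤ ξ) (hξ1 : ξ < 1) (hξ : C * ξ ≤ S) :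
    c ^ 2 < (1 - ξ ^ 2) * (S ^ 2 + c ^ 2) := by
  have h1 : C ^ 2 * ξ ^ 2 ≤ S ^ 2 := by
    rw [← mul_pow]; exact pow_le_pow_left₀ (by positivity) hξ 2
  have h2 : 1 ≤ (1 - ξ ^ 2) * C ^ 2 := by
    have : (1 - ξ ^ 2) * C ^ 2 = C ^ 2 - C ^ 2 * ξ ^ 2 := by ring
    linarith
  have h3 : C ^ 2 * c ^ 2 < S ^ 2 + c ^ 2 := by
    have : C ^ 2 * c ^ 2 = S ^ 2 * c ^ 2 + c ^ 2 := by rw [hsc]; ring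
    have := mul_lt_mul_of_pos_left hc1 (sq_pos_of_pos hs)
    linarith
  have h4 : 0 < 1 - ξ ^ 2 := by nlinarith
  calc c ^ 2 ≤ (1 - ξ ^ 2) * C ^ 2 * c ^ 2 := le_mul_of_one_le_left (sq_nonneg c) h2
    _ = (1 - ξ ^ 2) * (C ^ 2 * c ^ 2) := by ring
    _ < _ := mul_lt_mul_of_pos_left h3 h4

theorem quad_bound_zero {S C ξ : ℝ} (hc1 : c ^ 2 < 1) (hs : 0 < S) (hsc : C ^ 2 = S ^ 2 + 1)
    (hC : 0 < C) (hξ0 : 0 ≤ ξ) (hξ1 : ξ < 1) (hξ : C * ξ ≤ S) :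
    (-(c * (C - S * ξ))) ^ 2 < (1 - ξ ^ 2) * (S ^ 2 + c ^ 2) := by
  have h1 : (S - C * ξ) ^ 2 ≤ S ^ 2 * (1 - ξ ^ 2) := by
    have e1 := mul_nonneg (mul_nonneg hC.le hξ0) (sub_nonneg.2 hξ)
    have e2 := congrArg (· * ξ ^ 2) hsc
    have e3 := sq_nonneg ξ
    have e4 : S ^ 2 * (1 - ξ ^ 2) - (S - C * ξ) ^ 2
        = 2 * (C * ξ * (S - C * ξ)) + (C ^ 2 * ξ ^ 2 - S ^ 2 * ξ ^ 2) := by ring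
    have e5 : (S ^ 2 + 1) * ξ ^ 2 = S ^ 2 * ξ ^ 2 + ξ ^ 2 := by ring
    linarith
  have h4 : 0 < 1 - ξ ^ 2 := by nlinarith
  have h2 : 0 < S ^ 2 * (1 - ξ ^ 2) := by positivity
  have h3 : c ^ 2 * (S - C * ξ) ^ 2 < S ^ 2 * (1 - ξ ^ 2) :=
    (mul_le_mul_of_nonneg_left h1 (sq_nonneg c)).trans_lt (mul_lt_of_lt_one_left h2 hc1)
  have h5 : (1 - ξ ^ 2) * (S ^ 2 + c ^ 2) - (-(c * (C - S * ξ))) ^ 2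
      = S ^ 2 * (1 - ξ ^ 2) - c ^ 2 * (S - C * ξ) ^ 2 := by
    linear_combination c ^ 2 * (ξ ^ 2 - 1) * hsc
  linarith

/-- On the vertical line of abscissa `quadFst d u`, the height is a convex combination, with weights
v and 1 - v, of the heights on sides 2 and 0. The bounds `quad_bound_one` and `quad_bound_zero`
place these two ends in the disc, and the square is convex. -/
theorem quad_normSq_lt_one (hc : 0 < c) (hc1 : c < 1) (hd : 0 < d) {u v : ℝ}
    (hu : u ∈ unitInterval) (hv : v ∈ unitInterval) :
    normSq ⟨quadFst d u, quadSnd c d u v⟩ < 1 := by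
  have hs := Real.sinh_pos_iff.2 hd
  have hC := Real.cosh_pos d
  have hsc := Real.cosh_sq d
  have hY := Real.sq_sqrt (by positivity : 0 ≤ 1 + (c / Real.sinh d) ^ 2)
  have hYp : 0 < √(1 + (c / Real.sinh d) ^ 2) := Real.sqrt_pos.2 (by positivity)
  have hξ0 := quadFst_nonneg hd hu
  have hξ1 := quadFst_lt_one hd hu
  have hξ := cosh_mul_quadFst_le hd hu
  rw [normSq_apply, quadSnd]
  dsimp only
  generalize quadFst d u = ξ at *
  generalize Real.sinh d = S at *
  generalize Real.cosh d = C at *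
  generalize √(1 + (c / S) ^ 2) = Y at *
  have hY2 : Y ^ 2 * S ^ 2 = S ^ 2 + c ^ 2 := by rw [hY]; field_simp
  have hc2 : c ^ 2 < 1 := by nlinarith
  have b1 := quad_bound_one (c := c) hc2 hs hsc hC hξ0 hξ1 hξ
  have b0 := quad_bound_zero (c := c) hc2 hs hsc hC hξ0 hξ1 hξ
  obtain ⟨η₀, hη₀⟩ : ∃ η₀, η₀ = -(c * (C - S * ξ)) := ⟨_, rfl⟩
  have hη : (c / S * (v - (1 - v) * C) + c * (1 - v) * ξ) / Y
      = (v * c + (1 - v) * η₀) / (S * Y) := by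
    rw [hη₀]; field_simp; ring
  rw [← hη₀] at b0
  have hconv : (v * c + (1 - v) * η₀) ^ 2 ≤ v * c ^ 2 + (1 - v) * η₀ ^ 2 := by
    have h1 : 0 ≤ v * (1 - v) * (c - η₀) ^ 2 :=
      mul_nonneg (mul_nonneg hv.1 (by linarith [hv.2])) (sq_nonneg _)
    have h2 : v * c ^ 2 + (1 - v) * η₀ ^ 2 - (v * c + (1 - v) * η₀) ^ 2
      = v * (1 - v) * (c - η₀) ^ 2 := by ring
    linarith
  have hb : v * c ^ 2 + (1 - v) * η₀ ^ 2 < (1 - ξ ^ 2) * (S ^ 2 + c ^ 2) := by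
    rcases hv.1.eq_or_lt with h | h
    · rw [← h]; linarith
    · linarith [mul_lt_mul_of_pos_left b1 h, mul_le_mul_of_nonneg_left b0.le (sub_nonneg.2 hv.2)]
  rw [hη, ← sq, ← sq, div_pow, mul_pow, mul_comm (S ^ 2), hY2]
  have : (v * c + (1 - v) * η₀) ^ 2 / (S ^ 2 + c ^ 2) < 1 - ξ ^ 2 := by
    rw [div_lt_iff₀ (by positivity)]; linarith
  linarith

end QuadPoint

theorem quad_cos_bounds {g : ℕ} (hg : 2 ≤ g) :
    0 < Real.cos (Real.pi / ((2 * g : ℕ) : ℝ)) ∧ Real.cos (Real.pi / ((2 * g : ℕ) : ℝ)) < 1 := by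
  have h1 : (2 : ℝ) ≤ g := by exact_mod_cast hg
  have h0 : 0 < Real.pi / ((2 * g : ℕ) : ℝ) := by positivity
  have h2 : Real.pi / ((2 * g : ℕ) : ℝ) < Real.pi / 2 := by
    push_cast
    rw [div_lt_div_iff₀ (by positivity) (by positivity)]
    nlinarith [Real.pi_pos]
  refine ⟨Real.cos_pos_of_mem_Ioo ⟨by linarith, h2⟩, ?_⟩
  rw [← Real.cos_zero]
  exact Real.cos_lt_cos_of_nonneg_of_le_pi_div_two le_rfl h2.le h0

section

variable {g : ℕ} (hg : 2 ≤ g) {d : ℝ} (hd : 0 < d)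

/-- The parametrization of the quadrilateral by the unit square. -/
def quadPoint (p : unitInterval × unitInterval) : 𝔻 :=
  kleinDisc ⟨quadFst d p.1, quadSnd (Real.cos (Real.pi / ((2 * g : ℕ) : ℝ))) d p.1 p.2⟩
    (quad_normSq_lt_one (quad_cos_bounds hg).1 (quad_cos_bounds hg).2 hd p.1.2 p.2.2)

theorem continuous_quadPoint : Continuous (quadPoint hg hd) := by
  rw [UnitDisc.isEmbedding_coe.continuous_iff]
  have h1 : Continuous fun p : unitInterval × unitInterval => quadFst d p.1 :=
    Continuous.div (by fun_prop) (by fun_prop) fun p => (quad_denom_pos p.1.2).ne'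
  have h2 : Continuous fun p : unitInterval × unitInterval =>
      quadSnd (Real.cos (Real.pi / ((2 * g : ℕ) : ℝ))) d p.1 p.2 := by
    unfold quadSnd
    fun_prop
  have h3 : Continuous fun p : unitInterval × unitInterval =>
      (⟨quadFst d p.1, quadSnd (Real.cos (Real.pi / ((2 * g : ℕ) : ℝ))) d p.1 p.2⟩ : ℂ) :=
    Complex.equivRealProdCLM.symm.continuous.comp (h1.prodMk h2)
  refine Continuous.div h3 (continuous_ofReal.comp (continuous_const.add
    (Real.continuous_sqrt.comp (continuous_const.sub (continuous_normSq.comp h3))))) fun p => ?_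
  exact ofReal_ne_zero.2 (by positivity)

/-- All that is needed of the parametrization: v : 1 - v is the ratio of the positions with respect
to sides 0 and 2, and u : 1 - u that for sides 3 and 1. -/
theorem exists_side_quadPoint (p : unitInterval × unitInterval) : ∃ μ > 0, ∃ ν > 0,
    (quadMirrors (by omega : 1 ≤ g) hd).side 0 (quadPoint hg hd p) = ν * p.2 ∧
    (quadMirrors (by omega : 1 ≤ g) hd).side 1 (quadPoint hg hd p) = μ * (1 - p.1) ∧
    (quadMirrors (by omega : 1 ≤ g) hd).side 2 (quadPoint hg hd p) = ν * (1 - p.2) ∧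
    (quadMirrors (by omega : 1 ≤ g) hd).side 3 (quadPoint hg hd p) = μ * p.1 := by
  obtain ⟨⟨u, hu⟩, ⟨v, hv⟩⟩ := p
  have hc := (quad_cos_bounds hg).1
  have hn := quad_normSq_lt_one hc (quad_cos_bounds hg).2 hd hu hv
  have hs := Real.sinh_pos_iff.2 hd
  have hden := quad_denom_pos (d := d) hu
  have hfac := quad_factor_pos hc hd hu
  have hone := sinh_sub_cosh_mul_quadFst (d := d) hu
  simp only [HyperbolicMirrors.side, quadPoint, hyperboloid_kleinDisc, lorentz_smul_left,
    quadMirrors]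
  set c := Real.cos (Real.pi / ((2 * g : ℕ) : ℝ))
  set l := (√(1 - normSq ⟨quadFst d u, quadSnd c d u v⟩))⁻¹
  have hl : 0 < l := inv_pos.2 (Real.sqrt_pos.2 (by linarith))
  have hYp : 0 < √(1 + (c / Real.sinh d) ^ 2) := Real.sqrt_pos.2 (by positivity)
  have hsnd : √(1 + (c / Real.sinh d) ^ 2) * quadSnd c d u v
      = c / Real.sinh d * (v - (1 - v) * Real.cosh d) + c * (1 - v) * quadFst d u := by
    rw [quadSnd]; field_simp
  refine ⟨l * (Real.sinh d / (1 - u + u * Real.cosh d)), by positivity,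
    l * (c / Real.sinh d * (1 + Real.cosh d) - c * quadFst d u), by positivity, ?_, ?_, ?_, ?_⟩
  · simp only [lorentz, quadNormal, Matrix.cons_val]
    linear_combination l * hsnd
  · simp only [lorentz, quadNormal, Matrix.cons_val]
    linear_combination l * hone
  · simp only [lorentz, quadNormal, Matrix.cons_val]
    linear_combination (-l) * hsnd
  · simp only [lorentz, quadNormal, Matrix.cons_val]
    rw [quadFst]; ring

theorem quadPoint_mem_chamber (p : unitInterval × unitInterval) :
    quadPoint hg hd p ∈ (quadMirrors (by omega : 1 ≤ g) hd).chamber := by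
  obtain ⟨μ, hμ, ν, hν, h0, h1, h2, h3⟩ := exists_side_quadPoint hg hd p
  intro i
  fin_cases i
  · exact h0.symm ▸ mul_nonneg hν.le p.2.2.1
  · exact h1.symm ▸ mul_nonneg hμ.le (sub_nonneg.2 p.1.2.2)
  · exact h2.symm ▸ mul_nonneg hν.le (sub_nonneg.2 p.2.2.2)
  · exact h3.symm ▸ mul_nonneg hμ.le p.1.2.1

theorem quadPoint_injective : Function.Injective (quadPoint hg hd) := by
  intro p q h
  obtain ⟨μ, hμ, ν, hν, h0, h1, h2, h3⟩ := exists_side_quadPoint hg hd p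
  obtain ⟨μ', hμ', ν', hν', h0', h1', h2', h3'⟩ := exists_side_quadPoint hg hd q
  rw [h] at h0 h1 h2 h3
  have e1 : μ = μ' := by linarith
  have e2 : ν = ν' := by linarith
  subst e1 e2
  refine Prod.ext (Subtype.ext ?_) (Subtype.ext ?_)
  · exact mul_left_cancel₀ hμ.ne' (h3.symm.trans h3')
  · exact mul_left_cancel₀ hν.ne' (h0.symm.trans h0')

theorem exists_quadPoint_eq {z : 𝔻} (hz : z ∈ (quadMirrors (by omega : 1 ≤ g) hd).chamber) :
    ∃ p, quadPoint hg hd p = z := by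
  obtain ⟨⟨ξ, η⟩, hκ, rfl, -⟩ := exists_kleinDisc z
  have hc := (quad_cos_bounds hg).1
  have hs := Real.sinh_pos_iff.2 hd
  have hC := Real.sinh_lt_cosh d
  have hside : ∀ i, 0 ≤ lorentz ((1, ⟨ξ, η⟩) : ℝ × ℂ)
      (quadNormal (Real.cos (Real.pi / ((2 * g : ℕ) : ℝ))) d i) := by
    intro i
    have h := hz i
    rw [HyperbolicMirrors.side, hyperboloid_kleinDisc, lorentz_smul_left] at h
    exact (mul_nonneg_iff_of_pos_left (inv_pos.2 (Real.sqrt_pos.2 (by linarith)))).1 h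
  have h0 := hside 0
  have h1 := hside 1
  have h2 := hside 2
  have h3 := hside 3
  simp only [lorentz, quadNormal, Matrix.cons_val] at h0 h1 h2 h3
  have key : ∃ u ∈ unitInterval, ∃ v ∈ unitInterval, quadFst d u = ξ ∧
      quadSnd (Real.cos (Real.pi / ((2 * g : ℕ) : ℝ))) d u v = η := by
    simp only [quadSnd]
    generalize Real.cos (Real.pi / ((2 * g : ℕ) : ℝ)) = c at *
    have hY : 0 < √(1 + (c / Real.sinh d) ^ 2) := Real.sqrt_pos.2 (by positivity)
    simp only [quadFst]
    generalize √(1 + (c / Real.sinh d) ^ 2) = Y at *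
    generalize Real.sinh d = S at *
    generalize Real.cosh d = C at *
    have hξ0 : 0 ≤ ξ := by linarith
    have hξS : C * ξ ≤ S := by linarith
    have hξ1 : ξ < 1 := by
      by_contra! h; nlinarith
    -- D is the sum of the forms of sides 3 and 1, and E below that of sides 0 and 2. Thus u and v
    -- are recovered as the shares of sides 3 and 0.
    obtain ⟨D, hD⟩ : ∃ D, D = ξ + (S - C * ξ) := ⟨_, rfl⟩
    have hDpos : 0 < D := by
      rcases hξ0.eq_or_lt with h | h
      · rw [hD, ← h]; linarith
      · linarith
    obtain ⟨E, hE⟩ : ∃ E, E = c / S * (1 + C) - c * ξ := ⟨_, rfl⟩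
    have hEpos : 0 < E := by
      have : E = c / S * (1 + C - S * ξ) := by rw [hE]; field_simp
      rw [this]
      exact mul_pos (by positivity) (by nlinarith)
    have hu : 1 - ξ / D + ξ / D * C = S / D := by field_simp; rw [hD]; ring
    refine ⟨ξ / D, ⟨by positivity, ?_⟩, (c * C / S - c * ξ + Y * η) / E, ⟨?_, ?_⟩, ?_, ?_⟩
    · rw [div_le_one hDpos]; linarith
    · refine div_nonneg ?_ hEpos.le
      linarith
    · rw [div_le_one hEpos, hE]
      have : c / S * (1 + C) = c / S + c * C / S := by ring
      linarith
    · rw [hu]; field_simp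
    · rw [hu]
      have e1 : ξ / D * S / (S / D) = ξ := by field_simp
      have e2 : 1 - (c * C / S - c * ξ + Y * η) / E = (c / S - Y * η) / E := by
        field_simp; rw [hE]; field_simp; ring
      rw [e1, e2, div_eq_iff hY.ne']
      have e3 : c / S * ((c * C / S - c * ξ + Y * η) / E - (c / S - Y * η) / E * C)
          + c * ((c / S - Y * η) / E) * ξ
          = (c / S * (1 + C) - c * ξ) * (Y * η) / E := by ring
      rw [e3, ← hE]
      field_simp
  obtain ⟨u, hu, v, hv, e1, e2⟩ := key
  refine ⟨(⟨u, hu⟩, ⟨v, hv⟩), hyperboloid_injective ?_⟩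
  simp only [quadPoint, hyperboloid_kleinDisc, e1, e2]

end

section

/-! ### The surface group -/

/-- These words are stable under left multiplication by a, because a conjugates a b to its inverse,
and by b, because b = a (a b). -/
theorem exists_zpow_of_mem_closure_pair {G : Type*} [Group G] {a b : G} (ha : a * a = 1)
    (hb : b * b = 1) {w : G} (hw : w ∈ Subgroup.closure {a, b}) :
    ∃ n : ℤ, w = (a * b) ^ n ∨ w = (a * b) ^ n * a := by
  have ha' : a⁻¹ = a := inv_eq_of_mul_eq_one_left ha
  have hb' : b⁻¹ = b := inv_eq_of_mul_eq_one_left hb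
  have hconj : ∀ n : ℤ, a * (a * b) ^ n = (a * b) ^ (-n) * a := by
    intro n
    have h1 : a * (a * b) * a⁻¹ = (a * b)⁻¹ := by
      rw [mul_inv_rev, ha', hb', ← mul_assoc, ha, one_mul]
    have h2 := conj_zpow (i := n) (a := a) (b := a * b)
    rw [h1, inv_zpow', eq_mul_inv_iff_mul_eq] at h2
    exact h2.symm
  have hA : ∀ v : G, (∃ n : ℤ, v = (a * b) ^ n ∨ v = (a * b) ^ n * a) →
      ∃ n : ℤ, a * v = (a * b) ^ n ∨ a * v = (a * b) ^ n * a := by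
    rintro v ⟨n, rfl | rfl⟩
    · exact ⟨-n, Or.inr (hconj n)⟩
    · exact ⟨-n, Or.inl (by rw [← mul_assoc, hconj, mul_assoc, ha, mul_one])⟩
  have hB : ∀ v : G, (∃ n : ℤ, v = (a * b) ^ n ∨ v = (a * b) ^ n * a) →
      ∃ n : ℤ, b * v = (a * b) ^ n ∨ b * v = (a * b) ^ n * a := by
    rintro v ⟨n, h⟩
    have h1 : b * v = a * (a * b * v) := by
      rw [← mul_assoc, ← mul_assoc, ha, one_mul]
    rw [h1]
    refine hA _ ⟨1 + n, h.imp ?_ ?_⟩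
    · rintro rfl; rw [zpow_one_add]
    · rintro rfl; rw [zpow_one_add, mul_assoc (a * b)]
  have hmem : ∀ x ∈ ({a, b} : Set G), ∀ v : G, (∃ n : ℤ, v = (a * b) ^ n ∨ v = (a * b) ^ n * a) →
      ∃ n : ℤ, x * v = (a * b) ^ n ∨ x * v = (a * b) ^ n * a := by
    rintro x (rfl | rfl)
    exacts [hA, hB]
  induction hw using Subgroup.closure_induction_left with
  | one => exact ⟨0, Or.inl (zpow_zero _).symm⟩
  | mul_left x hx y _ ih => exact hmem x hx y ih
  | inv_mul_cancel x hx y _ ih =>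
    have hx' : x⁻¹ = x := by rcases hx with rfl | rfl <;> assumption
    rw [hx']
    exact hmem x hx y ih

variable {g : ℕ}

theorem tileFlip_ne : ∀ i c, tileFlip i c ≠ c := by decide

theorem tileFlip_three_ne : ∀ i j c, tileFlip i (tileFlip j (tileFlip i c)) ≠ c := by decide

theorem quadSimple_mul_self (i : Fin 4) :
    (quadSystem g).simple i * (quadSystem g).simple i = 1 := (quadSystem g).simple_mul_simple_self i

/-- The group generated by two adjacent sides acts freely on the tiles. -/
theorem eq_one_of_mem_closure_pair {i j : Fin 4} (hij : ∀ c, tileFlip i (tileFlip j c) ≠ c)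
    (hrot : quadMatrix g i j = 2 ∨ (quadMatrix g i j = 2 * g ∧
      ∀ c, tileRotation i j c = 1 ∨ tileRotation i j c = -1)) {w : QuadGroup g}
    (hw : w ∈ Subgroup.closure {(quadSystem g).simple i, (quadSystem g).simple j})
    {p : Tile g} (hp : tileAction g w p = p) : w = 1 := by
  have hpow : ∀ l : ℤ, ∀ q : Tile g,
      (tileAction g (((quadSystem g).simple i * (quadSystem g).simple j) ^ (2 * l))) q
        = (q.1 + l * (tileRotation i j q.2 : ZMod g), q.2) := by
    intro l q
    rw [zpow_mul, map_zpow, zpow_ofNat, map_pow, map_mul, tileAction_simple, tileAction_simple,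
      tilePerm_mul_sq_zpow]
  obtain ⟨n, hn⟩ := exists_zpow_of_mem_closure_pair (quadSimple_mul_self i)
    (quadSimple_mul_self j) hw
  -- An even power of the rotation keeps the position in the block and moves the block by ± l or 0.
  -- The three other kinds of elements change the position, hence fix no tile.
  obtain ⟨l, rfl | rfl⟩ := n.even_or_odd'
  · rcases hn with rfl | rfl
    · rw [hpow] at hp
      rcases hrot with h2 | ⟨h2g, hrot⟩
      · have h := (quadSystem g).simple_mul_simple_pow i j
        rw [h2] at h
        rw [zpow_mul, zpow_ofNat, h, one_zpow]
      · have h := (quadSystem g).simple_mul_simple_pow i j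
        rw [h2g] at h
        have h1 : (l : ZMod g) = 0 := by
          have h2 := congrArg Prod.fst hp
          dsimp only at h2
          rw [add_eq_left] at h2
          rcases hrot p.2 with h3 | h3 <;> rw [h3] at h2 <;> simpa using h2
        obtain ⟨k, rfl⟩ := (ZMod.intCast_zmod_eq_zero_iff_dvd _ _).1 h1
        rw [← mul_assoc, zpow_mul]
        have h4 : ((quadSystem g).simple i * (quadSystem g).simple j) ^ (2 * (g : ℤ)) = 1 := by
          exact_mod_cast h
        rw [h4, one_zpow]
    · rw [map_mul, Equiv.Perm.mul_apply, hpow, tileAction_simple, tilePerm_apply] at hp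
      exact (tileFlip_ne _ _ (congrArg Prod.snd hp)).elim
  · rcases hn with rfl | rfl
    · rw [zpow_add_one, map_mul, Equiv.Perm.mul_apply, hpow, map_mul, Equiv.Perm.mul_apply,
        tileAction_simple, tileAction_simple, tilePerm_apply, tilePerm_apply] at hp
      exact (hij _ (congrArg Prod.snd hp)).elim
    · rw [zpow_add_one, map_mul, Equiv.Perm.mul_apply, map_mul, Equiv.Perm.mul_apply, hpow, map_mul,
        Equiv.Perm.mul_apply, tileAction_simple, tileAction_simple, tilePerm_apply, tilePerm_apply,
        tilePerm_apply] at hp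
      exact (tileFlip_three_ne _ _ _ (congrArg Prod.snd hp)).elim

/-- The tiles are coloured alternately, so the colour records whether an element of W acts
holomorphically or antiholomorphically. -/
theorem tileFlip_parity : ∀ i c, (tileFlip i c).val % 2 ≠ c.val % 2 := by decide

/-- The base tile. -/
def baseTile (g : ℕ) : Tile g := (0, 1)

/-- The stabiliser of the base tile. -/
def tileStabilizer (g : ℕ) : Subgroup (QuadGroup g) :=
  (MulAction.stabilizer (Equiv.Perm (Tile g)) (baseTile g)).comap (tileAction g)

theorem mem_tileStabilizer {w : QuadGroup g} :
    w ∈ tileStabilizer g ↔ tileAction g w (baseTile g) = baseTile g := Iff.rfl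

/-- The group generated by the sides `0` and `3` is transitive on the tiles. -/
theorem exists_tileAction_eq (p q : Tile g) : ∃ w ∈ Subgroup.closure
    {(quadSystem g).simple 0, (quadSystem g).simple 3}, tileAction g w p = q := by
  have h1 : ∀ a b : Fin 4, ∃ i j : Fin 4, (i = 0 ∨ i = 3) ∧ (j = 0 ∨ j = 3) ∧
      (b = a ∨ b = tileFlip i a ∨ b = tileFlip i (tileFlip j a)) := by
    decide
  have hmem : ∀ i : Fin 4, (i = 0 ∨ i = 3) → (quadSystem g).simple i ∈ Subgroup.closure
      {(quadSystem g).simple 0, (quadSystem g).simple 3} := by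
    rintro i (rfl | rfl) <;> exact Subgroup.subset_closure (by simp)
  have h2 : ∃ w ∈ Subgroup.closure {(quadSystem g).simple 0, (quadSystem g).simple 3},
      (tileAction g w p).2 = q.2 := by
    obtain ⟨i, j, hi, hj, h | h | h⟩ := h1 p.2 q.2
    · exact ⟨1, one_mem _, by simp [h]⟩
    · exact ⟨(quadSystem g).simple i, hmem i hi, by rw [tileAction_simple, tilePerm_apply, h]⟩
    · refine ⟨(quadSystem g).simple i * (quadSystem g).simple j,
        mul_mem (hmem i hi) (hmem j hj), ?_⟩
      rw [map_mul, Equiv.Perm.mul_apply, tileAction_simple, tileAction_simple, tilePerm_apply,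
        tilePerm_apply, h]
  obtain ⟨w, hwm, hw⟩ := h2
  have hrot : ∀ c, tileRotation 0 3 c = 1 ∨ tileRotation 0 3 c = -1 := by decide
  -- The rotation moves the blocks by ± 1 according to the position, and e corrects this sign.
  obtain ⟨e, he⟩ : ∃ e : ℤ, ∀ r : Tile g, r.2 = q.2 → tileRotation 0 3 r.2 * e = 1 := by
    rcases hrot q.2 with h | h
    · exact ⟨1, fun r hr => by rw [hr, h]; rfl⟩
    · exact ⟨-1, fun r hr => by rw [hr, h]; rfl⟩
  obtain ⟨l, hl⟩ := ZMod.intCast_surjective (q.1 - (tileAction g w p).1)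
  refine ⟨(((quadSystem g).simple 0 * (quadSystem g).simple 3) ^ 2) ^ (l * e) * w,
    mul_mem (zpow_mem (pow_mem (mul_mem (hmem 0 (Or.inl rfl)) (hmem 3 (Or.inr rfl))) 2) _) hwm, ?_⟩
  rw [map_mul, Equiv.Perm.mul_apply, map_zpow, map_pow, map_mul, tileAction_simple,
    tileAction_simple, tilePerm_mul_sq_zpow]
  refine Prod.ext ?_ hw
  have h3 := congrArg (Int.cast : ℤ → ZMod g) (he _ hw)
  push_cast at h3 ⊢
  rw [mul_assoc, mul_comm (e : ZMod g), h3, hl]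
  ring

/-! ### The Fuchsian group and its free action. -/

section

variable (hg : 2 ≤ g) {d : ℝ} (hd : 0 < d)

/-- The action of the Coxeter group of the quadrilateral on the disc. -/
def quadAction : QuadGroup g →* Equiv.Perm 𝔻 :=
  (quadMirrors (by omega : 1 ≤ g) hd).action (quadSystem g)

theorem quadAction_simple (i : Fin 4) : quadAction hg hd ((quadSystem g).simple i)
    = (quadMirrors (by omega : 1 ≤ g) hd).reflection i :=
  HyperbolicMirrors.action_simple _ _ i

/-- The elements of the Coxeter group preserving the colour of the tiles are holomorphic. -/
theorem holomorphic_or_antiholomorphic (w : QuadGroup g) :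
    ((∀ p, (tileAction g w p).2.val % 2 = p.2.val % 2) ∧
      ContMDiff 𝓘(ℂ) 𝓘(ℂ) ω (quadAction hg hd w)) ∨
    ((∀ p, (tileAction g w p).2.val % 2 ≠ p.2.val % 2) ∧
      ContMDiff 𝓘(ℂ) 𝓘(ℂ) ω (fun z => star (quadAction hg hd w z))) := by
  induction w using (quadSystem g).simple_induction_left with
  | one => exact Or.inl ⟨fun p => by simp, by rw [map_one]; exact contMDiff_id⟩
  | mul_simple_left w i ih =>
    have hflip : ∀ p, (tileAction g ((quadSystem g).simple i * w) p).2
        = tileFlip i (tileAction g w p).2 := fun p => by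
      rw [map_mul, tileAction_simple, Equiv.Perm.mul_apply, tilePerm_apply]
    have hact : ∀ z, quadAction hg hd ((quadSystem g).simple i * w) z
        = discReflection ((quadMirrors (by omega : 1 ≤ g) hd).unit i) (quadAction hg hd w z) := by
      intro z
      rw [map_mul, quadAction_simple, Equiv.Perm.mul_apply]; rfl
    rcases ih with ⟨h1, h2⟩ | ⟨h1, h2⟩
    · refine Or.inr ⟨fun p => ?_, ?_⟩
      · rw [hflip, ← h1 p]; exact tileFlip_parity _ _
      · simp only [hact, star_discReflection]
        exact (contMDiff_reflectionMobius _).comp h2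
    · refine Or.inl ⟨fun p => ?_, ?_⟩
      · rw [hflip]
        have := tileFlip_parity i (tileAction g w p).2
        have := h1 p
        omega
      · have : (quadAction hg hd ((quadSystem g).simple i * w) : 𝔻 → 𝔻) = fun z =>
            reflectionMobius ((quadMirrors (by omega : 1 ≤ g) hd).unit i)
              (star (quadAction hg hd w z)) := funext hact
        rw [this]
        exact (contMDiff_reflectionMobius _).comp h2

theorem contMDiff_quadAction {w : QuadGroup g} (hw : w ∈ tileStabilizer g) :
    ContMDiff 𝓘(ℂ) 𝓘(ℂ) ω (quadAction hg hd w) := by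
  rcases holomorphic_or_antiholomorphic hg hd w with h | h
  · exact h.2
  · exact (h.1 (baseTile g) (by rw [mem_tileStabilizer.1 hw])).elim

/-- The action of the surface group on the disc. -/
def surfaceHom : tileStabilizer g →* DiscAut :=
  ((quadAction hg hd).comp (tileStabilizer g).subtype).codRestrict DiscAut fun w =>
    ⟨(contMDiff_quadAction hg hd w.2).mdifferentiable (by simp), by
      have h := contMDiff_quadAction hg hd (inv_mem w.2)
      rw [map_inv] at h
      exact h.mdifferentiable (by simp)⟩

theorem surfaceHom_smul (w : tileStabilizer g) (z : 𝔻) :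
    surfaceHom hg hd w • z = quadAction hg hd w z := rfl

/-- The Fuchsian group of the surface. -/
def surfaceGroup : Subgroup DiscAut := (surfaceHom hg hd).range

/-- The centre of the quadrilateral. -/
def quadCenter : 𝔻 := quadPoint hg hd (⟨1 / 2, by norm_num, by norm_num⟩, ⟨1 / 2, by norm_num, by norm_num⟩)

theorem side_quadCenter_pos (i : Fin 4) :
    0 < (quadMirrors (by omega : 1 ≤ g) hd).side i (quadCenter hg hd) := by
  obtain ⟨μ, hμ, ν, hν, h0, h1, h2, h3⟩ := exists_side_quadPoint hg hd
    (⟨1 / 2, by norm_num, by norm_num⟩, ⟨1 / 2, by norm_num, by norm_num⟩)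
  fin_cases i
  · exact h0.symm ▸ mul_pos hν (by norm_num)
  · exact h1.symm ▸ mul_pos hμ (by norm_num)
  · exact h2.symm ▸ mul_pos hν (by norm_num)
  · exact h3.symm ▸ mul_pos hμ (by norm_num)

theorem isFuchsian_surfaceGroup : IsFuchsian (surfaceGroup hg hd) := by
  intro K hK
  have hfin := (quadMirrors (by omega : 1 ≤ g) hd).finite_image_inter_nonempty (quadSystem g)
    (side_quadCenter_pos hg hd) hK
  have hfin' : {w : tileStabilizer g | (quadAction hg hd w '' K ∩ K).Nonempty}.Finite :=
    Set.Finite.preimage (f := ((↑) : tileStabilizer g → QuadGroup g))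
      Subtype.val_injective.injOn hfin
  refine (hfin'.image (surfaceHom hg hd)).subset ?_
  rintro _ ⟨⟨w, rfl⟩, hγ⟩
  exact ⟨w, hγ, rfl⟩

theorem exists_quadAction_quadPoint (z : 𝔻) : ∃ w p, z = quadAction hg hd w (quadPoint hg hd p) := by
  obtain ⟨w, hw⟩ := (quadMirrors (by omega : 1 ≤ g) hd).exists_action_mem_chamber (quadSystem g)
    (side_quadCenter_pos hg hd) z
  obtain ⟨p, hp⟩ := exists_quadPoint_eq hg hd hw
  refine ⟨w⁻¹, p, ?_⟩
  rw [hp, map_inv, Equiv.Perm.eq_inv_iff_eq]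
  rfl

/-- The group generated by the sides through a point of the quadrilateral. -/
def sideGroup (p : unitInterval × unitInterval) : Subgroup (QuadGroup g) :=
  Subgroup.closure ((quadSystem g).simple ''
    {i | (quadMirrors (by omega : 1 ≤ g) hd).side i (quadPoint hg hd p) = 0})

theorem quadAction_eq_quadPoint {w : QuadGroup g} {p q : unitInterval × unitInterval}
    (h : quadAction hg hd w (quadPoint hg hd p) = quadPoint hg hd q) :
    p = q ∧ w ∈ sideGroup hg hd p := by
  obtain ⟨h1, h2⟩ := (quadMirrors (by omega : 1 ≤ g) hd).eq_and_mem_closure_of_action_eq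
    (quadSystem g) (quadPoint_mem_chamber hg hd p) (quadPoint_mem_chamber hg hd q) h
  exact ⟨quadPoint_injective hg hd h1, h2⟩

theorem quadAction_of_mem_sideGroup {w : QuadGroup g} {p : unitInterval × unitInterval}
    (h : w ∈ sideGroup hg hd p) : quadAction hg hd w (quadPoint hg hd p) = quadPoint hg hd p := by
  have hle : sideGroup hg hd p ≤ (MulAction.stabilizer (Equiv.Perm 𝔻) (quadPoint hg hd p)).comap
      (quadAction hg hd) := by
    rw [sideGroup, Subgroup.closure_le]
    rintro _ ⟨i, hi, rfl⟩
    have hi' : lorentz (hyperboloid (quadPoint hg hd p))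
        ((quadMirrors (by omega : 1 ≤ g) hd).normal i) = 0 := hi
    change quadAction hg hd ((quadSystem g).simple i) (quadPoint hg hd p) = _
    rw [quadAction_simple]
    apply hyperboloid_injective
    rw [HyperbolicMirrors.reflection, discReflectionPerm_apply, hyperboloid_discReflection,
      lorentzReflection, hi']
    simp
  exact hle h

/-- Opposite sides do not meet, so the sides through the point are among two adjacent ones, whose
group acts freely on the tiles. -/
theorem eq_one_of_mem_sideGroup {w : QuadGroup g} {p : unitInterval × unitInterval}
    (h : w ∈ sideGroup hg hd p) {r : Tile g} (hr : tileAction g w r = r) : w = 1 := by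
  obtain ⟨μ, hμ, ν, hν, h0, h1, h2, h3⟩ := exists_side_quadPoint hg hd p
  have h02 : (quadMirrors (by omega : 1 ≤ g) hd).side 0 (quadPoint hg hd p) ≠ 0 ∨
      (quadMirrors (by omega : 1 ≤ g) hd).side 2 (quadPoint hg hd p) ≠ 0 := by
    by_contra! hh; rw [h0, h2] at hh; nlinarith [hh.1, hh.2]
  have h13 : (quadMirrors (by omega : 1 ≤ g) hd).side 1 (quadPoint hg hd p) ≠ 0 ∨
      (quadMirrors (by omega : 1 ≤ g) hd).side 3 (quadPoint hg hd p) ≠ 0 := by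
    by_contra! hh; rw [h1, h3] at hh; nlinarith [hh.1, hh.2]
  have key : ∀ i j : Fin 4, {k | (quadMirrors (by omega : 1 ≤ g) hd).side k
      (quadPoint hg hd p) = 0} ⊆ {i, j} →
      w ∈ Subgroup.closure {(quadSystem g).simple i, (quadSystem g).simple j} := by
    intro i j hij
    refine Subgroup.closure_mono ?_ h
    refine (image_mono hij).trans ?_
    rw [image_pair]
  have hsub : ∀ a b i j : Fin 4, (quadMirrors (by omega : 1 ≤ g) hd).side a (quadPoint hg hd p) ≠ 0 →
      (quadMirrors (by omega : 1 ≤ g) hd).side b (quadPoint hg hd p) ≠ 0 →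
      (∀ k, k = a ∨ k = b ∨ k = i ∨ k = j) →
      w ∈ Subgroup.closure {(quadSystem g).simple i, (quadSystem g).simple j} := by
    intro a b i j ha hb hk
    refine key i j fun k hk0 => ?_
    rcases hk k with rfl | rfl | h | h
    · exact (ha hk0).elim
    · exact (hb hk0).elim
    · exact Or.inl h
    · exact Or.inr h
  rcases h02 with ha | ha <;> rcases h13 with hb | hb
  · exact eq_one_of_mem_closure_pair (by decide) (Or.inl rfl)
      (hsub 0 1 2 3 ha hb (by decide)) hr
  · exact eq_one_of_mem_closure_pair (by decide) (Or.inr ⟨rfl, by decide⟩)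
      (hsub 0 3 1 2 ha hb (by decide)) hr
  · exact eq_one_of_mem_closure_pair (by decide) (Or.inr ⟨rfl, by decide⟩)
      (hsub 2 1 0 3 ha hb (by decide)) hr
  · exact eq_one_of_mem_closure_pair (by decide) (Or.inl rfl)
      (hsub 2 3 0 1 ha hb (by decide)) hr

/-- A conjugate in W of an element with a fixed point fixes a point of the quadrilateral, so lies in
its side group. It also fixes a tile, as a conjugate of an element fixing the base tile. -/
theorem surfaceGroup_free : ∀ γ ∈ surfaceGroup hg hd, γ ≠ 1 → ∀ z : 𝔻, γ • z ≠ z := by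
  rintro _ ⟨v, rfl⟩ hne z hz
  apply hne
  obtain ⟨w, p, rfl⟩ := exists_quadAction_quadPoint hg hd z
  rw [surfaceHom_smul] at hz
  have h1 : quadAction hg hd (w⁻¹ * v * w) (quadPoint hg hd p) = quadPoint hg hd p := by
    rw [map_mul, map_mul, map_inv, Equiv.Perm.mul_apply, Equiv.Perm.mul_apply, hz]
    exact (quadAction hg hd w).symm_apply_apply _
  have h2 : tileAction g (w⁻¹ * v * w) (tileAction g w⁻¹ (baseTile g))
      = tileAction g w⁻¹ (baseTile g) := by
    rw [← Equiv.Perm.mul_apply, ← map_mul, mul_assoc, mul_inv_cancel, mul_one, map_mul,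
      Equiv.Perm.mul_apply, mem_tileStabilizer.1 v.2]
  have h3 := eq_one_of_mem_sideGroup hg hd (quadAction_eq_quadPoint hg hd h1).2 h2
  have h4 : (v : QuadGroup g) = 1 := by
    have : (v : QuadGroup g) = w * (w⁻¹ * v * w) * w⁻¹ := by group
    rw [this, h3]; group
  rw [show v = 1 from Subtype.ext h4, map_one]

end

end

/-! ### The quotient as a union of tiles -/

theorem UnitDisc.continuous_star : Continuous (star : 𝔻 → 𝔻) := by
  rw [UnitDisc.isEmbedding_coe.continuous_iff]
  exact continuous_conj.comp UnitDisc.continuous_coe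

theorem continuous_quadAction {g : ℕ} (hg : 2 ≤ g) {d : ℝ} (hd : 0 < d) (w : QuadGroup g) :
    Continuous (quadAction hg hd w) := by
  rcases holomorphic_or_antiholomorphic hg hd w with h | h
  · exact h.2.continuous
  · have := UnitDisc.continuous_star.comp h.2.continuous
    simpa [Function.comp_def] using this

section

variable {g : ℕ} (hg : 2 ≤ g) {d : ℝ} (hd : 0 < d)

/-- An element of the Coxeter group mapping the base tile to a given one. -/
def tileSection (j : Tile g) : QuadGroup g := (exists_tileAction_eq j (baseTile g)).choose

theorem tileAction_tileSection (j : Tile g) : tileAction g (tileSection j) j = baseTile g :=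
  (exists_tileAction_eq j (baseTile g)).choose_spec.2

theorem tileAction_tileSection_inv (j : Tile g) :
    tileAction g (tileSection j)⁻¹ (baseTile g) = j := by
  rw [map_inv, Equiv.Perm.inv_eq_iff_eq, tileAction_tileSection]

/-- The parametrization of the quotient surface by the tiles. -/
def tileProj (x : Tile g × unitInterval × unitInterval) : DiscQuotient (surfaceGroup hg hd) :=
  discProj _ (quadAction hg hd (tileSection x.1) (quadPoint hg hd x.2))

theorem continuous_discProj (Γ : Subgroup DiscAut) : Continuous (discProj Γ) :=
  continuous_quotient_mk'

theorem continuous_tileProj : Continuous (tileProj hg hd) := by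
  rw [continuous_prod_of_discrete_left]
  intro j
  exact (continuous_discProj _).comp
    ((continuous_quadAction hg hd (tileSection j)).comp (continuous_quadPoint hg hd))

/-- The chamber translated by w lies over the tile w⁻¹(base), which depends only on the class of w
modulo the stabiliser. -/
theorem tileProj_surjective : Function.Surjective (tileProj hg hd) := by
  intro y
  obtain ⟨z, rfl⟩ := Quotient.mk_surjective y
  obtain ⟨w, p, rfl⟩ := exists_quadAction_quadPoint hg hd z
  refine ⟨(tileAction g w⁻¹ (baseTile g), p), ?_⟩
  set j := tileAction g w⁻¹ (baseTile g) with hj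
  have hmem : w * (tileSection j)⁻¹ ∈ tileStabilizer g := by
    rw [mem_tileStabilizer, map_mul, Equiv.Perm.mul_apply, tileAction_tileSection_inv, hj,
      ← Equiv.Perm.mul_apply, ← map_mul, mul_inv_cancel, map_one, Equiv.Perm.one_apply]
  have h1 := discProj_smul (Γ := surfaceGroup hg hd) (γ := surfaceHom hg hd ⟨_, hmem⟩) ⟨_, rfl⟩
    (quadAction hg hd (tileSection j) (quadPoint hg hd p))
  rw [surfaceHom_smul, ← Equiv.Perm.mul_apply, ← map_mul, inv_mul_cancel_right] at h1
  exact h1.symm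

theorem tileProj_tileAction {w : QuadGroup g} {p : unitInterval × unitInterval}
    (hw : w ∈ sideGroup hg hd p) (i : Tile g) :
    tileProj hg hd (tileAction g w i, p) = tileProj hg hd (i, p) := by
  set j := tileAction g w i with hj
  have hmem : tileSection j * w * (tileSection i)⁻¹ ∈ tileStabilizer g := by
    rw [mem_tileStabilizer, map_mul, map_mul, Equiv.Perm.mul_apply, Equiv.Perm.mul_apply,
      tileAction_tileSection_inv, ← hj, tileAction_tileSection]
  have h1 := discProj_smul (Γ := surfaceGroup hg hd) (γ := surfaceHom hg hd ⟨_, hmem⟩) ⟨_, rfl⟩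
    (quadAction hg hd (tileSection i) (quadPoint hg hd p))
  rw [surfaceHom_smul, ← Equiv.Perm.mul_apply, ← map_mul, inv_mul_cancel_right, map_mul,
    Equiv.Perm.mul_apply, quadAction_of_mem_sideGroup hg hd hw] at h1
  exact h1

/-- With `tileProj_tileAction`, this determines the fibres of the projection: tiles are glued only
at equal coordinates, through the sides passing there. -/
theorem tileProj_eq {i j : Tile g} {p q : unitInterval × unitInterval}
    (h : tileProj hg hd (i, p) = tileProj hg hd (j, q)) :
    p = q ∧ ∃ w ∈ sideGroup hg hd p, tileAction g w i = j := by
  obtain ⟨_, ⟨v, rfl⟩, hγ⟩ := exists_smul_of_discProj_eq h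
  rw [surfaceHom_smul] at hγ
  have h1 : quadAction hg hd ((tileSection j)⁻¹ * v * tileSection i) (quadPoint hg hd p)
      = quadPoint hg hd q := by
    rw [map_mul, map_mul, map_inv, Equiv.Perm.mul_apply, Equiv.Perm.mul_apply, hγ]
    exact (quadAction hg hd _).symm_apply_apply _
  obtain ⟨h2, h3⟩ := quadAction_eq_quadPoint hg hd h1
  refine ⟨h2, _, h3, ?_⟩
  rw [map_mul, map_mul, Equiv.Perm.mul_apply, Equiv.Perm.mul_apply, tileAction_tileSection,
    mem_tileStabilizer.1 v.2, tileAction_tileSection_inv]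

theorem side_quadPoint_eq_zero (p : unitInterval × unitInterval) :
    ((quadMirrors (by omega : 1 ≤ g) hd).side 0 (quadPoint hg hd p) = 0 ↔ (p.2 : ℝ) = 0) ∧
    ((quadMirrors (by omega : 1 ≤ g) hd).side 1 (quadPoint hg hd p) = 0 ↔ (p.1 : ℝ) = 1) ∧
    ((quadMirrors (by omega : 1 ≤ g) hd).side 2 (quadPoint hg hd p) = 0 ↔ (p.2 : ℝ) = 1) ∧
    ((quadMirrors (by omega : 1 ≤ g) hd).side 3 (quadPoint hg hd p) = 0 ↔ (p.1 : ℝ) = 0) := by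
  obtain ⟨μ, hμ, ν, hν, h0, h1, h2, h3⟩ := exists_side_quadPoint hg hd p
  rw [h0, h1, h2, h3]
  simp only [mul_eq_zero, hμ.ne', hν.ne', false_or, sub_eq_zero]
  exact ⟨trivial, eq_comm, eq_comm, trivial⟩

theorem simple_mem_sideGroup {i : Fin 4} {p : unitInterval × unitInterval}
    (h : (quadMirrors (by omega : 1 ≤ g) hd).side i (quadPoint hg hd p) = 0) :
    (quadSystem g).simple i ∈ sideGroup hg hd p := Subgroup.subset_closure ⟨i, h, rfl⟩

theorem tileProj_tilePerm {i : Fin 4} {p : unitInterval × unitInterval}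
    (h : (quadMirrors (by omega : 1 ≤ g) hd).side i (quadPoint hg hd p) = 0) (j : Tile g) :
    tileProj hg hd (tilePerm g i j, p) = tileProj hg hd (j, p) := by
  rw [← tileAction_simple]
  exact tileProj_tileAction hg hd (simple_mem_sideGroup hg hd h) j

theorem tileProj_center {p : unitInterval × unitInterval} (h1 : (p.1 : ℝ) = 0)
    (h2 : (p.2 : ℝ) = 0) (i j : Tile g) : tileProj hg hd (i, p) = tileProj hg hd (j, p) := by
  obtain ⟨w, hw, rfl⟩ := exists_tileAction_eq i j
  refine (tileProj_tileAction hg hd ?_ i).symm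
  have hs := side_quadPoint_eq_zero hg hd p
  refine (Subgroup.closure_le _).2 ?_ hw
  rintro _ (rfl | rfl)
  · exact simple_mem_sideGroup hg hd (hs.1.2 h2)
  · exact simple_mem_sideGroup hg hd (hs.2.2.2.2 h1)

theorem compactSpace_discQuotient_surfaceGroup :
    CompactSpace (DiscQuotient (surfaceGroup hg hd)) := by
  have : NeZero g := ⟨by omega⟩
  rw [← isCompact_univ_iff, ← (tileProj_surjective hg hd).range_eq]
  exact isCompact_range (continuous_tileProj hg hd)

end

/-! ### Polar coordinates on the standard surface -/

section

variable {g : ℕ}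

theorem norm_circlePoint (g : ℕ) (t : ℝ) : ‖circlePoint g t‖ = 1 := norm_exp_ofReal_mul_I _

theorem continuous_circlePoint (g : ℕ) : Continuous (circlePoint g) := by
  unfold circlePoint
  fun_prop

theorem circlePoint_eq_iff (hg : g ≠ 0) {s t : ℝ} :
    circlePoint g s = circlePoint g t ↔ ∃ n : ℤ, s = t + 4 * g * n := by
  have hg' : (g : ℝ) ≠ 0 := Nat.cast_ne_zero.2 hg
  rw [circlePoint, circlePoint, exp_eq_exp_iff_exists_int]
  refine exists_congr fun n => ?_
  have h1 : ((2 * Real.pi * t / (4 * g) : ℝ) : ℂ) * I + n * (2 * Real.pi * I)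
      = ((2 * Real.pi * t / (4 * g) + n * (2 * Real.pi) : ℝ) : ℂ) * I := by push_cast; ring
  rw [h1, mul_left_inj' I_ne_zero, ofReal_inj]
  have hp := Real.pi_pos.ne'
  constructor
  · intro h
    field_simp at h
    linarith
  · rintro rfl
    field_simp

theorem circlePoint_congr {a b : ℤ} (h : (a : ZMod g) = b) (s : ℝ) :
    circlePoint g (4 * a + s) = circlePoint g (4 * b + s) := by
  rcases eq_or_ne g 0 with rfl | hg
  · have : a = b := by simpa using h
    rw [this]
  · rw [circlePoint_eq_iff hg]
    obtain ⟨k, hk⟩ := (ZMod.intCast_eq_intCast_iff_dvd_sub _ _ _).1 h.symm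
    refine ⟨k, ?_⟩
    have : (a : ℝ) - b = g * k := by exact_mod_cast hk
    linear_combination 4 * this

/-- The orientation of a tile. -/
def tileSign (c : Fin 4) : ℝ := (![1, -1, 1, -1] : Fin 4 → ℝ) c

theorem tileSign_mul_self (c : Fin 4) : tileSign c * tileSign c = 1 := by
  fin_cases c <;> simp [tileSign]

theorem abs_tileSign (c : Fin 4) : |tileSign c| = 1 := by
  fin_cases c <;> simp [tileSign]

/-- The point of the closed disc with given tile and coordinates. -/
def polarPoint (x : Tile g × unitInterval × unitInterval) : ℂ :=
  ((max x.2.1 x.2.2 : ℝ) : ℂ) * circlePoint g (4 * (x.1.1.val : ℝ) + (x.1.2.val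
    + tileSign x.1.2 * ((x.2.1 - x.2.2 : ℝ) / (2 * max (x.2.1 : ℝ) x.2.2))))

theorem norm_polarPoint (x : Tile g × unitInterval × unitInterval) :
    ‖polarPoint x‖ = max (x.2.1 : ℝ) x.2.2 := by
  rw [polarPoint, norm_mul, norm_circlePoint, mul_one, norm_real,
    Real.norm_of_nonneg (le_max_of_le_left x.2.1.2.1)]

/-- The angle is not continuous at the corner (0, 0), but the radius max(u, v) tends to 0 there. -/
theorem continuous_polarPoint : Continuous (polarPoint (g := g)) := by
  rw [continuous_prod_of_discrete_left]
  intro j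
  rw [continuous_iff_continuousAt]
  intro p
  rcases eq_or_ne (max (p.1 : ℝ) p.2) 0 with h | h
  · have h0 : polarPoint (j, p) = 0 := by rw [← norm_eq_zero, norm_polarPoint, h]
    rw [ContinuousAt, h0, tendsto_zero_iff_norm_tendsto_zero]
    simp only [norm_polarPoint]
    have : Continuous fun q : unitInterval × unitInterval => max (q.1 : ℝ) q.2 := by fun_prop
    simpa [h] using this.tendsto p
  · unfold polarPoint
    refine ContinuousAt.mul (by fun_prop) ((continuous_circlePoint g).continuousAt.comp ?_)
    refine ContinuousAt.add continuousAt_const (ContinuousAt.add continuousAt_const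
      (ContinuousAt.mul continuousAt_const (ContinuousAt.div (by fun_prop) (by fun_prop) ?_)))
    simpa using h

/-- The image in the standard surface of the point with given tile and coordinates. -/
def polarMk (x : Tile g × unitInterval × unitInterval) : Metric.closedBall (0 : ℂ) 1 :=
  ⟨polarPoint x, by
    rw [mem_closedBall_zero_iff, norm_polarPoint]; exact max_le x.2.1.2.2 x.2.2.2.2⟩

theorem continuous_polarMk : Continuous (polarMk (g := g)) :=
  continuous_polarPoint.subtype_mk _

end

/-! ### The genus of the quotient -/

section

variable {g : ℕ} [NeZero g]

theorem polarPoint_intCast (a : ℤ) (c : Fin 4) (p : unitInterval × unitInterval) :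
    polarPoint (((a : ZMod g), c), p) = ((max p.1 p.2 : ℝ) : ℂ) * circlePoint g (4 * (a : ℝ)
      + (c.val + tileSign c * ((p.1 - p.2 : ℝ) / (2 * max (p.1 : ℝ) p.2)))) := by
  rw [polarPoint]
  congr 1
  have := circlePoint_congr (g := g) (a := ((a : ZMod g).val : ℤ)) (b := a) (by simp)
    (c.val + tileSign c * ((p.1 - p.2 : ℝ) / (2 * max (p.1 : ℝ) p.2)))
  rw [← this]
  push_cast
  rfl

theorem polarPoint_of_fst_eq_one (a : ℤ) (c : Fin 4) {p : unitInterval × unitInterval}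
    (h : (p.1 : ℝ) = 1) : polarPoint (((a : ZMod g), c), p)
      = circlePoint g (4 * (a : ℝ) + (c.val + tileSign c * ((1 - p.2 : ℝ) / 2))) := by
  rw [polarPoint_intCast, h, max_eq_left p.2.2.2]
  simp

theorem polarPoint_of_snd_eq_one (a : ℤ) (c : Fin 4) {p : unitInterval × unitInterval}
    (h : (p.2 : ℝ) = 1) : polarPoint (((a : ZMod g), c), p)
      = circlePoint g (4 * (a : ℝ) + (c.val - tileSign c * ((1 - p.1 : ℝ) / 2))) := by
  rw [polarPoint_intCast, h, max_eq_right p.1.2.2]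
  simp only [ofReal_one, one_mul]
  congr 1
  ring

theorem polarMk_tilePerm_zero (j : Tile g) {p : unitInterval × unitInterval}
    (h : (p.2 : ℝ) = 0) : polarMk (tilePerm g 0 j, p) = polarMk (j, p) := by
  obtain ⟨k, c⟩ := j
  obtain ⟨a, rfl⟩ := ZMod.intCast_surjective k
  apply Subtype.ext
  change polarPoint _ = polarPoint _
  rcases eq_or_ne (p.1 : ℝ) 0 with h1 | h1
  · simp [polarPoint, h, h1]
  rw [tilePerm_apply, ← Int.cast_add, polarPoint_intCast, polarPoint_intCast, h,
    max_eq_left p.1.2.1]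
  have h2 : ((p.1 : ℝ) - 0) / (2 * p.1) = 1 / 2 := by field_simp; ring
  rw [h2]
  congr 2
  fin_cases c <;> simp [tileFlip, tileShift, tileSign] <;> norm_num

theorem polarMk_tilePerm_three (j : Tile g) {p : unitInterval × unitInterval}
    (h : (p.1 : ℝ) = 0) : polarMk (tilePerm g 3 j, p) = polarMk (j, p) := by
  obtain ⟨k, c⟩ := j
  obtain ⟨a, rfl⟩ := ZMod.intCast_surjective k
  apply Subtype.ext
  change polarPoint _ = polarPoint _
  rcases eq_or_ne (p.2 : ℝ) 0 with h1 | h1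
  · simp [polarPoint, h, h1]
  rw [tilePerm_apply, ← Int.cast_add, polarPoint_intCast, polarPoint_intCast, h,
    max_eq_right p.2.2.1]
  have h2 : (0 - (p.2 : ℝ)) / (2 * p.2) = -(1 / 2) := by field_simp; ring
  rw [h2]
  congr 2
  fin_cases c <;> simp [tileFlip, tileShift, tileSign] <;> ring

/-- The image in the standard surface of the point with given tile and coordinates. -/
def standardMk (x : Tile g × unitInterval × unitInterval) : StandardSurface g :=
  Quot.mk _ (polarMk x)

/-- Side 1 of the tiles consists of the halves of the edges a and a⁻¹. As the pairing is directed
from a to a⁻¹, it is used for the tiles 0 and 1, and the two others follow because crossing a side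
is an involution. -/
theorem standardMk_tilePerm_one (j : Tile g) {p : unitInterval × unitInterval}
    (h : (p.1 : ℝ) = 1) : standardMk (tilePerm g 1 j, p) = standardMk (j, p) := by
  have key : ∀ c : Fin 4, c = 0 ∨ c = 1 → ∀ k : ZMod g,
      standardMk (tilePerm g 1 (k, c), p) = standardMk ((k, c), p) := by
    intro c hc k
    have hk := ZMod.val_lt k
    have hkk : ((k.val : ℤ) : ZMod g) = k := by simp
    have e1 : tilePerm g 1 (k, c) = (((k.val : ℤ) : ZMod g), tileFlip 1 c) := by
      rw [tilePerm_apply, hkk]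
      rcases hc with rfl | rfl <;> simp [tileShift]
    have e2 : (k, c) = (((k.val : ℤ) : ZMod g), c) := by rw [hkk]
    have hv0 := p.2.2.1
    have hv1 := p.2.2.2
    rw [e1, e2]
    symm
    rcases hc with rfl | rfl
    · refine Quot.sound (SidePairing.a k.val hk ((1 - p.2) / 2) ⟨by linarith, by linarith⟩ _ _ ?_ ?_)
      · refine (polarPoint_of_fst_eq_one _ _ h).trans (congrArg _ ?_)
        simp [tileSign]
      · refine (polarPoint_of_fst_eq_one _ _ h).trans (congrArg _ ?_)
        simp [tileSign, tileFlip]; ring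
    · refine Quot.sound (SidePairing.a k.val hk (1 - (1 - p.2) / 2) ⟨by linarith, by linarith⟩ _ _
        ?_ ?_)
      · refine (polarPoint_of_fst_eq_one _ _ h).trans (congrArg _ ?_)
        simp [tileSign]; ring
      · refine (polarPoint_of_fst_eq_one _ _ h).trans (congrArg _ ?_)
        simp [tileSign, tileFlip]; ring
  obtain ⟨k, c⟩ := j
  have hc : ∀ c : Fin 4, (c = 0 ∨ c = 1) ∨ (tileFlip 1 c = 0 ∨ tileFlip 1 c = 1) := by decide
  rcases hc c with hc | hc
  · exact key c hc k
  · have := key _ hc (k + (tileShift 1 c : ZMod g))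
    rw [← tilePerm_apply 1 (k, c), tilePerm_tilePerm] at this
    exact this.symm

theorem standardMk_tilePerm_two (j : Tile g) {p : unitInterval × unitInterval}
    (h : (p.2 : ℝ) = 1) : standardMk (tilePerm g 2 j, p) = standardMk (j, p) := by
  have key : ∀ c : Fin 4, c = 1 ∨ c = 2 → ∀ k : ZMod g,
      standardMk (tilePerm g 2 (k, c), p) = standardMk ((k, c), p) := by
    intro c hc k
    have hk := ZMod.val_lt k
    have hkk : ((k.val : ℤ) : ZMod g) = k := by simp
    have e1 : tilePerm g 2 (k, c)
        = (((k.val + tileShift 2 c : ℤ) : ZMod g), tileFlip 2 c) := by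
      rw [tilePerm_apply, Int.cast_add, hkk]
    have e2 : (k, c) = (((k.val : ℤ) : ZMod g), c) := by rw [hkk]
    have hv0 := p.1.2.1
    have hv1 := p.1.2.2
    rw [e1, e2]
    symm
    rcases hc with rfl | rfl
    · refine Quot.sound (SidePairing.b k.val hk ((1 - p.1) / 2) ⟨by linarith, by linarith⟩ _ _ ?_ ?_)
      · refine (polarPoint_of_snd_eq_one _ _ h).trans (congrArg _ ?_)
        simp [tileSign]; ring
      · refine (polarPoint_of_snd_eq_one _ _ h).trans (congrArg _ ?_)
        simp [tileSign, tileFlip, tileShift]; ring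
    · refine Quot.sound (SidePairing.b k.val hk (1 - (1 - p.1) / 2) ⟨by linarith, by linarith⟩ _ _
        ?_ ?_)
      · refine (polarPoint_of_snd_eq_one _ _ h).trans (congrArg _ ?_)
        simp [tileSign]; ring
      · refine (polarPoint_of_snd_eq_one _ _ h).trans (congrArg _ ?_)
        simp [tileSign, tileFlip, tileShift]; ring
  obtain ⟨k, c⟩ := j
  have hc : ∀ c : Fin 4, (c = 1 ∨ c = 2) ∨ (tileFlip 2 c = 1 ∨ tileFlip 2 c = 2) := by decide
  rcases hc c with hc | hc
  · exact key c hc k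
  · have := key _ hc (k + (tileShift 2 c : ZMod g))
    rw [← tilePerm_apply 2 (k, c), tilePerm_tilePerm] at this
    exact this.symm

theorem exists_polarPoint_eq {r ρ : ℝ} (hr : r ∈ unitInterval) (hρ : |ρ| ≤ 1 / 2) (a : ℤ)
    (c : Fin 4) : ∃ p, polarPoint (((a : ZMod g), c), p)
      = r * circlePoint g (4 * (a : ℝ) + (c.val + tileSign c * ρ)) := by
  rw [abs_le] at hρ
  -- The larger coordinate must be r, and the sign of ρ tells which one it is.
  obtain ⟨u, hu, v, hv, hmax, hsub⟩ : ∃ u ∈ unitInterval, ∃ v ∈ unitInterval,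
      max u v = r ∧ u - v = 2 * r * ρ := by
    rcases le_total 0 ρ with h | h
    · have h1 : 0 ≤ r * (1 - 2 * ρ) := mul_nonneg hr.1 (by linarith)
      have h2 : 0 ≤ r * ρ := mul_nonneg hr.1 h
      exact ⟨r, hr, r * (1 - 2 * ρ), ⟨h1, by linarith [hr.2]⟩, max_eq_left (by linarith), by ring⟩
    · have h1 : 0 ≤ r * (1 + 2 * ρ) := mul_nonneg hr.1 (by linarith)
      have h2 : 0 ≤ r * (-ρ) := mul_nonneg hr.1 (by linarith)
      exact ⟨r * (1 + 2 * ρ), ⟨h1, by linarith [hr.2]⟩, r, hr, max_eq_right (by linarith), by ring⟩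
  refine ⟨(⟨u, hu⟩, ⟨v, hv⟩), ?_⟩
  rw [polarPoint_intCast]
  dsimp only
  rw [hmax, hsub]
  rcases eq_or_ne r 0 with rfl | h0
  · simp
  · rw [mul_div_cancel_left₀ _ (by positivity)]

theorem polarMk_surjective : Function.Surjective (polarMk (g := g)) := by
  rintro ⟨z, hz⟩
  have hg : (g : ℝ) ≠ 0 := Nat.cast_ne_zero.2 (NeZero.ne g)
  rw [mem_closedBall_zero_iff] at hz
  -- T is the argument measured in edges of the polygon. The nearest integer is the corner of the
  -- tile, and its quotient and remainder by 4 are the block and the position.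
  obtain ⟨T, hT⟩ : ∃ T, T = 4 * g * arg z / (2 * Real.pi) := ⟨_, rfl⟩
  have hcirc : circlePoint g T = exp (arg z * I) := by
    rw [circlePoint, hT]
    congr 3
    have := Real.pi_pos.ne'
    field_simp
  obtain ⟨c, hc⟩ : ∃ c : Fin 4, (c.val : ℤ) = round T % 4 :=
    ⟨⟨(round T % 4).toNat, by omega⟩, by simp; omega⟩
  have hρ : |tileSign c * (T - round T)| ≤ 1 / 2 := by
    rw [abs_mul, abs_tileSign, one_mul]; exact abs_sub_round T
  obtain ⟨p, hp⟩ := exists_polarPoint_eq (g := g) ⟨norm_nonneg z, hz⟩ hρ (round T / 4) c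
  refine ⟨(((round T / 4 : ℤ), c), p), Subtype.ext (hp.trans ?_)⟩
  have h1 : 4 * ((round T / 4 : ℤ) : ℝ) + c.val = round T := by
    have : 4 * (round T / 4) + (c.val : ℤ) = round T := by omega
    exact_mod_cast this
  rw [← mul_assoc, tileSign_mul_self, one_mul, ← add_assoc, h1, add_sub_cancel, hcirc,
    norm_mul_exp_arg_mul_I]

end

section

variable {g : ℕ} (hg : 2 ≤ g) {d : ℝ} (hd : 0 < d)

theorem standardMk_tilePerm [NeZero g] {i : Fin 4} {p : unitInterval × unitInterval}
    (h : (quadMirrors (by omega : 1 ≤ g) hd).side i (quadPoint hg hd p) = 0) (j : Tile g) :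
    standardMk (tilePerm g i j, p) = standardMk (j, p) := by
  obtain ⟨h0, h1, h2, h3⟩ := side_quadPoint_eq_zero hg hd p
  fin_cases i
  · exact congrArg (Quot.mk _) (polarMk_tilePerm_zero j (h0.1 h))
  · exact standardMk_tilePerm_one j (h1.1 h)
  · exact standardMk_tilePerm_two j (h2.1 h)
  · exact congrArg (Quot.mk _) (polarMk_tilePerm_three j (h3.1 h))

/-- It suffices to check the generators of the side group, that is, that crossing each side is
compatible with the gluing of the polygon. -/
theorem standardMk_eq_of_tileProj_eq [NeZero g] {x y : Tile g × unitInterval × unitInterval}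
    (h : tileProj hg hd x = tileProj hg hd y) : standardMk x = standardMk y := by
  obtain ⟨i, p⟩ := x
  obtain ⟨j, q⟩ := y
  obtain ⟨rfl, w, hw, rfl⟩ := tileProj_eq hg hd h
  have key : ∀ i, standardMk (tileAction g w i, p) = standardMk (i, p) := by
    clear h
    induction hw using Subgroup.closure_induction with
    | mem x hx =>
      obtain ⟨s, hs, rfl⟩ := hx
      intro i
      rw [tileAction_simple]
      exact standardMk_tilePerm hg hd hs i
    | one => intro i; simp
    | mul x y _ _ hx hy => intro i; rw [map_mul, Equiv.Perm.mul_apply, hx, hy]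
    | inv x _ hx =>
      intro i
      rw [← hx, ← Equiv.Perm.mul_apply, ← map_mul, mul_inv_cancel, map_one, Equiv.Perm.one_apply]
  exact (key i).symm

/-- Two points at the same place of consecutive tiles have the same projection. -/
theorem tileProj_eq_of_consecutive {a b : ℤ} {c c' : Fin 4} {p q : unitInterval × unitInterval}
    (h : 4 * a + (c.val : ℤ) = 4 * b + c'.val + 1) {M : ℝ} (hp : max (p.1 : ℝ) p.2 = M)
    (hq : max (q.1 : ℝ) q.2 = M) (hpM : tileSign c * (p.1 - p.2) = -M)
    (hqM : tileSign c' * (q.1 - q.2) = M) :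
    tileProj hg hd (((a : ZMod g), c), p) = tileProj hg hd (((b : ZMod g), c'), q) := by
  have hsign : tileSign c = -tileSign c' ∧ (tileSign c' = 1 ∧ (c' = 0 ∨ c' = 2) ∨
      tileSign c' = -1 ∧ (c' = 1 ∨ c' = 3)) := by
    clear hpM hqM
    fin_cases c' <;> fin_cases c <;> simp [tileSign] at h ⊢ <;> omega
  obtain ⟨hs, hs'⟩ := hsign
  have hp1 := p.1.2.1
  have hp2 := p.2.2.1
  have hq1 := q.1.2.1
  have hq2 := q.2.2.1
  have hpl := le_max_left (p.1 : ℝ) p.2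
  have hpr := le_max_right (p.1 : ℝ) p.2
  have hql := le_max_left (q.1 : ℝ) q.2
  have hqr := le_max_right (q.1 : ℝ) q.2
  rw [hs] at hpM
  have hpq : p = q := by
    refine Prod.ext (Subtype.ext ?_) (Subtype.ext ?_) <;>
      rcases hs' with ⟨h1, -⟩ | ⟨h1, -⟩ <;> rw [h1] at hpM hqM <;> linarith
  subst hpq
  obtain ⟨h0, h1, h2, h3⟩ := side_quadPoint_eq_zero hg hd p
  rcases hs' with ⟨h5, h6⟩ | ⟨h5, h6⟩ <;> rw [h5] at hqM
  · have e : (((a : ZMod g), c) : Tile g) = tilePerm g 0 ((b : ZMod g), c') := by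
      rw [tilePerm_apply, ← Int.cast_add]
      have : a = b + tileShift 0 c' ∧ c = tileFlip 0 c' := by
        rcases h6 with rfl | rfl <;> fin_cases c <;> simp [tileShift, tileFlip] at h ⊢ <;> omega
      rw [this.1, this.2]
    rw [e]
    exact tileProj_tilePerm hg hd (h0.2 (by linarith)) _
  · have e : (((a : ZMod g), c) : Tile g) = tilePerm g 3 ((b : ZMod g), c') := by
      rw [tilePerm_apply, ← Int.cast_add]
      have : a = b + tileShift 3 c' ∧ c = tileFlip 3 c' := by
        rcases h6 with rfl | rfl <;> fin_cases c <;> simp [tileShift, tileFlip] at h ⊢ <;> omega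
      rw [this.1, this.2]
    rw [e]
    exact tileProj_tilePerm hg hd (h3.2 (by linarith)) _

theorem abs_polar_angle_le (c : Fin 4) {p : unitInterval × unitInterval} {M : ℝ} (hM : 0 < M)
    (h : max (p.1 : ℝ) p.2 = M) : |tileSign c * ((p.1 - p.2 : ℝ) / (2 * M))| ≤ 1 / 2 := by
  have hp1 := p.1.2.1
  have hp2 := p.2.2.1
  have hpl := le_max_left (p.1 : ℝ) p.2
  have hpr := le_max_right (p.1 : ℝ) p.2
  rw [abs_mul, abs_tileSign, one_mul, abs_div, abs_of_pos (by positivity : 0 < 2 * M),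
    div_le_div_iff₀ (by positivity) two_pos]
  have : |(p.1 - p.2 : ℝ)| ≤ M := abs_le.2 ⟨by linarith, by linarith⟩
  linarith

/-- Angles within a tile differ from its corner by at most 1/2, so equal points lie in the same
tile, with equal coordinates, or in consecutive tiles on their common side. At the centre all tiles
meet. -/
theorem tileProj_eq_of_polarMk_eq {x y : Tile g × unitInterval × unitInterval}
    (h : polarMk x = polarMk y) : tileProj hg hd x = tileProj hg hd y := by
  have : NeZero g := ⟨by omega⟩
  obtain ⟨⟨k, c⟩, p⟩ := x
  obtain ⟨⟨k', c'⟩, q⟩ := y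
  obtain ⟨a, rfl⟩ := ZMod.intCast_surjective k
  obtain ⟨b, rfl⟩ := ZMod.intCast_surjective k'
  have h1 : polarPoint (((a : ZMod g), c), p) = polarPoint (((b : ZMod g), c'), q) :=
    congrArg Subtype.val h
  have hmax := congrArg norm h1
  rw [norm_polarPoint, norm_polarPoint] at hmax
  dsimp only at hmax
  obtain ⟨M, hM⟩ : ∃ M, max (p.1 : ℝ) p.2 = M := ⟨_, rfl⟩
  have hM' := hmax.symm.trans hM
  have hp1 := p.1.2.1
  have hp2 := p.2.2.1
  have hq1 := q.1.2.1
  have hq2 := q.2.2.1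
  have hpl := hM ▸ le_max_left (p.1 : ℝ) p.2
  have hpr := hM ▸ le_max_right (p.1 : ℝ) p.2
  have hql := hM' ▸ le_max_left (q.1 : ℝ) q.2
  have hqr := hM' ▸ le_max_right (q.1 : ℝ) q.2
  rcases (hp1.trans hpl).eq_or_lt with h0 | hpos
  · have hpq : p = q := Prod.ext (Subtype.ext (by linarith)) (Subtype.ext (by linarith))
    subst hpq
    exact tileProj_center hg hd (by linarith) (by linarith) _ _
  rw [polarPoint_intCast, polarPoint_intCast, hM, hM',
    mul_right_inj' (ofReal_ne_zero.2 hpos.ne'), circlePoint_eq_iff (NeZero.ne g)] at h1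
  obtain ⟨n, hn⟩ := h1
  -- Full turns are absorbed in the block, which only matters modulo g.
  obtain ⟨b', hb'⟩ : ∃ b', b' = b + g * n := ⟨_, rfl⟩
  have hbb : (b : ZMod g) = (b' : ZMod g) := by rw [hb']; simp
  rw [hbb]
  have hρ := abs_le.1 (abs_polar_angle_le c hpos hM)
  have hσ := abs_le.1 (abs_polar_angle_le c' hpos hM')
  obtain ⟨ρ, hρ'⟩ : ∃ ρ, ρ = tileSign c * ((p.1 - p.2 : ℝ) / (2 * M)) := ⟨_, rfl⟩
  obtain ⟨σ, hσ'⟩ : ∃ σ, σ = tileSign c' * ((q.1 - q.2 : ℝ) / (2 * M)) := ⟨_, rfl⟩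
  rw [← hρ'] at hρ hn
  rw [← hσ'] at hσ hn
  have hρM : tileSign c * (p.1 - p.2 : ℝ) = 2 * M * ρ := by rw [hρ']; field_simp
  have hσM : tileSign c' * (q.1 - q.2 : ℝ) = 2 * M * σ := by rw [hσ']; field_simp
  obtain ⟨N, hN⟩ : ∃ N : ℤ, N = 4 * a + c.val - (4 * b' + c'.val) := ⟨_, rfl⟩
  have hNr : (N : ℝ) = σ - ρ := by
    rw [hN, hb']; push_cast; linarith
  have hN1 : N ≤ 1 := by
    have : (N : ℝ) ≤ 1 := by linarith
    exact_mod_cast this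
  have hN2 : -1 ≤ N := by
    have : (-1 : ℝ) ≤ N := by linarith
    exact_mod_cast this
  have hcases : N = -1 ∨ N = 0 ∨ N = 1 := by omega
  rcases hcases with rfl | rfl | rfl
  · push_cast at hNr
    have e1 : ρ = 1 / 2 := by linarith
    have e2 : σ = -(1 / 2) := by linarith
    refine (tileProj_eq_of_consecutive hg hd (by omega) hM' hM ?_ ?_).symm
    · rw [hσM, e2]; ring
    · rw [hρM, e1]; ring
  · have hc := c.2
    have hc' := c'.2
    obtain rfl : a = b' := by omega
    obtain rfl : c = c' := Fin.ext (by omega)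
    have e1 : ρ = σ := by push_cast at hNr; linarith
    have e2 : (p.1 - p.2 : ℝ) = q.1 - q.2 := by
      have : tileSign c * (tileSign c * (p.1 - p.2 : ℝ))
          = tileSign c * (tileSign c * (q.1 - q.2 : ℝ)) := by rw [hρM, hσM, e1]
      rwa [← mul_assoc, ← mul_assoc, tileSign_mul_self, one_mul, one_mul] at this
    have hpq : p = q := by
      rcases max_choice (p.1 : ℝ) p.2 with h2 | h2 <;>
        rcases max_choice (q.1 : ℝ) q.2 with h3 | h3 <;> rw [hM] at h2 <;> rw [hM'] at h3 <;>
        exact Prod.ext (Subtype.ext (by linarith)) (Subtype.ext (by linarith))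
    rw [hpq]
  · push_cast at hNr
    have e1 : ρ = -(1 / 2) := by linarith
    have e2 : σ = 1 / 2 := by linarith
    refine tileProj_eq_of_consecutive hg hd (by omega) hM hM' ?_ ?_
    · rw [hρM, e1]; ring
    · rw [hσM, e2]; ring

/-- Each edge of the polygon is cut at its midpoint, and each half belongs to the tile of its end.
The pairing exchanges halves lying in neighbouring tiles across side 1 for a, across side 2 for b.
-/
theorem exists_tileProj_eq_of_sidePairing {z w : Metric.closedBall (0 : ℂ) 1}
    (h : SidePairing g z w) :
    ∃ x y, polarMk x = z ∧ polarMk y = w ∧ tileProj hg hd x = tileProj hg hd y := by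
  have : NeZero g := ⟨by omega⟩
  rcases h with ⟨k, hk, s, hs, _, _, hz, hw⟩ | ⟨k, hk, s, hs, _, _, hz, hw⟩
  · rcases le_total s (1 / 2) with h | h
    · obtain ⟨p, hp1, hp2⟩ : ∃ p : unitInterval × unitInterval, (p.1 : ℝ) = 1 ∧
          (p.2 : ℝ) = 1 - 2 * s :=
        ⟨(1, ⟨1 - 2 * s, by linarith [hs.1], by linarith [hs.1]⟩), rfl, rfl⟩
      refine ⟨((((k : ℤ) : ZMod g), 0), p), ((((k : ℤ) : ZMod g), 3), p), Subtype.ext ?_,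
        Subtype.ext ?_, ?_⟩
      · rw [hz]
        refine (polarPoint_of_fst_eq_one _ _ hp1).trans (congrArg _ ?_)
        simp [tileSign, hp2]
      · rw [hw]
        refine (polarPoint_of_fst_eq_one _ _ hp1).trans (congrArg _ ?_)
        simp [tileSign, hp2]; ring
      · have := tileProj_tilePerm hg hd ((side_quadPoint_eq_zero hg hd p).2.1.2 hp1)
          (((k : ℤ) : ZMod g), 3)
        simpa [tilePerm_apply, tileShift, tileFlip] using this
    · obtain ⟨p, hp1, hp2⟩ : ∃ p : unitInterval × unitInterval, (p.1 : ℝ) = 1 ∧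
          (p.2 : ℝ) = 2 * s - 1 :=
        ⟨(1, ⟨2 * s - 1, by linarith [hs.2], by linarith [hs.2]⟩), rfl, rfl⟩
      refine ⟨((((k : ℤ) : ZMod g), 1), p), ((((k : ℤ) : ZMod g), 2), p), Subtype.ext ?_,
        Subtype.ext ?_, ?_⟩
      · rw [hz]
        refine (polarPoint_of_fst_eq_one _ _ hp1).trans (congrArg _ ?_)
        simp [tileSign, hp2]; ring
      · rw [hw]
        refine (polarPoint_of_fst_eq_one _ _ hp1).trans (congrArg _ ?_)
        simp [tileSign, hp2]; ring
      · have := tileProj_tilePerm hg hd ((side_quadPoint_eq_zero hg hd p).2.1.2 hp1)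
          (((k : ℤ) : ZMod g), 2)
        simpa [tilePerm_apply, tileShift, tileFlip] using this
  · rcases le_total s (1 / 2) with h | h
    · obtain ⟨p, hp1, hp2⟩ : ∃ p : unitInterval × unitInterval, (p.2 : ℝ) = 1 ∧
          (p.1 : ℝ) = 1 - 2 * s :=
        ⟨(⟨1 - 2 * s, by linarith [hs.1], by linarith [hs.1]⟩, 1), rfl, rfl⟩
      refine ⟨((((k : ℤ) : ZMod g), 1), p), ((((k + 1 : ℤ) : ZMod g), 0), p), Subtype.ext ?_,
        Subtype.ext ?_, ?_⟩
      · rw [hz]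
        refine (polarPoint_of_snd_eq_one _ _ hp1).trans (congrArg _ ?_)
        simp [tileSign, hp2]; ring
      · rw [hw]
        refine (polarPoint_of_snd_eq_one _ _ hp1).trans (congrArg _ ?_)
        simp [tileSign, hp2]; ring
      · have := tileProj_tilePerm hg hd ((side_quadPoint_eq_zero hg hd p).2.2.1.2 hp1)
          (((k : ℤ) : ZMod g), 1)
        simpa [tilePerm_apply, tileShift, tileFlip] using this.symm
    · obtain ⟨p, hp1, hp2⟩ : ∃ p : unitInterval × unitInterval, (p.2 : ℝ) = 1 ∧
          (p.1 : ℝ) = 2 * s - 1 :=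
        ⟨(⟨2 * s - 1, by linarith [hs.2], by linarith [hs.2]⟩, 1), rfl, rfl⟩
      refine ⟨((((k : ℤ) : ZMod g), 2), p), ((((k : ℤ) : ZMod g), 3), p), Subtype.ext ?_,
        Subtype.ext ?_, ?_⟩
      · rw [hz]
        refine (polarPoint_of_snd_eq_one _ _ hp1).trans (congrArg _ ?_)
        simp [tileSign, hp2]; ring
      · rw [hw]
        refine (polarPoint_of_snd_eq_one _ _ hp1).trans (congrArg _ ?_)
        simp [tileSign, hp2]; ring
      · have := tileProj_tilePerm hg hd ((side_quadPoint_eq_zero hg hd p).2.2.1.2 hp1)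
          (((k : ℤ) : ZMod g), 2)
        simpa [tilePerm_apply, tileShift, tileFlip] using this.symm

/-- `standardMk` and `tileProj` are surjections from the same compact space with the same fibres.
The induced continuous bijection goes from a compact space to a Hausdorff one. -/
theorem hasGenus_discQuotient_surfaceGroup : HasGenus (DiscQuotient (surfaceGroup hg hd)) g := by
  have : NeZero g := ⟨by omega⟩
  have hT2 : T2Space (DiscQuotient (surfaceGroup hg hd)) :=
    ((isFuchsian_surfaceGroup hg hd).isSmoothQuotient (surfaceGroup_free hg hd)).2.1
  choose σ hσ using polarMk_surjective (g := g)
  have hφ : ∀ x, tileProj hg hd (σ (polarMk x)) = tileProj hg hd x :=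
    fun x => tileProj_eq_of_polarMk_eq hg hd (hσ _)
  let F : StandardSurface g → DiscQuotient (surfaceGroup hg hd) :=
    Quot.lift (fun z => tileProj hg hd (σ z)) fun z w h => by
      obtain ⟨x, y, rfl, rfl, hxy⟩ := exists_tileProj_eq_of_sidePairing hg hd h
      exact (hφ x).trans (hxy.trans (hφ y).symm)
  have hF : ∀ x, F (standardMk x) = tileProj hg hd x := hφ
  have hq : IsQuotientMap (standardMk (g := g)) :=
    isQuotientMap_quot_mk.comp
      (continuous_polarMk.isClosedMap.isQuotientMap continuous_polarMk polarMk_surjective)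
  have hFc : Continuous F := by
    rw [hq.continuous_iff]
    exact (continuous_tileProj hg hd).congr fun x => (hF x).symm
  have hFb : Function.Bijective F := by
    refine ⟨fun a b hab => ?_, fun y => ?_⟩
    · obtain ⟨x, rfl⟩ := hq.surjective a
      obtain ⟨y, rfl⟩ := hq.surjective b
      rw [hF, hF] at hab
      exact standardMk_eq_of_tileProj_eq hg hd hab
    · obtain ⟨x, rfl⟩ := tileProj_surjective hg hd y
      exact ⟨standardMk x, hF x⟩
  exact ⟨(Continuous.homeoOfEquivCompactToT2 (f := Equiv.ofBijective F hFb) hFc).symm⟩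

end

/-! ### Generators of the surface group -/

/-- The first coordinate is the hyperbolic cosine of the distance to 0, and 1 + 2 sinh² d = cosh 2d.
Equivalently |z| = tanh d. -/
theorem poincareDist_zero_of_hyperboloid_fst {z : 𝔻} {d : ℝ} (hd : 0 < d)
    (h : (hyperboloid z).1 = 1 + 2 * Real.sinh d ^ 2) : poincareDist 0 z = 2 * d := by
  have hS := Real.sinh_pos_iff.2 hd
  have hC := Real.cosh_pos d
  have hSC := Real.sinh_lt_cosh d
  have hsq := Real.cosh_sq d
  have hz := UnitDisc.one_sub_normSq_pos z
  have hn : ‖(z : ℂ)‖ = Real.sinh d / Real.cosh d := by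
    rw [hyperboloid] at h
    dsimp only at h
    rw [div_eq_iff hz.ne', normSq_eq_norm_sq] at h
    refine (sq_eq_sq₀ (norm_nonneg _) (by positivity)).1 ?_
    rw [div_pow, eq_div_iff (by positivity), hsq]
    linear_combination (1 / 2 : ℝ) * h
  have hexp : (1 + Real.sinh d / Real.cosh d) / (1 - Real.sinh d / Real.cosh d)
      = Real.exp (2 * d) := by
    have h1 : Real.cosh d - Real.sinh d ≠ 0 := by linarith
    have h2 : 1 - Real.sinh d / Real.cosh d = (Real.cosh d - Real.sinh d) / Real.cosh d := by
      field_simp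
    rw [h2, div_eq_iff (div_ne_zero h1 hC.ne')]
    rw [Real.cosh_sub_sinh, two_mul, Real.exp_add, Real.exp_neg]
    have := Real.cosh_add_sinh d
    have := Real.exp_pos d
    field_simp
    linarith
  rw [poincareDist]
  simp only [UnitDisc.coe_zero, map_zero, zero_mul, sub_zero, div_one, zero_sub, norm_neg]
  rw [hn, hexp, Real.log_exp]

section

variable {g : ℕ} (hg : 2 ≤ g) {d : ℝ} (hd : 0 < d)

theorem simple_mul_simple_mem_tileStabilizer :
    (quadSystem g).simple 3 * (quadSystem g).simple 1 ∈ tileStabilizer g := by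
  rw [mem_tileStabilizer, map_mul, Equiv.Perm.mul_apply, tileAction_simple, tileAction_simple,
    tilePerm_apply, tilePerm_apply]
  simp [baseTile, tileShift, tileFlip]

/-- The translation along the common perpendicular of two opposite sides. -/
def shortElement : DiscAut := surfaceHom hg hd ⟨_, simple_mul_simple_mem_tileStabilizer⟩

theorem poincareDist_shortElement : poincareDist 0 (shortElement hg hd • (0 : 𝔻)) = 2 * d := by
  apply poincareDist_zero_of_hyperboloid_fst hd
  have h0 : hyperboloid 0 = (1, 0) := by simp [hyperboloid]
  rw [shortElement, surfaceHom_smul, map_mul, quadAction_simple, quadAction_simple,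
    Equiv.Perm.mul_apply, HyperbolicMirrors.reflection, HyperbolicMirrors.reflection,
    discReflectionPerm_apply, discReflectionPerm_apply, hyperboloid_discReflection,
    hyperboloid_discReflection, h0]
  simp [lorentzReflection, lorentz, quadMirrors, quadNormal]
  ring

theorem shortElement_ne_one : shortElement hg hd ≠ 1 := by
  intro h
  have h1 := poincareDist_shortElement hg hd
  rw [h, one_smul, poincareDist] at h1
  simp at h1
  exact hd.ne' h1

theorem shortElement_mem : shortElement hg hd ∈ surfaceGroup hg hd := ⟨_, rfl⟩

/-- The elements of a group other than the identity that move a set to a set meeting it. -/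
def overlapSet (Γ : Subgroup DiscAut) (K : Set 𝔻) : Set DiscAut :=
  {γ | γ ∈ Γ ∧ γ ≠ 1 ∧ (((fun z : 𝔻 => γ • z) '' K) ∩ K).Nonempty}

theorem IsFuchsian.finite_overlapSet {Γ : Subgroup DiscAut} (hΓ : IsFuchsian Γ) {K : Set 𝔻}
    (hK : IsCompact K) : (overlapSet Γ K).Finite :=
  (hΓ K hK).subset fun _ h => ⟨h.1, h.2.2⟩

theorem inv_mem_overlapSet {Γ : Subgroup DiscAut} {K : Set 𝔻} {γ : DiscAut}
    (h : γ ∈ overlapSet Γ K) : γ⁻¹ ∈ overlapSet Γ K := by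
  obtain ⟨h1, h2, _, ⟨z, hz, rfl⟩, hz'⟩ := h
  exact ⟨inv_mem h1, inv_ne_one.2 h2, z, ⟨γ • z, hz', inv_smul_smul γ z⟩, hz⟩

/-- The union of the tiles. -/
def fundamentalRegion : Set 𝔻 :=
  ⋃ j : Tile g, quadAction hg hd (tileSection j) '' range (quadPoint hg hd)

theorem isCompact_fundamentalRegion : IsCompact (fundamentalRegion hg hd) := by
  have : NeZero g := ⟨by omega⟩
  exact isCompact_iUnion fun j =>
    (isCompact_range (continuous_quadPoint hg hd)).image (continuous_quadAction hg hd _)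

theorem mem_fundamentalRegion (j : Tile g) (p : unitInterval × unitInterval) :
    quadAction hg hd (tileSection j) (quadPoint hg hd p) ∈ fundamentalRegion hg hd :=
  mem_iUnion.2 ⟨j, mem_image_of_mem _ (mem_range_self p)⟩

theorem exists_side_quadPoint_eq_zero (i : Fin 4) :
    ∃ p, (quadMirrors (by omega : 1 ≤ g) hd).side i (quadPoint hg hd p) = 0 := by
  fin_cases i
  · exact ⟨(0, 0), (side_quadPoint_eq_zero hg hd _).1.2 rfl⟩
  · exact ⟨(1, 0), (side_quadPoint_eq_zero hg hd _).2.1.2 rfl⟩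
  · exact ⟨(0, 1), (side_quadPoint_eq_zero hg hd _).2.2.1.2 rfl⟩
  · exact ⟨(0, 0), (side_quadPoint_eq_zero hg hd _).2.2.2.2 rfl⟩

/-- Write an element of W as a word and follow the corresponding path of chambers. Each crossing of
a side contributes an element of the surface group that carries a point of the region on this side
to another point of the region, so it is trivial or belongs to the overlap set. -/
theorem exists_eq_mul_tileSection {K : Set 𝔻} (hK : fundamentalRegion hg hd ⊆ K)
    (w : QuadGroup g) : ∃ (v : tileStabilizer g) (i : Tile g), w = v * tileSection i ∧
      surfaceHom hg hd v ∈ Subgroup.closure (overlapSet (surfaceGroup hg hd) K) := by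
  -- The path has to start at the chosen representative of the base tile, which need not be 1.
  suffices h : ∀ w : QuadGroup g, ∃ (v : tileStabilizer g) (i : Tile g),
      tileSection (baseTile g) * w = v * tileSection i ∧
      surfaceHom hg hd v ∈ Subgroup.closure (overlapSet (surfaceGroup hg hd) K) by
    simpa using h ((tileSection (baseTile g))⁻¹ * w)
  intro w
  induction w using (quadSystem g).simple_induction_right with
  | one => exact ⟨1, baseTile g, by simp, by rw [map_one]; exact one_mem _⟩
  | mul_simple_right w s ih =>
    obtain ⟨v, i, h1, h2⟩ := ih
    set j := tilePerm g s i with hj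
    have hu : tileSection i * (quadSystem g).simple s * (tileSection j)⁻¹ ∈ tileStabilizer g := by
      rw [mem_tileStabilizer, map_mul, map_mul, Equiv.Perm.mul_apply, Equiv.Perm.mul_apply,
        tileAction_tileSection_inv, tileAction_simple, hj, tilePerm_tilePerm,
        tileAction_tileSection]
    refine ⟨v * ⟨_, hu⟩, j, ?_, ?_⟩
    · rw [← mul_assoc, h1]
      simp [mul_assoc]
    rw [map_mul]
    refine mul_mem h2 ?_
    by_cases hne : surfaceHom hg hd ⟨_, hu⟩ = 1
    · rw [hne]; exact one_mem _
    obtain ⟨p, hp⟩ := exists_side_quadPoint_eq_zero hg hd s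
    refine Subgroup.subset_closure ⟨⟨_, rfl⟩, hne, _, ⟨_, hK (mem_fundamentalRegion hg hd j p), rfl⟩,
      ?_⟩
    dsimp only
    rw [surfaceHom_smul, ← Equiv.Perm.mul_apply, ← map_mul, inv_mul_cancel_right, map_mul,
      Equiv.Perm.mul_apply, quadAction_of_mem_sideGroup hg hd (simple_mem_sideGroup hg hd hp)]
    exact hK (mem_fundamentalRegion hg hd i p)

theorem closure_overlapSet {K : Set 𝔻} (hK : fundamentalRegion hg hd ⊆ K) :
    Subgroup.closure (overlapSet (surfaceGroup hg hd) K) = surfaceGroup hg hd := by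
  refine le_antisymm ((Subgroup.closure_le _).2 fun _ h => h.1) ?_
  rintro _ ⟨w, rfl⟩
  -- Applied to this element, the decomposition must end at the base tile, and then v = w.
  obtain ⟨v, i, h1, h2⟩ := exists_eq_mul_tileSection hg hd hK (w * tileSection (baseTile g))
  have h3 : tileSection i = (v : QuadGroup g)⁻¹ * (w * tileSection (baseTile g)) :=
    eq_inv_mul_of_mul_eq h1.symm
  have h4 : tileAction g (tileSection i) (baseTile g) = baseTile g := by
    rw [h3, map_mul, map_mul, Equiv.Perm.mul_apply, Equiv.Perm.mul_apply, tileAction_tileSection,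
      mem_tileStabilizer.1 w.2, mem_tileStabilizer.1 (inv_mem v.2)]
  have h5 : i = baseTile g :=
    (tileAction g (tileSection i)).injective ((tileAction_tileSection i).trans h4.symm)
  rw [h5] at h1
  rwa [show w = v from Subtype.ext (mul_right_cancel h1)]

end

end

theorem mainTheorem8 (g : ℕ) (hg : 2 ≤ g) (ε : ℝ) (hε : 0 < ε) :
    ∃ (Γ : Subgroup DiscAut) (𝒢 : Set DiscAut) (α : DiscAut),
      IsFuchsian Γ ∧
      IsSmoothQuotient Γ ∧ CompactSpace (DiscQuotient Γ) ∧ HasGenus (DiscQuotient Γ) g ∧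
      𝒢.Finite ∧ Subgroup.closure 𝒢 = Γ ∧ (∀ γ : DiscAut, γ ∈ 𝒢 ↔ γ⁻¹ ∈ 𝒢) ∧ (1 : DiscAut) ∉ 𝒢 ∧
      α ∈ 𝒢 ∧ poincareDist 0 (α • (0 : 𝔻)) ≤ ε := by
  have hd : 0 < ε / 2 := half_pos hε
  have hF := isFuchsian_surfaceGroup hg hd
  -- Adding 0 and its image to the tiles forces the short translation into the overlap set.
  let K : Set 𝔻 := insert 0 (insert (shortElement hg hd • 0) (fundamentalRegion hg hd))
  refine ⟨surfaceGroup hg hd, overlapSet (surfaceGroup hg hd) K, shortElement hg hd, hF,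
    hF.isSmoothQuotient (surfaceGroup_free hg hd), compactSpace_discQuotient_surfaceGroup hg hd,
    hasGenus_discQuotient_surfaceGroup hg hd,
    hF.finite_overlapSet (((isCompact_fundamentalRegion hg hd).insert _).insert _),
    closure_overlapSet hg hd ((Set.subset_insert _ _).trans (Set.subset_insert _ _)),
    fun γ => ⟨inv_mem_overlapSet, fun h => inv_inv γ ▸ inv_mem_overlapSet h⟩,
    fun h => h.2.1 rfl, ⟨shortElement_mem hg hd, shortElement_ne_one hg hd, _,
      ⟨0, Set.mem_insert _ _, rfl⟩, Set.mem_insert_of_mem _ (Set.mem_insert _ _)⟩, ?_⟩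
  rw [poincareDist_shortElement]
  linarith
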